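/- \textbf{Setting.} A linear system $x_{t+1}=Ax_t+Bu_t+w_t$, $y_t=Cx_t+e_t$, $x_1=0$, with $u_t\in\mathbb R^{d_u}$, $y_t\in\mathbb R^{d_y}$ and arbitrary deterministic $w_t,e_t$, is run with a nominal linear controller $\pi_0$ driven by exogenous inputs $u^{\rm ex}_t$ and having an auxiliary output $\omega_t\in\mathbb R^{d_\omega}$: $$s_{t+1}=A_0s_t+B_0y_t+B_{\rm ex}u^{\rm ex}_t,\quad u_t=u^{\rm ex}_t+C_0s_t+D_0y_t,\quad \omega_t=C_\omega s_t+D_\omega y_t,\quad s_1=0,$$ where $d_u,d_\omega\ge1$. (Static feedback $u_t=u^{\rm ex}_t+Ky_t$ with $\omega_t=y_t$, i.e. the algorithm \textsc{Drc-Ons}, is the special case without internal state.) Put $v_t=(y_t,u_t)$. Let $v^{\rm nat}_t,\omega^{\rm nat}_t$ be the signals obtained for $u^{\rm ex}\equiv 0$, and let $G_v=(G_v^{[i]})_{i\ge0}$, $G_\omega=(G_\omega^{[i]})_{i\ge 0}$ be the Markov operators (impulse responses) of the closed loop from $u^{\rm ex}$ to $v$ and to $\omega$; so $v_t=v_t^{\rm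 nat}+\sum_{i=1}^tG_v^{[t-i]}u_i^{\rm ex}$ and likewise for $\omega$. For a Markov operator $G$ let $\psi_G(n)=\sum_{i\ge n}\|G^{[i]}\|_{\rm op}$, $\|G\|_{\ell_1,\rm op}=\psi_G(0)$, and $$\kappa(G)=\min\Big\{1,\ \inf\Big\{\sum_{n\ge0}\Big\|\sum_{i=0}^nG^{[i]}u_{n-i}\Big\|^2:\ \sum_{n\ge0}\|u_n\|^2=1\Big\}\Big\}.$$ A decay function is a non-negative non-increasing function $\psi:\mathbb N\to\mathbb R$. \textbf{Comparators.} For a linear dynamic controller $\pi$ (of any internal dimension, zero initial state) let $v^\pi_t$ be its closed-loop signal for the same $w,e$. A $\pi_0\to\pi$ conversion operator is a Markov operator $G$ such that, with $u^{{\rm ex},\pi_0\to\pi}_t=\sum_{i=1}^tG^{[t-i]}\omega_i^{\rm nat}$, one has $v_t^\pi=v_t^{\rm nat}+\sum_{i=1}^tG_v^{[t-i]}u_i^{{\rm ex},\pi_0\to\pi}$ for all $t\ge1$. Let $\Pi_\star$ be the set of all $\pi$ that have a conversion operator $G$ with $\|G\|_{\ell_1,\rm op}\le R_\star$ and $\psi_G(n)\le\psi_\star(n)$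 for all $n$, where $\psi_\star$ is a decay function. \textbf{Algorithm} (\textsc{Drc-Ons-Dyn}, known $G_v,G_\omega$; parameters $m,h\ge1$, $\eta,\lambda,R_{\mathcal M}$). Let $\mathcal M=\{M=(M^{[0]},\dots,M^{[m-1]}):M^{[i]}\in\mathbb R^{d_u\times d_\omega},\ \sum_{i<m}\|M^{[i]}\|_{\rm op}\le R_{\mathcal M}\}$, and identify $M$ with its vectorization $z\in\mathbb R^{md_ud_\omega}$. Start from any $z_1\in\mathcal M$ and $\Lambda_0=\lambda I$. In round $t=1,2,\dots$: observe $y_t,\omega_t$; recover $\omega^{\rm nat}_t=\omega_t-\sum_{i=1}^{t-1}G_\omega^{[t-i]}u^{\rm ex}_i$; play $u_t^{\rm ex}=Y_tz_t$, where $Y_t$ is the matrix with $Y_tz=\sum_{i=0}^{m-1}M^{[i]}\omega^{\rm nat}_{t-i}$ for $z\leftrightarrow M$ (with $\omega_s^{\rm nat}=0$ and $Y_s=0$ for $s\le0$); suffer $\ell_t(v_t)$ and observe $\ell_t$; recover $v^{\rm nat}_t=v_t-\sum_{i=1}^tG_v^{[t-i]}u^{\rm ex}_i$; put $H_t=\sum_{i=0}^hG_v^{[i]}Y_{t-i}$,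 $\nabla_t=H_t^\top\nabla\ell_t(v_t^{\rm nat}+H_tz_t)$, $\Lambda_t=\Lambda_{t-1}+H_t^\top H_t$, and $$z_{t+1}=\arg\min_{z\in\mathcal M}\big\|\Lambda_t^{1/2}\big(z-(z_t-\eta\Lambda_t^{-1}\nabla_t)\big)\big\|.$$ \textbf{Theorem.} There is a universal constant $C_0>0$ such that the following holds. Let $T\ge1$ and suppose that \begin{itemize} \item (losses) for some $\alpha>0$ and $L$, every $\ell_t$ is differentiable, $\alpha$-strongly convex, and $\|\nabla\ell_t(v)\|\le L\max\{1,\|v\|\}$ for all $v$; \item (stability) $R_{\pi_0}:=\max\{\|G_v\|_{\ell_1,\rm op},\|G_\omega\|_{\ell_1,\rm op}\}<\infty$, and $\psi_{\pi_0}$ is a decay function with $\psi_{G_v}\le\psi_{\pi_0}$ and $\psi_{G_\omega}\le\psi_{\pi_0}$; \item (bounded nature's iterates) $\|v_t^{\rm nat}\|,\|\omega_t^{\rm nat}\|\le R_{\rm nat}$ for all $t\ge1$, with $R_{\rm nat}\ge1$; \item (invertibility) $\kappa:=\kappa(G_v)>0$; \item (parameters) $\lambda=6hR_{\rm nat}^2R_{\pi_0}^2$,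 $\eta=1/\alpha$, $\psi_{\pi_0}(h+1)\le R_{\pi_0}/T$, $\psi_\star(m)\le cR_\star/T$ for some $c>0$, and $R_{\mathcal M}\ge\max\{1,R_\star\}$. \end{itemize} Then \textsc{Drc-Ons-Dyn} satisfies $$\sum_{t=1}^T\ell_t(v_t)-\inf_{\pi\in\Pi_\star}\sum_{t=1}^T\ell_t(v_t^\pi)\ \le\ C_0(1+c)\,(\alpha\sqrt\kappa)^{-1}\,m\,h^2\,d_u\,d_\omega\,R_{\pi_0}^3R_{\rm nat}^2R_{\mathcal M}^2L^2\log(1+T).$$ -/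

import Mathlib

open scoped Matrix.Norms.L2Operator ENNReal

noncomputable section

namespace Drc

/-- Real vectors with coordinates indexed by `ι`, with the Euclidean norm. Matrices carry the
induced operator norm throughout. -/
abbrev Vec (ι : Type) [Fintype ι] := EuclideanSpace ℝ ι

/-- Matrix-vector product on Euclidean vectors. -/
def act {ι κ : Type} [Fintype ι] [Fintype κ] (M : Matrix ι κ ℝ) (x : Vec κ) : Vec ι :=
  WithLp.toLp 2 (M.mulVec x.ofLp)

/-- The stacked vector `v = (y, u)`. -/
def joint {dy du : ℕ} (y : Vec (Fin dy)) (u : Vec (Fin du)) : Vec (Fin dy ⊕ Fin du) :=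
  WithLp.toLp 2 (Sum.elim y.ofLp u.ofLp)

/-- `trajectory step init t` is the state at the beginning of round `t`. Rounds are numbered
`1, 2, …`; round `1` starts in `init`, and round `t` is played by `step t`.
(The value at `0` is not used.) -/
def trajectory {σ : Type} (step : ℕ → σ → σ) (init : σ) : ℕ → σ
  | 0 => init
  | 1 => init
  | t + 2 => step (t + 1) (trajectory step init (t + 1))

/-! ### Systems and controllers -/

/-- The partially observed linear system
`x (t+1) = A x t + B u t + w t`, `y t = C x t + e t`, with `x 1 = 0`. -/
structure LinSys (dx dy du : ℕ) where
  A : Matrix (Fin dx) (Fin dx) ℝ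
  B : Matrix (Fin dx) (Fin du) ℝ
  C : Matrix (Fin dy) (Fin dx) ℝ

/-- A linear dynamic controller, of arbitrary internal dimension:
`s (t+1) = A s t + B y t`, `u t = C s t + D y t`, with `s 1 = 0`. -/
structure LDC (dy du : ℕ) where
  ds : ℕ
  A : Matrix (Fin ds) (Fin ds) ℝ
  B : Matrix (Fin ds) (Fin dy) ℝ
  C : Matrix (Fin du) (Fin ds) ℝ
  D : Matrix (Fin du) (Fin dy) ℝ

/-- A nominal controller `π₀`, driven by exogenous inputs `uex`, with an auxiliary output `ω`:
`s (t+1) = A s t + B y t + Bex uex t`, `u t = uex t + C s t + D y t`,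
`ω t = Cω s t + Dω y t`, with `s 1 = 0`. Static feedback `u = uex + K y` with `ω = y` is the case
`ds = 0`, `D = K`, `Dω = 1`. -/
structure NominalController (ds dy du dω : ℕ) where
  A : Matrix (Fin ds) (Fin ds) ℝ
  B : Matrix (Fin ds) (Fin dy) ℝ
  Bex : Matrix (Fin ds) (Fin du) ℝ
  C : Matrix (Fin du) (Fin ds) ℝ
  D : Matrix (Fin du) (Fin dy) ℝ
  Cω : Matrix (Fin dω) (Fin ds) ℝ
  Dω : Matrix (Fin dω) (Fin dy) ℝ

section ClosedLoops

variable {dx ds dy du dω : ℕ}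

/-- States `(x t, s t)` when the system is controlled by the linear dynamic controller `π`. -/
def policyState (S : LinSys dx dy du) (π : LDC dy du) (w : ℕ → Vec (Fin dx))
    (e : ℕ → Vec (Fin dy)) : ℕ → Vec (Fin dx) × Vec (Fin π.ds) :=
  trajectory
    (fun t p =>
      let y := act S.C p.1 + e t
      let u := act π.C p.2 + act π.D y
      (act S.A p.1 + act S.B u + w t, act π.A p.2 + act π.B y))
    (0, 0)

/-- `v^π t = (y^π t, u^π t)`. -/
def policyIterate (S : LinSys dx dy du) (π : LDC dy du) (w : ℕ → Vec (Fin dx))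
    (e : ℕ → Vec (Fin dy)) (t : ℕ) : Vec (Fin dy ⊕ Fin du) :=
  let p := policyState S π w e t
  let y := act S.C p.1 + e t
  joint y (act π.C p.2 + act π.D y)

/-- States `(x t, s t)` under the nominal controller, without exogenous input. -/
def natState (S : LinSys dx dy du) (π₀ : NominalController ds dy du dω) (w : ℕ → Vec (Fin dx))
    (e : ℕ → Vec (Fin dy)) : ℕ → Vec (Fin dx) × Vec (Fin ds) :=
  trajectory
    (fun t p =>
      let y := act S.C p.1 + e t
      let u := act π₀.C p.2 + act π₀.D y
      (act S.A p.1 + act S.B u + w t, act π₀.A p.2 + act π₀.B y))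
    (0, 0)

/-- Nature's iterates `v^nat t = (y^nat t, u^nat t)`. -/
def vNat (S : LinSys dx dy du) (π₀ : NominalController ds dy du dω) (w : ℕ → Vec (Fin dx))
    (e : ℕ → Vec (Fin dy)) (t : ℕ) : Vec (Fin dy ⊕ Fin du) :=
  let p := natState S π₀ w e t
  let y := act S.C p.1 + e t
  joint y (act π₀.C p.2 + act π₀.D y)

/-- Nature's iterates `ω^nat t`. -/
def omegaNat (S : LinSys dx dy du) (π₀ : NominalController ds dy du dω) (w : ℕ → Vec (Fin dx))
    (e : ℕ → Vec (Fin dy)) (t : ℕ) : Vec (Fin dω) :=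
  let p := natState S π₀ w e t
  act π₀.Cω p.2 + act π₀.Dω (act S.C p.1 + e t)

/-! ### Markov operators -/

/-- State matrix of the loop formed by the system and the nominal controller. -/
def loopA (S : LinSys dx dy du) (π₀ : NominalController ds dy du dω) :
    Matrix (Fin dx ⊕ Fin ds) (Fin dx ⊕ Fin ds) ℝ :=
  Matrix.fromBlocks (S.A + S.B * π₀.D * S.C) (S.B * π₀.C) (π₀.B * S.C) π₀.A

/-- Input matrix, from `uex`, of that loop. -/
def loopB (S : LinSys dx dy du) (π₀ : NominalController ds dy du dω) :
    Matrix (Fin dx ⊕ Fin ds) (Fin du) ℝ :=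
  Matrix.fromRows S.B π₀.Bex

/-- The Markov operator (impulse response) from `uex` to `v = (y, u)`. -/
def markovV (S : LinSys dx dy du) (π₀ : NominalController ds dy du dω) :
    ℕ → Matrix (Fin dy ⊕ Fin du) (Fin du) ℝ
  | 0 => Matrix.fromRows 0 1
  | i + 1 =>
      Matrix.fromBlocks S.C 0 (π₀.D * S.C) π₀.C * loopA S π₀ ^ i * loopB S π₀

/-- The Markov operator (impulse response) from `uex` to `ω`. -/
def markovOmega (S : LinSys dx dy du) (π₀ : NominalController ds dy du dω) :
    ℕ → Matrix (Fin dω) (Fin du) ℝ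
  | 0 => 0
  | i + 1 => Matrix.fromCols (π₀.Dω * S.C) π₀.Cω * loopA S π₀ ^ i * loopB S π₀

end ClosedLoops

section Operators

variable {ι κ : Type} [Fintype ι] [Fintype κ] [DecidableEq ι] [DecidableEq κ]

/-- The decay function `ψ_G(n) = ∑_{i ≥ n} ‖G i‖_op`, as an extended real. -/
def decay (G : ℕ → Matrix ι κ ℝ) (n : ℕ) : ℝ≥0∞ := ∑' i, ‖G (n + i)‖ₑ

/-- `‖G‖_{ℓ₁,op} = ∑_i ‖G i‖_op`, as an extended real. -/
def l1op (G : ℕ → Matrix ι κ ℝ) : ℝ≥0∞ := ∑' i, ‖G i‖ₑ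

/-- The invertibility modulus
`κ(G) = min {1, inf {∑_n ‖∑_{i ≤ n} G i u (n - i)‖² : ∑_n ‖u n‖² = 1}}`. -/
def invModulus (G : ℕ → Matrix ι κ ℝ) : ℝ :=
  (min 1 (⨅ (u : ℕ → Vec κ) (_ : ∑' n, ‖u n‖ₑ ^ 2 = 1),
    ∑' n, ‖∑ i ∈ Finset.range (n + 1), act (G i) (u (n - i))‖ₑ ^ 2)).toReal

end Operators

/-- Proper, stable decay functions. -/
def IsDecayFunction (ψ : ℕ → ℝ) : Prop := (∀ n, 0 ≤ ψ n) ∧ Antitone ψ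

/-- `R_{π₀} = max {‖G_{ex→v}‖_{ℓ₁,op}, ‖G_{ex→ω}‖_{ℓ₁,op}}`, as an extended real. -/
def nominalRadius {dx ds dy du dω : ℕ} (S : LinSys dx dy du)
    (π₀ : NominalController ds dy du dω) : ℝ≥0∞ :=
  max (l1op (markovV S π₀)) (l1op (markovOmega S π₀))

/-- Cost regularity: `ℓ` is differentiable, `α`-strongly convex, and
`‖∇ℓ(v)‖ ≤ L max {1, ‖v‖}`. -/
def LossRegular {ι : Type} [Fintype ι] (α L : ℝ) (ℓ : Vec ι → ℝ) : Prop :=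
  Differentiable ℝ ℓ ∧ StrongConvexOn Set.univ α ℓ ∧ ∀ v, ‖gradient ℓ v‖ ≤ L * max 1 ‖v‖

/-! ### The policy benchmark -/

section Benchmark

variable {dx ds dy du dω : ℕ}

/-- `G` is a `π₀ → π` conversion operator: the exogenous inputs
`uex t = ∑_{i=1}^t G (t - i) ω^nat i` on top of `π₀` reproduce the iterates of `π`. -/
def IsConversion (S : LinSys dx dy du) (π₀ : NominalController ds dy du dω)
    (w : ℕ → Vec (Fin dx)) (e : ℕ → Vec (Fin dy)) (π : LDC dy du)
    (G : ℕ → Matrix (Fin du) (Fin dω) ℝ) : Prop :=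
  let uex : ℕ → Vec (Fin du) := fun t =>
    ∑ i ∈ Finset.Icc 1 t, act (G (t - i)) (omegaNat S π₀ w e i)
  ∀ t, 1 ≤ t → policyIterate S π w e t =
    vNat S π₀ w e t + ∑ i ∈ Finset.Icc 1 t, act (markovV S π₀ (t - i)) (uex i)

/-- The comparator class `Π_{stab,π₀}(R, ψ)`. -/
def comparators (S : LinSys dx dy du) (π₀ : NominalController ds dy du dω)
    (w : ℕ → Vec (Fin dx)) (e : ℕ → Vec (Fin dy)) (R : ℝ) (ψ : ℕ → ℝ) : Set (LDC dy du) :=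
  {π | ∃ G, IsConversion S π₀ w e π G ∧ l1op G ≤ ENNReal.ofReal R ∧
    ∀ n, decay G n ≤ ENNReal.ofReal (ψ n)}

end Benchmark

/-! ### The algorithm -/

/-- Index set of the coordinates of the vectorized controller parameter `z = 𝔢(M)`,
`M = (M 0, …, M (m-1))` with each `M i` of size `du × dω`. -/
abbrev PIdx (m du dω : ℕ) := Fin m × Fin du × Fin dω

/-- The matrix `M i` encoded by `z`. -/
def block {m du dω : ℕ} (z : Vec (PIdx m du dω)) (i : Fin m) :
    Matrix (Fin du) (Fin dω) ℝ :=
  Matrix.of fun a b => z (i, a, b)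

/-- The constraint set `{M : ∑_{i<m} ‖M i‖_op ≤ R}`, in vectorized form. -/
def paramSet (m du dω : ℕ) (R : ℝ) : Set (Vec (PIdx m du dω)) :=
  {z | ∑ i, ‖block z i‖ ≤ R}

/-- The matrix `Y t` with `Y t · 𝔢(M) = ∑_{i<m} M i (ω (t - i))`, where `ω s = 0` for `s ≤ 0`. -/
def embed {du dω : ℕ} (m : ℕ) (ω : ℕ → Vec (Fin dω)) (t : ℕ) :
    Matrix (Fin du) (PIdx m du dω) ℝ :=
  Matrix.of fun a p => if a = p.2.1 ∧ (p.1 : ℕ) < t then ω (t - p.1) p.2.2 else 0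

/-- A minimizer over `K` of `z ↦ ‖Λ^{1/2} (z - p)‖² = (z - p)ᵀ Λ (z - p)`. -/
def projOn {ι : Type} [Fintype ι] (K : Set (Vec ι)) (Λ : Matrix ι ι ℝ) (p : Vec ι) : Vec ι :=
  Classical.epsilon fun z => z ∈ K ∧
    ∀ z' ∈ K, inner ℝ (z - p) (act Λ (z - p)) ≤ inner ℝ (z' - p) (act Λ (z' - p))

/-- Inputs of the algorithm: DRC length `m`, memory `h`, step size `η`, regularization `lam`,
radius `RM`, and the two Markov operators. -/
structure AlgInput (dy du dω : ℕ) where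
  m : ℕ
  h : ℕ
  η : ℝ
  lam : ℝ
  RM : ℝ
  Gv : ℕ → Matrix (Fin dy ⊕ Fin du) (Fin du) ℝ
  Gω : ℕ → Matrix (Fin dω) (Fin du) ℝ

/-- Memory of the algorithm at the beginning of a round: past exogenous inputs, past recovered
`ω^nat`, the current parameter `z`, and `Λ`. -/
structure AlgState (m du dω : ℕ) where
  uex : ℕ → Vec (Fin du)
  omegaHat : ℕ → Vec (Fin dω)
  z : Vec (PIdx m du dω)
  Lam : Matrix (PIdx m du dω) (PIdx m du dω) ℝ

section Algorithm

variable {dx ds dy du dω : ℕ}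

/-- Memory before the first round, for the initial parameter `z₁`: `Λ = lam I`. -/
def algInit (P : AlgInput dy du dω) (z₁ : Vec (PIdx P.m du dω)) : AlgState P.m du dω where
  uex := 0
  omegaHat := 0
  z := z₁
  Lam := P.lam • 1

/-- First half of round `t`. After observing `ω t`, the algorithm records
`ω^nat t = ω t - ∑_{i=1}^{t-1} Gω (t - i) uex i` and the exogenous input
`uex t = Y t z = ∑_{i<m} M i ω^nat (t - i)`. -/
def algPlay (P : AlgInput dy du dω) (t : ℕ) (a : AlgState P.m du dω) (ω : Vec (Fin dω)) :
    AlgState P.m du dω :=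
  let ωhat := ω - ∑ i ∈ Finset.Ico 1 t, act (P.Gω (t - i)) (a.uex i)
  let omegaHat := Function.update a.omegaHat t ωhat
  { a with
    omegaHat := omegaHat
    uex := Function.update a.uex t (act (embed P.m omegaHat t) a.z) }

/-- Second half of round `t`. After observing `v t = (y t, u t)` and the loss `ℓ`, the algorithm
recovers `v^nat t = v t - ∑_{i=1}^t Gv (t - i) uex i`, forms `H t = ∑_{i=0}^h Gv i Y (t - i)` and
the loss `f(z) = ℓ (v^nat t + H t z)`, and takes a semi-Newton step:
`Λ ← Λ + H tᵀ H t`, followed by the `Λ`-projection of `z - η Λ⁻¹ ∇f(z)` onto the constraint set. -/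
def algUpdate (P : AlgInput dy du dω) (t : ℕ) (a : AlgState P.m du dω)
    (v : Vec (Fin dy ⊕ Fin du)) (ℓ : Vec (Fin dy ⊕ Fin du) → ℝ) : AlgState P.m du dω :=
  let vhat := v - ∑ i ∈ Finset.Icc 1 t, act (P.Gv (t - i)) (a.uex i)
  let H : Matrix (Fin dy ⊕ Fin du) (PIdx P.m du dω) ℝ :=
    ∑ i ∈ Finset.range (P.h + 1), P.Gv i * embed P.m a.omegaHat (t - i)
  let Lam := a.Lam + H.transpose * H
  let grad := gradient (fun z : Vec (PIdx P.m du dω) => ℓ (vhat + act H z)) a.z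
  { a with
    Lam := Lam
    z := projOn (paramSet P.m du dω P.RM) Lam (a.z - P.η • act Lam⁻¹ grad) }

/-- System, nominal controller and algorithm at the beginning of a round. -/
structure LoopState (dx ds m du dω : ℕ) where
  x : Vec (Fin dx)
  s : Vec (Fin ds)
  alg : AlgState m du dω

/-- The output `y t`, the memory after `algPlay`, and the input `u t` of round `t`. -/
def loopRound (S : LinSys dx dy du) (π₀ : NominalController ds dy du dω)
    (e : ℕ → Vec (Fin dy)) (P : AlgInput dy du dω) (t : ℕ) (p : LoopState dx ds P.m du dω) :
    Vec (Fin dy) × AlgState P.m du dω × Vec (Fin du) :=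
  let y := act S.C p.x + e t
  let a := algPlay P t p.alg (act π₀.Cω p.s + act π₀.Dω y)
  (y, a, a.uex t + act π₀.C p.s + act π₀.D y)

/-- The algorithm in closed loop with the system and the nominal controller. -/
def loopState (S : LinSys dx dy du) (π₀ : NominalController ds dy du dω)
    (w : ℕ → Vec (Fin dx)) (e : ℕ → Vec (Fin dy))
    (ℓ : ℕ → Vec (Fin dy ⊕ Fin du) → ℝ) (P : AlgInput dy du dω)
    (z₁ : Vec (PIdx P.m du dω)) : ℕ → LoopState dx ds P.m du dω :=
  trajectory
    (fun t p =>
      let r := loopRound S π₀ e P t p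
      let y := r.1
      let a := r.2.1
      let u := r.2.2
      { x := act S.A p.x + act S.B u + w t
        s := act π₀.A p.s + act π₀.B y + act π₀.Bex (a.uex t)
        alg := algUpdate P t a (joint y u) (ℓ t) })
    ⟨0, 0, algInit P z₁⟩

/-- `v^alg t = (y^alg t, u^alg t)`. -/
def algIterate (S : LinSys dx dy du) (π₀ : NominalController ds dy du dω)
    (w : ℕ → Vec (Fin dx)) (e : ℕ → Vec (Fin dy))
    (ℓ : ℕ → Vec (Fin dy ⊕ Fin du) → ℝ) (P : AlgInput dy du dω)
    (z₁ : Vec (PIdx P.m du dω)) (t : ℕ) : Vec (Fin dy ⊕ Fin du) :=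
  let r := loopRound S π₀ e P t (loopState S π₀ w e ℓ P z₁ t)
  joint r.1 r.2.2

/-- `ControlReg_T(alg; Π) = ∑_{t ≤ T} ℓ_t(v t) - inf_{π ∈ Π} ∑_{t ≤ T} ℓ_t(v^π t)`, as an extended
real (the infimum over the empty class is `+∞`). -/
def controlReg (S : LinSys dx dy du) (w : ℕ → Vec (Fin dx)) (e : ℕ → Vec (Fin dy))
    (ℓ : ℕ → Vec (Fin dy ⊕ Fin du) → ℝ) (T : ℕ) (v : ℕ → Vec (Fin dy ⊕ Fin du))
    (Pol : Set (LDC dy du)) : EReal :=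
  ((∑ t ∈ Finset.Icc 1 T, ℓ t (v t) : ℝ) : EReal) -
    ⨅ π ∈ Pol, ((∑ t ∈ Finset.Icc 1 T, ℓ t (policyIterate S π w e t) : ℝ) : EReal)

end Algorithm

end Drc

end

/-! Write `z t` for the parameter played in round `t`, `κ` for the invertibility modulus of `G_v`,
`ρ` for `R_{π₀}`, and `Λ_t = λI + ∑_{s≤t} H_sᵀH_s`. By linearity the algorithm recovers nature's
iterates exactly, so the regret splits into three parts: the loss of the played iterates against the
memoryless iterates `v^nat_t + H_t z_t`, the regret of the memoryless iterates against a fixed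
parameter, and the error of representing a comparator by a fixed parameter. The third is `O(1)` by
truncation (`exists_param_approx`). The second is the online Newton analysis: with `η = 1/α`, strong
convexity in `v` supplies exactly the term `-(α/2)‖H_t(z_t - x)‖²` that pays for the growth of
`Λ_t`, and the rest is the log-determinant potential (`IsNewtonRun.regret_le`,
`sum_memoryless_sub_le`).

The difficulty is the first part, which needs `‖Y_r(z_r - z_t)‖` for `r ≤ t ≤ r + h`. A Newton step
is short in the norm of `Λ`, which is built from the convolved features `H`, whereas the memory
error sees the raw `Y_r`. Invertibility compares the two: for fixed `x`, the energy of `s ↦ Y_s x`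
is at most `1/κ` times that of its convolution with `G_v`. This concerns complete finite-energy
signals, while only a prefix up to round `r` is available. A cutoff that decreases slowly over the
next `K ≈ 6hρ/√κ` rounds makes the commutator error small, but the inequality then involves rounds
up to `r + K` (`invModulus_mul_sum_le_truncated`).

Consider therefore the joint matrix `S_t = Λ_t + (κ/9)∑_{s≤t} Y_sᵀY_s`. Call `r` settled if `S_{r+K}
≤ 2S_r`. In settled rounds the look-ahead is harmless and `S_r ≤ 2Λ_r` follows (`quad_jointSum_le`).
Movement is then bounded by the product of a leverage of `Y_r` in `S_r`, which sums to `O(D/κ)`, and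
a leverage of `H_s` in `Λ_s`, which sums to `O(D)`, where `D = m d_u d_ω log(1+T)`. A weighted AM-GM
gives the rate `D/√κ` (`norm_act_movement_le`). In an unsettled round some direction doubles within
`K` rounds, which raises `log det S` by at least `1/2`; hence there are at most `K + 2KD` such
rounds (`card_isUnsettled_le`), and there the trivial bound on `Y_r z` suffices.
`sum_norm_memory_le` adds everything up. -/

namespace Drc

/-! ### Matrices acting on Euclidean vectors -/

section Act

variable {ι κ μ : Type} [Fintype ι] [Fintype κ] [Fintype μ]

@[simp] lemma act_add (M : Matrix ι κ ℝ) (x y : Vec κ) : act M (x + y) = act M x + act M y := by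
  ext i; simp [act, Matrix.mulVec_add]

@[simp] lemma act_sub (M : Matrix ι κ ℝ) (x y : Vec κ) : act M (x - y) = act M x - act M y := by
  ext i; simp [act, Matrix.mulVec_sub]

@[simp] lemma act_neg (M : Matrix ι κ ℝ) (x : Vec κ) : act M (-x) = -act M x := by
  ext i; simp [act, Matrix.mulVec_neg]

@[simp] lemma act_smul (M : Matrix ι κ ℝ) (c : ℝ) (x : Vec κ) : act M (c • x) = c • act M x := by
  ext i; simp [act, Matrix.mulVec_smul]

@[simp] lemma act_zero (M : Matrix ι κ ℝ) : act M (0 : Vec κ) = 0 := by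
  ext i; simp [act]

lemma act_sum {σ : Type} (M : Matrix ι κ ℝ) (s : Finset σ) (f : σ → Vec κ) :
    act M (∑ i ∈ s, f i) = ∑ i ∈ s, act M (f i) := by
  classical
  induction s using Finset.induction_on with
  | empty => simp
  | insert a s ha ih => simp [Finset.sum_insert ha, ih]

@[simp] lemma zero_act (x : Vec κ) : act (0 : Matrix ι κ ℝ) x = 0 := by
  ext i; simp [act]

@[simp] lemma add_act (M N : Matrix ι κ ℝ) (x : Vec κ) : act (M + N) x = act M x + act N x := by
  ext i; simp [act, Matrix.add_mulVec]

@[simp] lemma smul_act (c : ℝ) (M : Matrix ι κ ℝ) (x : Vec κ) : act (c • M) x = c • act M x := by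
  ext i; simp [act, Matrix.smul_mulVec]

lemma sum_act {σ : Type} (s : Finset σ) (f : σ → Matrix ι κ ℝ) (x : Vec κ) :
    act (∑ i ∈ s, f i) x = ∑ i ∈ s, act (f i) x := by
  classical
  induction s using Finset.induction_on with
  | empty => simp
  | insert a s ha ih => simp [Finset.sum_insert ha, ih]

lemma mul_act (M : Matrix ι κ ℝ) (N : Matrix κ μ ℝ) (x : Vec μ) :
    act (M * N) x = act M (act N x) := by
  ext i; simp [act, Matrix.mulVec_mulVec]

@[simp] lemma one_act [DecidableEq ι] (x : Vec ι) : act (1 : Matrix ι ι ℝ) x = x := by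
  ext i; simp [act]

lemma inner_act (M : Matrix ι κ ℝ) (x : Vec ι) (y : Vec κ) :
    inner ℝ x (act M y) = inner ℝ (act M.transpose x) y := by
  simp [act, EuclideanSpace.inner_eq_star_dotProduct, Matrix.mulVec_transpose,
    dotProduct_comm _ x.ofLp, dotProduct_comm y.ofLp, Matrix.dotProduct_mulVec]

lemma norm_act_le [DecidableEq ι] [DecidableEq κ] (M : Matrix ι κ ℝ) (x : Vec κ) :
    ‖act M x‖ ≤ ‖M‖ * ‖x‖ :=
  Matrix.l2_opNorm_mulVec M x

lemma continuous_act (M : Matrix ι κ ℝ) : Continuous (act M) := by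
  unfold act; fun_prop

end Act

/-! ### Quadratic forms, trace bounds and concavity of `log det` -/

section Quadratic

variable {ι κ : Type} [Fintype ι] [Fintype κ]

/-- The quadratic form `xᵀ S x`. -/
noncomputable def quad (S : Matrix ι ι ℝ) (x : Vec ι) : ℝ := inner ℝ x (act S x)

lemma quad_transpose_mul_self (P : Matrix κ ι ℝ) (x : Vec ι) :
    quad (P.transpose * P) x = ‖act P x‖ ^ 2 := by
  rw [quad, mul_act, inner_act, Matrix.transpose_transpose, real_inner_self_eq_norm_sq]

lemma quad_add_matrix (S R : Matrix ι ι ℝ) (x : Vec ι) : quad (S + R) x = quad S x + quad R x := by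
  simp [quad, inner_add_right]

lemma quad_smul_matrix (c : ℝ) (S : Matrix ι ι ℝ) (x : Vec ι) : quad (c • S) x = c * quad S x := by
  simp [quad, inner_smul_right]

lemma quad_sum_matrix {σ : Type} (s : Finset σ) (f : σ → Matrix ι ι ℝ) (x : Vec ι) :
    quad (∑ i ∈ s, f i) x = ∑ i ∈ s, quad (f i) x := by
  simp [quad, sum_act, inner_sum]

lemma quad_one [DecidableEq ι] (x : Vec ι) : quad (1 : Matrix ι ι ℝ) x = ‖x‖ ^ 2 := by
  simp [quad]

lemma quad_eq_dotProduct (S : Matrix ι ι ℝ) (x : Vec ι) :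
    quad S x = x.ofLp ⬝ᵥ S.mulVec x.ofLp := by
  simp [quad, act, EuclideanSpace.inner_eq_star_dotProduct, dotProduct_comm]

lemma posSemidef_iff_quad (S : Matrix ι ι ℝ) :
    S.PosSemidef ↔ S.transpose = S ∧ ∀ x, 0 ≤ quad S x := by
  rw [Matrix.posSemidef_iff_dotProduct_mulVec, Matrix.IsHermitian,
    Matrix.conjTranspose_eq_transpose_of_trivial]
  refine and_congr_right fun _ => ⟨fun h x => ?_, fun h x => ?_⟩
  · rw [quad_eq_dotProduct]; simpa using h x.ofLp
  · simpa [quad_eq_dotProduct] using h (WithLp.toLp 2 x)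

open scoped MatrixOrder in
lemma exists_transpose_mul_self {S : Matrix ι ι ℝ} (hS : S.PosSemidef) :
    ∃ R : Matrix ι ι ℝ, S = R.transpose * R := by
  classical
  obtain ⟨R, hR⟩ := CStarAlgebra.nonneg_iff_eq_star_mul_self.mp hS.nonneg
  exact ⟨R, by simpa [Matrix.star_eq_conjTranspose] using hR⟩

lemma trace_mul_transpose_mul_self (A : Matrix ι ι ℝ) (P : Matrix κ ι ℝ) :
    (A * (P.transpose * P)).trace = ∑ k, quad A (WithLp.toLp 2 (P k)) := by
  rw [← Matrix.mul_assoc, Matrix.trace_mul_comm, ← Matrix.mul_assoc, Matrix.trace]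
  refine Finset.sum_congr rfl fun k _ => ?_
  rw [quad_eq_dotProduct]
  simp [Matrix.mul_apply, Matrix.mulVec, dotProduct, Finset.mul_sum, Finset.sum_mul]
  rw [Finset.sum_comm]
  exact Finset.sum_congr rfl fun i _ => Finset.sum_congr rfl fun j _ => by ring

lemma quad_nonneg_of_posSemidef {S : Matrix ι ι ℝ} (hS : S.PosSemidef) (x : Vec ι) : 0 ≤ quad S x :=
  ((posSemidef_iff_quad S).1 hS).2 x

variable [DecidableEq ι]

/-- Cauchy-Schwarz for a positive definite form and its inverse. -/
lemma inner_sq_le_quad_inv_mul {S : Matrix ι ι ℝ} (hS : S.PosDef) (p x : Vec ι) :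
    inner ℝ p x ^ 2 ≤ quad S⁻¹ p * quad S x := by
  obtain ⟨R, hR⟩ := exists_transpose_mul_self hS.posSemidef
  have hp : p = act S (act S⁻¹ p) := by
    rw [← mul_act, Matrix.mul_nonsing_inv _ ((Matrix.isUnit_iff_isUnit_det _).1 hS.isUnit), one_act]
  have h1 : quad S⁻¹ p = ‖act R (act S⁻¹ p)‖ ^ 2 := by
    rw [← quad_transpose_mul_self, ← hR, quad, quad, ← hp, real_inner_comm]
  have h2 : quad S x = ‖act R x‖ ^ 2 := by rw [← quad_transpose_mul_self, ← hR]
  have h3 : inner ℝ p x = inner ℝ (act R (act S⁻¹ p)) (act R x) := by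
    rw [inner_act, ← mul_act, ← hR, ← hp]
  rw [h1, h2, h3, ← mul_pow]
  exact sq_le_sq' (by
    have := abs_real_inner_le_norm (act R (act S⁻¹ p)) (act R x)
    rw [abs_le] at this; exact this.1) (real_inner_le_norm _ _)

/-- `‖P x‖² ≤ tr (S⁻¹ Pᵀ P) · xᵀ S x`. -/
lemma norm_act_sq_le_trace_mul_quad {S : Matrix ι ι ℝ} (hS : S.PosDef) (P : Matrix κ ι ℝ)
    (x : Vec ι) :
    ‖act P x‖ ^ 2 ≤ (S⁻¹ * (P.transpose * P)).trace * quad S x := by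
  -- Both sides are sums over the rows of `P`, and Cauchy-Schwarz applies to each row.
  rw [trace_mul_transpose_mul_self, EuclideanSpace.real_norm_sq_eq, Finset.sum_mul]
  refine Finset.sum_le_sum fun k _ => ?_
  have h : (act P x) k = inner ℝ (WithLp.toLp 2 (P k) : Vec ι) x := by
    simp [act, EuclideanSpace.inner_eq_star_dotProduct, Matrix.mulVec, dotProduct_comm]
  rw [h]
  exact inner_sq_le_quad_inv_mul hS _ _

lemma trace_inv_mul_nonneg {S : Matrix ι ι ℝ} (hS : S.PosDef) (P : Matrix κ ι ℝ) :
    0 ≤ (S⁻¹ * (P.transpose * P)).trace := by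
  rw [trace_mul_transpose_mul_self]
  exact Finset.sum_nonneg fun k _ => quad_nonneg_of_posSemidef hS.inv.posSemidef _

/-- `log det` is concave. -/
lemma log_det_sub_le_trace {A B : Matrix ι ι ℝ} (hA : A.PosDef) (hB : B.PosDef) :
    Real.log B.det - Real.log A.det ≤ (A⁻¹ * B).trace - Fintype.card ι := by
  obtain ⟨R, hR⟩ := exists_transpose_mul_self hA.posSemidef
  have hdet : A.det = R.det * R.det := by rw [hR, Matrix.det_mul, Matrix.det_transpose]
  have hApos := hA.det_pos
  have hRdet : R.det ≠ 0 := by rintro h; rw [hdet, h] at hApos; simp at hApos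
  have hRu : IsUnit R.det := hRdet.isUnit
  -- Congruence by `Q` turns `A` into the identity, so the claim becomes `log μ ≤ μ - 1` summed over
  -- the eigenvalues of `QᵀBQ`.
  set Q := R⁻¹ with hQ
  have hM : (Q.transpose * B * Q).PosDef := by
    have := hB.conjTranspose_mul_mul_same (B := Q) (by
      apply Matrix.mulVec_injective_of_isUnit
      rw [Matrix.isUnit_iff_isUnit_det, hQ]
      exact Matrix.isUnit_nonsing_inv_det R hRu)
    simpa using this
  have hAinv : A⁻¹ = Q * Q.transpose := by
    rw [hR, Matrix.mul_inv_rev, hQ, Matrix.transpose_nonsing_inv]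
  have htr : (A⁻¹ * B).trace = (Q.transpose * B * Q).trace := by
    rw [hAinv, Matrix.mul_assoc, Matrix.trace_mul_comm]
  have hdetM : Real.log (Q.transpose * B * Q).det = Real.log B.det - Real.log A.det := by
    rw [← Real.log_div hB.det_pos.ne' hApos.ne', hdet]
    congr 1
    rw [Matrix.det_mul, Matrix.det_mul, Matrix.det_transpose, hQ, Matrix.det_nonsing_inv,
      Ring.inverse_eq_inv']
    field_simp
  rw [htr, ← hdetM, hM.1.det_eq_prod_eigenvalues, hM.1.trace_eq_sum_eigenvalues]
  simp only [RCLike.ofReal_real_eq_id, id]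
  rw [Real.log_prod (fun i _ => (hM.eigenvalues_pos i).ne'), ← Finset.card_univ,
    Finset.card_eq_sum_ones, Nat.cast_sum, ← Finset.sum_sub_distrib]
  refine Finset.sum_le_sum fun i _ => ?_
  simpa using Real.log_le_sub_one_of_pos (hM.eigenvalues_pos i)

end Quadratic

/-! ### The log-determinant potential and the count of unsettled rounds -/

section Potential

variable {ι : Type} [Fintype ι] [DecidableEq ι]

lemma trace_inv_mul_nonneg_of_posSemidef {S W : Matrix ι ι ℝ} (hS : S.PosDef)
    (hW : W.PosSemidef) : 0 ≤ (S⁻¹ * W).trace := by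
  obtain ⟨P, rfl⟩ := exists_transpose_mul_self hW
  exact trace_inv_mul_nonneg hS P

lemma quad_le_trace_mul_quad {S W : Matrix ι ι ℝ} (hS : S.PosDef) (hW : W.PosSemidef)
    (x : Vec ι) : quad W x ≤ (S⁻¹ * W).trace * quad S x := by
  obtain ⟨P, rfl⟩ := exists_transpose_mul_self hW
  rw [quad_transpose_mul_self]
  exact norm_act_sq_le_trace_mul_quad hS P x

/-- This is the tangent inequality of `log det` at `A + W`, evaluated at `A`, where `tr((A+W)⁻¹A)`
equals the dimension minus `tr((A+W)⁻¹W)`. -/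
lemma log_det_add_trace_le {A W : Matrix ι ι ℝ} (hA : A.PosDef) (hW : W.PosSemidef) :
    Real.log A.det + ((A + W)⁻¹ * W).trace ≤ Real.log (A + W).det := by
  have hB : (A + W).PosDef := hA.add_posSemidef hW
  have h := log_det_sub_le_trace hB hA
  have h1 : ((A + W)⁻¹ * A).trace + ((A + W)⁻¹ * W).trace = Fintype.card ι := by
    rw [← Matrix.trace_add, ← Matrix.mul_add,
      Matrix.nonsing_inv_mul _ ((Matrix.isUnit_iff_isUnit_det _).1 hB.isUnit), Matrix.trace_one]
  linarith

/-- If the form doubles along `x`, then `W` carries more than half of `A + W` there, which forces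
`tr((A+W)⁻¹W) ≥ 1/2`. A single direction thus already yields a constant gain in the potential. -/
lemma log_det_add_half_le {A W : Matrix ι ι ℝ} (hA : A.PosDef) (hW : W.PosSemidef) {x : Vec ι}
    (hx : 2 * quad A x < quad (A + W) x) :
    Real.log A.det + 1 / 2 ≤ Real.log (A + W).det := by
  have hB : (A + W).PosDef := hA.add_posSemidef hW
  have h1 := log_det_add_trace_le hA hW
  have h2 := quad_le_trace_mul_quad hB hW x
  have h3 := quad_nonneg_of_posSemidef hA.posSemidef x
  have h4 : 0 < quad (A + W) x := by linarith
  rw [quad_add_matrix] at hx h2 h4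
  have : (1 / 2 : ℝ) ≤ ((A + W)⁻¹ * W).trace := by
    by_contra hlt
    push Not at hlt
    have := mul_lt_mul_of_pos_right hlt h4
    linarith
  linarith

/-- The regularized sum `lam I + W 0 + ⋯ + W t`. -/
noncomputable def regSum (lam : ℝ) (W : ℕ → Matrix ι ι ℝ) (t : ℕ) : Matrix ι ι ℝ :=
  lam • 1 + ∑ s ∈ Finset.range (t + 1), W s

variable {lam : ℝ} {W : ℕ → Matrix ι ι ℝ}

omit [Fintype ι] in
lemma posDef_regSum (hlam : 0 < lam) (hW : ∀ t, (W t).PosSemidef) (t : ℕ) :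
    (regSum lam W t).PosDef :=
  (Matrix.PosDef.one.smul hlam).add_posSemidef (Matrix.posSemidef_sum _ fun s _ => hW s)

omit [Fintype ι] in
lemma regSum_succ (t : ℕ) : regSum lam W (t + 1) = regSum lam W t + W (t + 1) := by
  rw [regSum, Finset.sum_range_succ, ← add_assoc, regSum]

omit [Fintype ι] in
lemma regSum_add (t k : ℕ) :
    regSum lam W (t + k) = regSum lam W t + ∑ j ∈ Finset.range k, W (t + 1 + j) := by
  rw [regSum, regSum, add_right_comm t k 1, Finset.sum_range_add, add_assoc]

lemma quad_regSum (t : ℕ) (x : Vec ι) :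
    quad (regSum lam W t) x = lam * ‖x‖ ^ 2 + ∑ s ∈ Finset.range (t + 1), quad (W s) x := by
  rw [regSum, quad_add_matrix, quad_smul_matrix, quad_one, quad_sum_matrix]

lemma quad_regSum_mono (hW : ∀ t, (W t).PosSemidef) {s t : ℕ} (hst : s ≤ t) (x : Vec ι) :
    quad (regSum lam W s) x ≤ quad (regSum lam W t) x := by
  obtain ⟨k, rfl⟩ := Nat.exists_eq_add_of_le hst
  rw [regSum_add, quad_add_matrix, quad_sum_matrix]
  linarith [Finset.sum_nonneg fun j (_ : j ∈ Finset.range k) =>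
    quad_nonneg_of_posSemidef (hW (s + 1 + j)) x]

lemma sum_trace_inv_mul_le (hlam : 0 < lam) (hW : ∀ t, (W t).PosSemidef) (n : ℕ) :
    ∑ t ∈ Finset.range (n + 1), ((regSum lam W t)⁻¹ * W t).trace ≤
      Real.log (regSum lam W n).det - Real.log (lam • (1 : Matrix ι ι ℝ)).det := by
  induction n with
  | zero =>
    have := log_det_add_trace_le (Matrix.PosDef.one.smul hlam) (hW 0)
    simp only [zero_add, Finset.sum_range_one, regSum]
    linarith
  | succ n ih =>
    have := log_det_add_trace_le (posDef_regSum hlam hW n) (hW (n + 1))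
    rw [Finset.sum_range_succ, regSum_succ]
    linarith

lemma log_det_regSum_mono (hlam : 0 < lam) (hW : ∀ t, (W t).PosSemidef) :
    Monotone fun t => Real.log (regSum lam W t).det := by
  refine monotone_nat_of_le_succ fun t => ?_
  rw [regSum_succ]
  have h1 := log_det_add_trace_le (posDef_regSum hlam hW t) (hW (t + 1))
  have h2 := trace_inv_mul_nonneg_of_posSemidef
    ((posDef_regSum hlam hW t).add_posSemidef (hW (t + 1))) (hW (t + 1))
  linarith

/-- Uses the tangent inequality at `lam (1 + n) I`. Since `W 0 = 0`, only `n` increments count, so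
the trace is at most that of `lam (1 + n) I` and the first-order term is nonpositive. -/
lemma log_det_regSum_sub_le (hlam : 0 < lam) (hW : ∀ t, (W t).PosSemidef) (hW0 : W 0 = 0)
    (htr : ∀ t, (W t).trace ≤ Fintype.card ι * lam) (n : ℕ) :
    Real.log (regSum lam W n).det - Real.log (lam • (1 : Matrix ι ι ℝ)).det ≤
      Fintype.card ι * Real.log (1 + n) := by
  have hn : (0 : ℝ) < 1 + n := by positivity
  have hc : 0 < lam * (1 + n) := by positivity
  have h := log_det_sub_le_trace ((Matrix.PosDef.one (n := ι) (R := ℝ)).smul hc)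
    (posDef_regSum hlam hW n)
  have hinv : ((lam * (1 + n)) • (1 : Matrix ι ι ℝ))⁻¹ = (lam * (1 + n))⁻¹ • 1 := by
    apply Matrix.inv_eq_right_inv
    rw [Matrix.smul_mul, Matrix.mul_smul, smul_smul, mul_inv_cancel₀ hc.ne', Matrix.one_mul,
      one_smul]
  have hsum : ∑ s ∈ Finset.range (n + 1), (W s).trace ≤ n * (Fintype.card ι * lam) := by
    rw [Finset.sum_range_succ', hW0, Matrix.trace_zero, add_zero]
    calc _ ≤ ∑ _s ∈ Finset.range n, (Fintype.card ι * lam : ℝ) :=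
          Finset.sum_le_sum fun s _ => htr (s + 1)
      _ = _ := by simp
  have htrS : (regSum lam W n).trace ≤ Fintype.card ι * (lam * (1 + n)) := by
    rw [regSum, Matrix.trace_add, Matrix.trace_smul, Matrix.trace_one, Matrix.trace_sum]
    simp only [smul_eq_mul]
    nlinarith
  rw [hinv, Matrix.smul_mul, Matrix.one_mul, Matrix.trace_smul, smul_eq_mul] at h
  have h2 : (lam * (1 + n))⁻¹ * (regSum lam W n).trace ≤ Fintype.card ι := by
    rw [inv_mul_le_iff₀ hc]; linarith
  have h3 : Real.log ((lam * (1 + n)) • (1 : Matrix ι ι ℝ)).det =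
      Real.log (lam • (1 : Matrix ι ι ℝ)).det + Fintype.card ι * Real.log (1 + n) := by
    simp only [Matrix.det_smul, Matrix.det_one, mul_one, Real.log_pow]
    rw [Real.log_mul hlam.ne' hn.ne']
    ring
  linarith

/-- Each unit increment of `f` is covered by at most `K` of the windows `[r, r + K]`. -/
lemma sum_shift_sub_le {f : ℕ → ℝ} (hf : Monotone f) {K N T : ℕ} (h : N + K ≤ T + 1) :
    ∑ r ∈ Finset.range N, (f (r + K) - f r) ≤ K * (f T - f 0) := by
  induction K with
  | zero => simp
  | succ K ih =>
    have h1 : ∑ r ∈ Finset.range N, (f (r + (K + 1)) - f r) =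
        ∑ r ∈ Finset.range N, (f (r + K) - f r) + (f (N + K) - f K) := by
      have := Finset.sum_range_sub (fun r => f (r + K)) N
      rw [zero_add] at this
      rw [← this, ← Finset.sum_add_distrib]
      refine Finset.sum_congr rfl fun r _ => ?_
      rw [add_right_comm r 1 K, add_assoc r K 1]; ring
    have h2 : f (N + K) ≤ f T := hf (by omega)
    have h3 : f 0 ≤ f K := hf (by omega)
    have h4 := ih (by omega)
    rw [h1]; push_cast; linarith

/-- Rounds `r ≤ T` such that the regularized sum at least doubles, in some direction, within the
next `K` rounds, or for which these are not all played. -/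
def IsUnsettled (S : ℕ → Matrix ι ι ℝ) (K T r : ℕ) : Prop :=
  T < r + K ∨ ∃ x, 2 * quad (S r) x < quad (S (r + K)) x

open scoped Classical in
lemma card_isUnsettled_le (hlam : 0 < lam) (hW : ∀ t, (W t).PosSemidef) (K T : ℕ) :
    (((Finset.range (T + 1)).filter (IsUnsettled (regSum lam W) K T)).card : ℝ) ≤
      K + 2 * K * (Real.log (regSum lam W T).det - Real.log (regSum lam W 0).det) := by
  set f := fun t => Real.log (regSum lam W t).det with hf
  have hmono : Monotone f := log_det_regSum_mono hlam hW
  -- Rounds `r ≥ N` are those whose window ends after `T`; there are at most `K` of them. If `K >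
  -- T`, truncated subtraction gives `N = 0` and every round is of this kind.
  set N := T + 1 - K with hN
  have hsub : (Finset.range (T + 1)).filter (IsUnsettled (regSum lam W) K T) ⊆
      Finset.Ico N (T + 1) ∪ (Finset.range N).filter (fun r => 1 / 2 ≤ f (r + K) - f r) := by
    intro r hr
    rw [Finset.mem_filter, Finset.mem_range] at hr
    rw [Finset.mem_union, Finset.mem_Ico, Finset.mem_filter, Finset.mem_range]
    rcases lt_or_ge T (r + K) with h | h
    · left; omega
    · right
      refine ⟨by omega, ?_⟩
      obtain ⟨x, hx⟩ := hr.2.resolve_left (by omega)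
      have hW' : (∑ j ∈ Finset.range K, W (r + 1 + j)).PosSemidef :=
        Matrix.posSemidef_sum _ fun s _ => hW _
      rw [regSum_add] at hx
      have := log_det_add_half_le (posDef_regSum hlam hW r) hW' hx
      simp only [hf, regSum_add]
      linarith
  have h1 : ((Finset.Ico N (T + 1)).card : ℝ) ≤ K := by
    rw [Nat.card_Ico]; exact_mod_cast (by omega)
  have h2 : (((Finset.range N).filter (fun r => 1 / 2 ≤ f (r + K) - f r)).card : ℝ) * (1 / 2) ≤
      K * (f T - f 0) := by
    calc _ = ∑ r ∈ (Finset.range N).filter (fun r => 1 / 2 ≤ f (r + K) - f r), (1 / 2 : ℝ) := by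
          simp
      _ ≤ ∑ r ∈ (Finset.range N).filter (fun r => 1 / 2 ≤ f (r + K) - f r),
            (f (r + K) - f r) := Finset.sum_le_sum fun r hr => (Finset.mem_filter.1 hr).2
      _ ≤ ∑ r ∈ Finset.range N, (f (r + K) - f r) :=
          Finset.sum_le_sum_of_subset_of_nonneg (Finset.filter_subset _ _) fun r _ _ =>
            sub_nonneg.2 (hmono (by omega))
      _ ≤ K * (f T - f 0) := by
          rcases Nat.eq_zero_or_pos N with h0 | h0
          · rw [h0]
            have := sub_nonneg.2 (hmono (Nat.zero_le T))
            simp only [Finset.range_zero, Finset.sum_empty]; positivity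
          · exact sum_shift_sub_le hmono (by omega)
  have h3 : (((Finset.range (T + 1)).filter (IsUnsettled (regSum lam W) K T)).card : ℝ) ≤
      (Finset.Ico N (T + 1)).card +
        ((Finset.range N).filter (fun r => 1 / 2 ≤ f (r + K) - f r)).card := by
    exact_mod_cast (Finset.card_le_card hsub).trans (Finset.card_union_le _ _)
  linarith

end Potential

/-! ### Convolution inequalities -/

section Convolution

lemma sum_conv_le {β x : ℕ → ℝ} {b : ℝ} (hβ : ∀ i, 0 ≤ β i) (hx : ∀ s, 0 ≤ x s)
    (hb : ∀ n, ∑ i ∈ Finset.range n, β i ≤ b) (n : ℕ) :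
    ∑ t ∈ Finset.range n, ∑ i ∈ Finset.range (t + 1), β i * x (t - i) ≤
      b * ∑ s ∈ Finset.range n, x s := by
  rw [Finset.sum_range_diag_flip n fun i s => β i * x s]
  calc _ ≤ ∑ i ∈ Finset.range n, β i * ∑ s ∈ Finset.range n, x s := by
        refine Finset.sum_le_sum fun i _ => ?_
        rw [← Finset.mul_sum]
        refine mul_le_mul_of_nonneg_left ?_ (hβ i)
        exact Finset.sum_le_sum_of_subset_of_nonneg
          (Finset.range_subset_range.2 (Nat.sub_le n i)) fun s _ _ => hx s
    _ ≤ _ := by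
        rw [← Finset.sum_mul]
        exact mul_le_mul_of_nonneg_right (hb n) (Finset.sum_nonneg fun s _ => hx s)

/-- Young's inequality `‖β * x‖₂ ≤ ‖β‖₁ ‖x‖₂`. -/
lemma sum_sq_conv_le {β x : ℕ → ℝ} {b : ℝ} (hβ : ∀ i, 0 ≤ β i)
    (hb : ∀ n, ∑ i ∈ Finset.range n, β i ≤ b) (n : ℕ) :
    ∑ t ∈ Finset.range n, (∑ i ∈ Finset.range (t + 1), β i * x (t - i)) ^ 2 ≤
      b ^ 2 * ∑ s ∈ Finset.range n, x s ^ 2 := by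
  have hb0 : 0 ≤ b := by simpa using hb 0
  calc _ ≤ ∑ t ∈ Finset.range n, b * ∑ i ∈ Finset.range (t + 1), β i * x (t - i) ^ 2 := by
        refine Finset.sum_le_sum fun t _ => ?_
        have h := Finset.sum_sq_le_sum_mul_sum_of_sq_le_mul (Finset.range (t + 1))
          (r := fun i => β i * x (t - i)) (f := β) (g := fun i => β i * x (t - i) ^ 2)
          (fun i _ => hβ i) (fun i _ => mul_nonneg (hβ i) (sq_nonneg _))
          (fun i _ => by rw [mul_pow, sq (β i), mul_assoc])
        exact h.trans (mul_le_mul_of_nonneg_right (hb _)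
          (Finset.sum_nonneg fun i _ => mul_nonneg (hβ i) (sq_nonneg _)))
    _ ≤ _ := by
        rw [← Finset.mul_sum, sq b, mul_assoc]
        exact mul_le_mul_of_nonneg_left (sum_conv_le hβ (fun s => sq_nonneg _) hb n) hb0

end Convolution

/-! ### The invertibility modulus applied to prefixes of a signal -/

section Invertibility

variable {ι κ : Type} [Fintype ι] [Fintype κ]

lemma invModulus_le_one (G : ℕ → Matrix ι κ ℝ) : invModulus G ≤ 1 := by
  rw [invModulus]
  exact ENNReal.toReal_le_of_le_ofReal zero_le_one (by simp)

lemma invModulus_nonneg (G : ℕ → Matrix ι κ ℝ) : 0 ≤ invModulus G := ENNReal.toReal_nonneg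

/-- By homogeneity, the infimum over unit-energy inputs bounds every finitely supported input. Only
the partial sums of the output energy need a bound, so no summability has to be checked. -/
lemma invModulus_mul_sum_le (G : ℕ → Matrix ι κ ℝ) {a : ℕ → Vec κ} {N : ℕ}
    (ha : ∀ n, N ≤ n → a n = 0) {B : ℝ}
    (hB : ∀ M, ∑ n ∈ Finset.range M,
      ‖∑ i ∈ Finset.range (n + 1), act (G i) (a (n - i))‖ ^ 2 ≤ B) :
    invModulus G * ∑ n ∈ Finset.range N, ‖a n‖ ^ 2 ≤ B := by
  set A := ∑ n ∈ Finset.range N, ‖a n‖ ^ 2 with hA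
  have hA0 : 0 ≤ A := Finset.sum_nonneg fun n _ => sq_nonneg _
  rcases hA0.eq_or_lt with h0 | hpos
  · rw [← h0, mul_zero]; simpa using hB 0
  set c := (√A)⁻¹ with hc
  have hc0 : 0 ≤ c := by positivity
  have hc2 : c ^ 2 * A = 1 := by
    rw [hc, inv_pow, Real.sq_sqrt hA0, inv_mul_cancel₀ hpos.ne']
  have hsq : ∀ (σ : Type) [Fintype σ] (x : Vec σ), ‖x‖ₑ ^ 2 = ENNReal.ofReal (‖x‖ ^ 2) :=
    fun σ _ x => by rw [← ofReal_norm, ENNReal.ofReal_pow (norm_nonneg _)]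
  have hu : ∑' n, ‖c • a n‖ₑ ^ 2 = 1 := by
    rw [tsum_eq_sum (s := Finset.range N) fun n hn => by
      rw [ha n (by simpa using hn)]; simp]
    simp_rw [hsq]
    rw [← ENNReal.ofReal_sum_of_nonneg fun n _ => sq_nonneg _]
    simp_rw [norm_smul, mul_pow]
    rw [← Finset.mul_sum, Real.norm_of_nonneg hc0, hc2, ENNReal.ofReal_one]
  have hle : min 1 (⨅ (u : ℕ → Vec κ) (_ : ∑' n, ‖u n‖ₑ ^ 2 = 1),
      ∑' n, ‖∑ i ∈ Finset.range (n + 1), act (G i) (u (n - i))‖ₑ ^ 2) ≤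
        ENNReal.ofReal (c ^ 2 * B) := by
    refine (min_le_right _ _).trans ((iInf₂_le (fun n => c • a n) hu).trans ?_)
    refine ENNReal.tsum_le_of_sum_range_le fun M => ?_
    simp_rw [hsq]
    rw [← ENNReal.ofReal_sum_of_nonneg fun n _ => sq_nonneg _]
    refine ENNReal.ofReal_le_ofReal ?_
    simp_rw [act_smul, ← Finset.smul_sum, norm_smul, mul_pow]
    rw [← Finset.mul_sum, Real.norm_of_nonneg hc0]
    exact mul_le_mul_of_nonneg_left (hB M) (sq_nonneg _)
  have hB0 : 0 ≤ B := by simpa using hB 0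
  have h1 : invModulus G ≤ c ^ 2 * B := ENNReal.toReal_le_of_le_ofReal (by positivity) hle
  calc invModulus G * A ≤ c ^ 2 * B * A := mul_le_mul_of_nonneg_right h1 hA0
    _ = c ^ 2 * A * B := by ring
    _ = B := by rw [hc2, one_mul]

/-- The cutoff equal to `1` up to `t` that decreases linearly to `0` on `[t, t + K]`. -/
noncomputable def ramp (t K s : ℕ) : ℝ := max 0 (min 1 (1 - ((s : ℝ) - t) / K))

lemma ramp_nonneg (t K s : ℕ) : 0 ≤ ramp t K s := le_max_left _ _

lemma ramp_le_one (t K s : ℕ) : ramp t K s ≤ 1 := max_le zero_le_one (min_le_left _ _)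

lemma ramp_eq_one {t K s : ℕ} (h : s ≤ t) : ramp t K s = 1 := by
  have h1 : ((s : ℝ) - t) / K ≤ 0 :=
    div_nonpos_of_nonpos_of_nonneg (sub_nonpos.2 (by exact_mod_cast h)) (Nat.cast_nonneg K)
  rw [ramp, min_eq_left (by linarith), max_eq_right zero_le_one]

lemma ramp_eq_zero {t K s : ℕ} (hK : 0 < K) (h : t + K ≤ s) : ramp t K s = 0 := by
  have h1 : 1 ≤ ((s : ℝ) - t) / K := by
    rw [le_div_iff₀ (by exact_mod_cast hK)]
    have : (t : ℝ) + K ≤ s := by exact_mod_cast h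
    linarith
  rw [ramp, max_eq_left ((min_le_right _ _).trans (by linarith))]

/-- Clipping to `[0, 1]` is 1-Lipschitz, so the slope `1/K` of the unclipped ramp survives. -/
lemma abs_ramp_sub_ramp_le (t K s i : ℕ) : |ramp t K s - ramp t K (s + i)| ≤ i / K := by
  unfold ramp
  refine (abs_max_sub_max_le_max _ _ _ _).trans (max_le (by simp; positivity) ?_)
  refine (abs_min_sub_min_le_max _ _ _ _).trans (max_le (by simp; positivity) (le_of_eq ?_))
  rw [← abs_of_nonneg (a := (i / K : ℝ)) (by positivity)]
  congr 1
  push_cast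
  ring

variable [DecidableEq ι] [DecidableEq κ]

/-- Truncated convolutions of an input control the input itself, up to an error that is small when
the cutoff is slow. -/
lemma invModulus_mul_sum_le_truncated (G : ℕ → Matrix ι κ ℝ) {q : ℕ → Vec κ} (hq : q 0 = 0)
    {h K : ℕ} (hK : 0 < K) {b : ℝ}
    (hb : ∀ n, ∑ i ∈ Finset.range n, ‖G i‖ * (if i ≤ h then (h : ℝ) / K else 1) ≤ b) (t : ℕ) :
    invModulus G * ∑ s ∈ Finset.range (t + 1), ‖q s‖ ^ 2 ≤
      2 * ∑ s ∈ Finset.range (t + K + 1),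
          ‖∑ i ∈ Finset.range (h + 1), act (G i) (q (s - i))‖ ^ 2 +
        2 * b ^ 2 * ∑ s ∈ Finset.range (t + K + 1), ‖q s‖ ^ 2 := by
  set χ := ramp t K with hχ
  set β : ℕ → ℝ := fun i => ‖G i‖ * (if i ≤ h then (h : ℝ) / K else 1) with hβ
  set p : ℕ → Vec ι := fun n => ∑ i ∈ Finset.range (h + 1), act (G i) (q (n - i)) with hp
  -- The ramp vanishes from `t + K` on, so the commutator error only sees the input before that
  -- point; this keeps its energy a finite sum.
  set r : ℕ → ℝ := fun s => if s < t + K + 1 then ‖q s‖ else 0 with hr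
  have hβ0 : ∀ i, 0 ≤ β i := fun i => by
    simp only [hβ]; split_ifs <;> positivity
  have key : ∀ n, ‖∑ i ∈ Finset.range (n + 1), act (G i) (χ (n - i) • q (n - i))‖ ≤
      χ n * ‖p n‖ + ∑ i ∈ Finset.range (n + 1), β i * r (n - i) := by
    intro n
    have hpn : p n = ∑ i ∈ Finset.range (n + 1), if i ≤ h then act (G i) (q (n - i)) else 0 := by
      simp only [hp]
      rw [← Finset.sum_filter]
      symm
      refine Finset.sum_subset_zero_on_sdiff ?_ ?_ fun _ _ => rfl
      · intro i hi; simp only [Finset.mem_filter, Finset.mem_range] at hi ⊢; omega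
      · intro i hi
        simp only [Finset.mem_sdiff, Finset.mem_filter, Finset.mem_range] at hi
        -- Lags `i > n` read the signal at `0`, where it vanishes.
        rw [show n - i = 0 by omega, hq, act_zero]
    -- Convolution and cutoff are commuted. At lags `i ≤ h` the commutator carries `χ(n-i) - χ(n)`,
    -- at most `h/K`; lags beyond `h` are absent from the truncated convolution `p` and are charged
    -- in full. This is the kernel `β`.
    have hdec : ∑ i ∈ Finset.range (n + 1), act (G i) (χ (n - i) • q (n - i)) = χ n • p n +
        ∑ i ∈ Finset.range (n + 1),
          act (G i) ((χ (n - i) - if i ≤ h then χ n else 0) • q (n - i)) := by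
      rw [hpn, Finset.smul_sum, ← Finset.sum_add_distrib]
      refine Finset.sum_congr rfl fun i _ => ?_
      split_ifs <;> simp [sub_smul]
    rw [hdec]
    refine (norm_add_le _ _).trans (add_le_add ?_ ?_)
    · rw [norm_smul, Real.norm_of_nonneg (ramp_nonneg _ _ _)]
    · refine (norm_sum_le _ _).trans (Finset.sum_le_sum fun i hi => ?_)
      have hin : i ≤ n := by simpa [Nat.lt_succ_iff] using hi
      refine (norm_act_le _ _).trans ?_
      simp only [hβ, hr]
      rw [mul_assoc, norm_smul, Real.norm_eq_abs]
      refine mul_le_mul_of_nonneg_left ?_ (norm_nonneg _)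
      by_cases hlt : n - i < t + K + 1
      · rw [if_pos hlt]
        refine mul_le_mul_of_nonneg_right ?_ (norm_nonneg _)
        by_cases hih : i ≤ h
        · rw [if_pos hih, if_pos hih]
          have := abs_ramp_sub_ramp_le t K (n - i) i
          rw [Nat.sub_add_cancel hin] at this
          refine this.trans ?_
          gcongr
        · rw [if_neg hih, if_neg hih, sub_zero, abs_of_nonneg (ramp_nonneg _ _ _)]
          exact ramp_le_one _ _ _
      · have h1 : χ (n - i) = 0 := ramp_eq_zero hK (by omega)
        have h2 : χ n = 0 := ramp_eq_zero hK (by omega)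
        simp [h1, h2, hlt]
  have hrs : ∀ M, ∑ s ∈ Finset.range M, r s ^ 2 ≤ ∑ s ∈ Finset.range (t + K + 1), ‖q s‖ ^ 2 := by
    intro M
    simp only [hr, ite_pow]
    rw [← Finset.sum_filter_add_sum_filter_not _ (fun s => s < t + K + 1),
      Finset.sum_congr rfl (fun s hs => if_pos (Finset.mem_filter.1 hs).2),
      Finset.sum_congr (s₁ := (Finset.range M).filter (fun s => ¬ s < t + K + 1)) rfl
        (fun s hs => if_neg (Finset.mem_filter.1 hs).2)]
    simp only [ne_eq, OfNat.ofNat_ne_zero, not_false_eq_true, zero_pow, Finset.sum_const_zero,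
      add_zero]
    refine Finset.sum_le_sum_of_subset_of_nonneg ?_ fun s _ _ => sq_nonneg _
    intro s hs
    simpa using (Finset.mem_filter.1 hs).2
  have hps : ∀ M, ∑ n ∈ Finset.range M, (χ n * ‖p n‖) ^ 2 ≤
      ∑ s ∈ Finset.range (t + K + 1), ‖p s‖ ^ 2 := by
    intro M
    calc _ ≤ ∑ n ∈ (Finset.range M).filter (fun s => s < t + K + 1), (χ n * ‖p n‖) ^ 2 := by
          rw [← Finset.sum_filter_add_sum_filter_not (Finset.range M) (fun s => s < t + K + 1)]
          refine add_le_of_le_of_nonpos le_rfl (Finset.sum_nonpos fun s hs => ?_)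
          have : χ s = 0 := ramp_eq_zero hK (by have := (Finset.mem_filter.1 hs).2; omega)
          simp [this]
      _ ≤ ∑ n ∈ Finset.range (t + K + 1), (χ n * ‖p n‖) ^ 2 := by
          refine Finset.sum_le_sum_of_subset_of_nonneg ?_ fun s _ _ => sq_nonneg _
          intro s hs
          simpa using (Finset.mem_filter.1 hs).2
      _ ≤ _ := by
          refine Finset.sum_le_sum fun n _ => ?_
          refine pow_le_pow_left₀ (mul_nonneg (ramp_nonneg _ _ _) (norm_nonneg _)) ?_ 2
          exact mul_le_of_le_one_left (norm_nonneg _) (ramp_le_one _ _ _)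
  have hmain := invModulus_mul_sum_le G (a := fun n => χ n • q n) (N := t + K + 1)
    (fun n hn => by rw [hχ, ramp_eq_zero hK (by omega), zero_smul])
    (B := 2 * ∑ s ∈ Finset.range (t + K + 1), ‖p s‖ ^ 2 +
        2 * b ^ 2 * ∑ s ∈ Finset.range (t + K + 1), ‖q s‖ ^ 2) (by
      intro M
      calc _ ≤ ∑ n ∈ Finset.range M, (2 * (χ n * ‖p n‖) ^ 2 +
            2 * (∑ i ∈ Finset.range (n + 1), β i * r (n - i)) ^ 2) := by
            refine Finset.sum_le_sum fun n _ => ?_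
            refine (pow_le_pow_left₀ (norm_nonneg _) (key n) 2).trans ?_
            nlinarith [sq_nonneg (χ n * ‖p n‖ - ∑ i ∈ Finset.range (n + 1), β i * r (n - i))]
        _ ≤ _ := by
            rw [Finset.sum_add_distrib, ← Finset.mul_sum, ← Finset.mul_sum]
            have h1 := sum_sq_conv_le (x := r) hβ0 hb M
            have h2 := mul_le_mul_of_nonneg_left (hrs M) (sq_nonneg b)
            have h3 := hps M
            linarith)
  refine le_trans (mul_le_mul_of_nonneg_left ?_ (invModulus_nonneg G)) hmain
  calc ∑ s ∈ Finset.range (t + 1), ‖q s‖ ^ 2 = ∑ s ∈ Finset.range (t + 1), ‖χ s • q s‖ ^ 2 := by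
        refine Finset.sum_congr rfl fun s hs => ?_
        rw [hχ, ramp_eq_one (by simpa [Nat.lt_succ_iff] using hs), one_smul]
    _ ≤ _ := Finset.sum_le_sum_of_subset_of_nonneg
        (Finset.range_subset_range.2 (by omega)) fun s _ _ => sq_nonneg _

end Invertibility

/-! ### Projection onto a convex set in a quadratic norm -/

section Projection

variable {ι : Type} [Fintype ι]

lemma quad_add_smul {S : Matrix ι ι ℝ} (hS : S.transpose = S) (x y : Vec ι) (c : ℝ) :
    quad S (x + c • y) = quad S x + 2 * c * inner ℝ y (act S x) + c ^ 2 * quad S y := by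
  have h : inner ℝ x (act S y) = inner ℝ y (act S x) := by
    rw [inner_act, hS, real_inner_comm]
  simp only [quad, act_add, act_smul, inner_add_left, inner_add_right, real_inner_smul_left,
    real_inner_smul_right, h]
  ring

/-- Compactness provides a minimizer, so the choice operator in `projOn` really selects one. -/
lemma projOn_spec {K : Set (Vec ι)} (hK : IsCompact K) (hne : K.Nonempty) (S : Matrix ι ι ℝ)
    (p : Vec ι) :
    projOn K S p ∈ K ∧ ∀ x ∈ K, quad S (projOn K S p - p) ≤ quad S (x - p) := by
  have hc : ContinuousOn (fun z : Vec ι => inner ℝ (z - p) (act S (z - p))) K := by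
    have := continuous_act S
    fun_prop
  obtain ⟨z, hz, hmin⟩ := hK.exists_isMinOn hne hc
  exact Classical.epsilon_spec (p := fun z => z ∈ K ∧
    ∀ z' ∈ K, inner ℝ (z - p) (act S (z - p)) ≤ inner ℝ (z' - p) (act S (z' - p)))
    ⟨z, hz, fun x hx => hmin hx⟩

/-- Projections do not increase the distance to points of a convex set. -/
lemma quad_projOn_sub_le {K : Set (Vec ι)} (hK : IsCompact K) (hconv : Convex ℝ K)
    {S : Matrix ι ι ℝ} (hS : S.PosSemidef) (p : Vec ι) {x : Vec ι} (hx : x ∈ K) :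
    quad S (projOn K S p - x) ≤ quad S (p - x) := by
  obtain ⟨hz, hmin⟩ := projOn_spec hK ⟨x, hx⟩ S p
  obtain ⟨hsymm, hnn⟩ := (posSemidef_iff_quad S).1 hS
  set z := projOn K S p
  -- First-order optimality of the projection `z`: the form cannot decrease to first order towards
  -- `x`.
  have hvar : 0 ≤ inner ℝ (x - z) (act S (z - p)) := by
    by_contra hneg
    push Not at hneg
    set a := inner ℝ (x - z) (act S (z - p)) with ha
    have hq := hnn (x - z)
    -- A step short enough that the linear decrease `2ca` outweighs `c² quad S (x - z)`; the `+ 1`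
    -- avoids division by zero.
    set c : ℝ := min 1 (-a / (quad S (x - z) + 1)) with hc
    have hc0 : 0 < c := lt_min one_pos (div_pos (by linarith) (by linarith))
    have hc1 : c ≤ 1 := min_le_left _ _
    have hmem : z + c • (x - z) ∈ K := hconv.add_smul_sub_mem hz hx ⟨hc0.le, hc1⟩
    have h1 := hmin _ hmem
    rw [show z + c • (x - z) - p = (z - p) + c • (x - z) by abel, quad_add_smul hsymm, ← ha] at h1
    have h2 : c * (quad S (x - z) + 1) ≤ -a := by
      rw [← le_div_iff₀ (by linarith)]; exact min_le_right _ _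
    nlinarith
  have h1 := quad_add_smul hsymm (z - p) (x - z) 1
  have h2 := hnn (z - p)
  have hneg : ∀ y, quad S (-y) = quad S y := fun y => by simp [quad]
  rw [show z - p + (1 : ℝ) • (x - z) = -(p - x) by rw [one_smul]; abel, hneg] at h1
  rw [show z - x = -(x - z) by abel, hneg]
  linarith

end Projection

/-! ### Online Newton steps: movement and regret -/

section NewtonRun

variable {ι ν : Type} [Fintype ι] [Fintype ν] [DecidableEq ι]

/-- A self-bounding argument: for `y = S⁻¹Hᵀn`, the form `quad S y = ⟨n, Hy⟩` is at most `g‖Hy‖`,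
while `‖Hy‖²` is at most the trace times `quad S y` itself. -/
lemma quad_inv_transpose_act_le {S : Matrix ι ι ℝ} (hS : S.PosDef) (H : Matrix ν ι ℝ) {n : Vec ν}
    {g : ℝ} (hn : ‖n‖ ≤ g) :
    quad S⁻¹ (act H.transpose n) ≤ g ^ 2 * (S⁻¹ * (H.transpose * H)).trace := by
  set y := act S⁻¹ (act H.transpose n) with hy
  have hSy : act S y = act H.transpose n := by
    rw [hy, ← mul_act, Matrix.mul_nonsing_inv _ ((Matrix.isUnit_iff_isUnit_det _).1 hS.isUnit),
      one_act]
  have hq : quad S⁻¹ (act H.transpose n) = quad S y := by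
    rw [quad, quad, hSy, ← hy, real_inner_comm]
  have h1 : quad S y = inner ℝ n (act H y) := by
    rw [inner_act, ← hSy, quad, real_inner_comm]
  have h2 := norm_act_sq_le_trace_mul_quad hS H y
  have h3 : quad S y ≤ g * ‖act H y‖ := by
    rw [h1]
    exact (real_inner_le_norm _ _).trans (mul_le_mul_of_nonneg_right hn (norm_nonneg _))
  have h0 := quad_nonneg_of_posSemidef hS.posSemidef y
  have htr := trace_inv_mul_nonneg hS H
  rw [hq]
  rcases h0.eq_or_lt with h | h
  · rw [← h]; positivity
  · have h4 : quad S y ^ 2 ≤ g ^ 2 * ((S⁻¹ * (H.transpose * H)).trace * quad S y) :=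
      calc quad S y ^ 2 ≤ (g * ‖act H y‖) ^ 2 := pow_le_pow_left₀ h0 h3 2
        _ = g ^ 2 * ‖act H y‖ ^ 2 := mul_pow _ _ _
        _ ≤ _ := mul_le_mul_of_nonneg_left h2 (sq_nonneg g)
    refine le_of_mul_le_mul_right ?_ h
    linarith

/-- The iterates `z` of the online (semi-)Newton step with features `H`, and gradients `Hᵀ n` of
size `‖n‖ ≤ g`, over the set `K`. -/
structure IsNewtonRun (K : Set (Vec ι)) (η lam g : ℝ) (H : ℕ → Matrix ν ι ℝ) (n : ℕ → Vec ν)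
    (z : ℕ → Vec ι) : Prop where
  lam_pos : 0 < lam
  mem : ∀ t, z t ∈ K
  norm_le : ∀ t, ‖n t‖ ≤ g
  step : ∀ t, ∀ x ∈ K,
    quad (regSum lam (fun s => (H s).transpose * H s) t) (z (t + 1) - x) ≤
      quad (regSum lam (fun s => (H s).transpose * H s) t)
        (z t - η • act (regSum lam (fun s => (H s).transpose * H s) t)⁻¹
          (act (H t).transpose (n t)) - x)

omit [DecidableEq ι] in
lemma posSemidef_transpose_mul_self (P : Matrix ν ι ℝ) : (P.transpose * P).PosSemidef := by
  simpa using Matrix.posSemidef_conjTranspose_mul_self P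

/-- The leverage `tr (Λ_t⁻¹ H_tᵀ H_t)` of round `t`. -/
noncomputable def leverage (lam : ℝ) (H : ℕ → Matrix ν ι ℝ) (t : ℕ) : ℝ :=
  ((regSum lam (fun s => (H s).transpose * H s) t)⁻¹ * ((H t).transpose * H t)).trace

namespace IsNewtonRun

variable {K : Set (Vec ι)} {η lam g : ℝ} {H : ℕ → Matrix ν ι ℝ} {n : ℕ → Vec ν} {z : ℕ → Vec ι}

lemma posDef (hrun : IsNewtonRun K η lam g H n z) (t : ℕ) :
    (regSum lam (fun s => (H s).transpose * H s) t).PosDef :=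
  posDef_regSum hrun.lam_pos (fun _ => posSemidef_transpose_mul_self _) t

lemma leverage_nonneg (hrun : IsNewtonRun K η lam g H n z) (t : ℕ) : 0 ≤ leverage lam H t :=
  trace_inv_mul_nonneg (hrun.posDef t) _

lemma quad_step_le (hrun : IsNewtonRun K η lam g H n z) (t : ℕ) {x : Vec ι} (hx : x ∈ K) :
    quad (regSum lam (fun s => (H s).transpose * H s) t) (z (t + 1) - x) ≤
      quad (regSum lam (fun s => (H s).transpose * H s) t) (z t - x) -
        2 * η * inner ℝ (n t) (act (H t) (z t - x)) + η ^ 2 * (g ^ 2 * leverage lam H t) := by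
  refine (hrun.step t x hx).trans ?_
  set S := regSum lam (fun s => (H s).transpose * H s) t with hS
  have hpd := hrun.posDef t
  rw [← hS] at hpd
  have hsymm := ((posSemidef_iff_quad S).1 hpd.posSemidef).1
  set d := act (H t).transpose (n t) with hd
  have hSd : act S (act S⁻¹ d) = d := by
    rw [← mul_act, Matrix.mul_nonsing_inv _ ((Matrix.isUnit_iff_isUnit_det _).1 hpd.isUnit),
      one_act]
  rw [show z t - η • act S⁻¹ d - x = (z t - x) + (-η) • act S⁻¹ d by rw [neg_smul]; abel,
    quad_add_smul hsymm]
  have h1 : inner ℝ (act S⁻¹ d) (act S (z t - x)) = inner ℝ (n t) (act (H t) (z t - x)) := by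
    rw [inner_act, hsymm, hSd, inner_act]
  have h2 : quad S (act S⁻¹ d) = quad S⁻¹ d := by rw [quad, quad, hSd, real_inner_comm]
  have h3 : quad S⁻¹ d ≤ g ^ 2 * leverage lam H t :=
    quad_inv_transpose_act_le hpd (H t) (hrun.norm_le t)
  rw [h1, h2]
  nlinarith [mul_le_mul_of_nonneg_left h3 (sq_nonneg η)]

/-- The step inequality with the current iterate as the comparison point, which cancels the distance
and the linear term. -/
lemma quad_movement_le (hrun : IsNewtonRun K η lam g H n z) (t : ℕ) :
    quad (regSum lam (fun s => (H s).transpose * H s) t) (z (t + 1) - z t) ≤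
      η ^ 2 * (g ^ 2 * leverage lam H t) := by
  have h := hrun.quad_step_le t (hrun.mem t)
  simpa [quad] using h

/-- Regret of the online Newton step, before the linearized losses are compared with the losses. -/
lemma regret_le (hrun : IsNewtonRun K η lam g H n z) {x : Vec ι} (hx : x ∈ K) (N : ℕ) :
    ∑ t ∈ Finset.range N, (2 * η * inner ℝ (n t) (act (H t) (z t - x)) -
        ‖act (H t) (z t - x)‖ ^ 2) ≤
      lam * ‖z 0 - x‖ ^ 2 + η ^ 2 * g ^ 2 * ∑ t ∈ Finset.range N, leverage lam H t := by
  -- The induction must retain the final distance in the `Λ` norm. Passing from `Λ_{N-1}` to `Λ_N`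
  -- adds `‖H_N(z_N - x)‖²`, which is what the subtracted squares pay for.
  have key : ∑ t ∈ Finset.range N, (2 * η * inner ℝ (n t) (act (H t) (z t - x)) -
        ‖act (H t) (z t - x)‖ ^ 2) +
      (lam * ‖z N - x‖ ^ 2 + ∑ s ∈ Finset.range N, ‖act (H s) (z N - x)‖ ^ 2) ≤
      lam * ‖z 0 - x‖ ^ 2 + η ^ 2 * g ^ 2 * ∑ t ∈ Finset.range N, leverage lam H t := by
    induction N with
    | zero => simp
    | succ N ih =>
      have h := hrun.quad_step_le N hx
      simp only [quad_regSum, quad_transpose_mul_self] at h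
      rw [Finset.sum_range_succ (fun s => ‖act (H s) (z N - x)‖ ^ 2)] at h
      rw [Finset.sum_range_succ (fun t => 2 * η * inner ℝ (n t) (act (H t) (z t - x)) -
        ‖act (H t) (z t - x)‖ ^ 2), Finset.sum_range_succ (fun t => leverage lam H t)]
      linarith
  have h0 : 0 ≤ lam * ‖z N - x‖ ^ 2 := mul_nonneg hrun.lam_pos.le (sq_nonneg _)
  have h1 : 0 ≤ ∑ s ∈ Finset.range N, ‖act (H s) (z N - x)‖ ^ 2 :=
    Finset.sum_nonneg fun s _ => sq_nonneg _
  linarith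

end IsNewtonRun

end NewtonRun

/-! ### Settled rounds: `H` dominates `Y` -/

section Memory

variable {ι ν υ : Type} [Fintype ι] [Fintype ν] [Fintype υ] [DecidableEq ι] [DecidableEq ν]
  [DecidableEq υ]

/-- The features `H_t = ∑_{i ≤ h} G_i Y_{t-i}` of the convolution of `Y` with `G`, truncated
at lag `h`. -/
def features (G : ℕ → Matrix ν υ ℝ) (Y : ℕ → Matrix υ ι ℝ) (h t : ℕ) : Matrix ν ι ℝ :=
  ∑ i ∈ Finset.range (h + 1), G i * Y (t - i)

/-- Regularized second moments of `H` and `√θ Y`. -/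
noncomputable def jointSum (lam θ : ℝ) (H : ℕ → Matrix ν ι ℝ) (Y : ℕ → Matrix υ ι ℝ) :
    ℕ → Matrix ι ι ℝ :=
  regSum lam fun t => (H t).transpose * H t + θ • ((Y t).transpose * Y t)

variable {G : ℕ → Matrix ν υ ℝ} {Y : ℕ → Matrix υ ι ℝ} {lam : ℝ} {h K T : ℕ}

omit [DecidableEq ν] [DecidableEq υ] in
lemma quad_jointSum (θ : ℝ) (H : ℕ → Matrix ν ι ℝ) (t : ℕ) (x : Vec ι) :
    quad (jointSum lam θ H Y t) x = quad (regSum lam (fun s => (H s).transpose * H s) t) x +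
      θ * ∑ s ∈ Finset.range (t + 1), ‖act (Y s) x‖ ^ 2 := by
  simp only [jointSum, quad_regSum, quad_add_matrix, quad_smul_matrix, quad_transpose_mul_self,
    Finset.sum_add_distrib, Finset.mul_sum]
  ring

/-- In settled rounds, the second moments of `H` dominate those of `Y`. -/
lemma quad_jointSum_le (hlam : 0 ≤ lam) (hY : Y 0 = 0) (hK : 0 < K)
    (hb : K ≤ T → ∀ n, ∑ i ∈ Finset.range n, ‖G i‖ * (if i ≤ h then (h : ℝ) / K else 1) ≤
      √(invModulus G) / 3) {r : ℕ}
    (hr : ¬ IsUnsettled (jointSum lam (invModulus G / 9) (features G Y h) Y) K T r) (x : Vec ι) :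
    quad (jointSum lam (invModulus G / 9) (features G Y h) Y r) x ≤
      2 * quad (regSum lam (fun s => (features G Y h s).transpose * features G Y h s) r) x := by
  rw [IsUnsettled] at hr
  push Not at hr
  have hx := hr.2 x
  have hramp := invModulus_mul_sum_le_truncated G (q := fun s => act (Y s) x) (by simp [hY])
    (h := h) hK (hb (by omega)) r
  rw [div_pow, Real.sq_sqrt (invModulus_nonneg G)] at hramp
  have hH : ∀ s, ∑ i ∈ Finset.range (h + 1), act (G i) (act (Y (s - i)) x) =
      act (features G Y h s) x := fun s => by
    simp only [features, sum_act, mul_act]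
  simp only [hH] at hramp
  have h1 : ∑ s ∈ Finset.range (r + K + 1), ‖act (features G Y h s) x‖ ^ 2 ≤
      quad (regSum lam (fun s => (features G Y h s).transpose * features G Y h s) (r + K)) x := by
    simp only [quad_regSum, quad_transpose_mul_self]
    have : 0 ≤ lam * ‖x‖ ^ 2 := by positivity
    linarith
  have h0 :
      0 ≤ quad (regSum lam (fun s => (features G Y h s).transpose * features G Y h s) r) x := by
    simp only [quad_regSum, quad_transpose_mul_self]
    positivity
  -- With `θ = κ/9`, let `A`, `B`, `S = A + θB` be the values at `x` of `Λ`, `∑ YᵀY` and the joint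
  -- sum. The cutoff inequality and settledness give `9θB_r ≤ 2A_{r+K} + 2θB_{r+K} = 2S_{r+K} ≤ 4S_r
  -- = 4A_r + 4θB_r`. Hence `θB_r ≤ (4/5)A_r` and `S_r ≤ 2A_r`.
  rw [quad_jointSum] at hx ⊢
  rw [quad_jointSum] at hx
  linarith

end Memory

/-! ### The total cost of memory -/

section Memory

variable {ι ν υ : Type} [Fintype ι] [Fintype ν] [Fintype υ] [DecidableEq ι] [DecidableEq ν]
  [DecidableEq υ]

/-- `tr (S_t⁻¹ Y_tᵀ Y_t)` for the joint second moments `S_t`. -/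
noncomputable def inputLeverage (lam θ : ℝ) (H : ℕ → Matrix ν ι ℝ) (Y : ℕ → Matrix υ ι ℝ)
    (t : ℕ) : ℝ :=
  ((jointSum lam θ H Y t)⁻¹ * ((Y t).transpose * Y t)).trace

variable {lam θ : ℝ} {H : ℕ → Matrix ν ι ℝ} {Y : ℕ → Matrix υ ι ℝ}

omit [DecidableEq ν] [DecidableEq υ] [DecidableEq ι] in
lemma posSemidef_jointIncrement (hθ : 0 ≤ θ) (t : ℕ) :
    ((H t).transpose * H t + θ • ((Y t).transpose * Y t)).PosSemidef :=
  (posSemidef_transpose_mul_self _).add ((posSemidef_transpose_mul_self _).smul hθ)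

omit [DecidableEq ν] [DecidableEq υ] in
lemma posDef_jointSum (hlam : 0 < lam) (hθ : 0 ≤ θ) (t : ℕ) : (jointSum lam θ H Y t).PosDef :=
  posDef_regSum hlam (posSemidef_jointIncrement hθ) t

omit [DecidableEq ν] [DecidableEq υ] in
lemma inputLeverage_nonneg (hlam : 0 < lam) (hθ : 0 ≤ θ) (t : ℕ) :
    0 ≤ inputLeverage lam θ H Y t :=
  trace_inv_mul_nonneg (posDef_jointSum hlam hθ t) _

omit [DecidableEq ν] [DecidableEq υ] in
lemma sum_inputLeverage_le (hlam : 0 < lam) (hθ : 0 ≤ θ) (n : ℕ) :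
    θ * ∑ t ∈ Finset.range (n + 1), inputLeverage lam θ H Y t ≤
      Real.log (jointSum lam θ H Y n).det - Real.log (lam • (1 : Matrix ι ι ℝ)).det := by
  refine le_trans ?_ (sum_trace_inv_mul_le hlam (posSemidef_jointIncrement hθ) n)
  rw [Finset.mul_sum]
  refine Finset.sum_le_sum fun t _ => ?_
  change _ ≤ ((jointSum lam θ H Y t)⁻¹ * _).trace
  rw [Matrix.mul_add, Matrix.trace_add, Matrix.mul_smul, Matrix.trace_smul, smul_eq_mul]
  have := trace_inv_mul_nonneg (posDef_jointSum (H := H) (Y := Y) hlam hθ t) (H t)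
  rw [inputLeverage]
  linarith

variable {Z : Set (Vec ι)} {η g R : ℝ} {G : ℕ → Matrix ν υ ℝ} {h K T : ℕ} {n : ℕ → Vec ν}
  {z : ℕ → Vec ι}

/-- Movement, as seen through `Y_r`, of the iterates after a settled round `r`. -/
lemma norm_act_movement_le (hrun : IsNewtonRun Z η lam g (features G Y h) n z) (hη : 0 ≤ η)
    (hκ : 0 < invModulus G) (hY : Y 0 = 0) (hK : 0 < K)
    (hb : K ≤ T → ∀ n, ∑ i ∈ Finset.range n, ‖G i‖ * (if i ≤ h then (h : ℝ) / K else 1) ≤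
      √(invModulus G) / 3) {r : ℕ}
    (hr : ¬ IsUnsettled (jointSum lam (invModulus G / 9) (features G Y h) Y) K T r) {s : ℕ}
    (hrs : r ≤ s) :
    ‖act (Y r) (z (s + 1) - z s)‖ ≤
      η * g * (√(invModulus G) * inputLeverage lam (invModulus G / 9) (features G Y h) Y r +
        (√(invModulus G))⁻¹ * leverage lam (features G Y h) s) := by
  set δ := z (s + 1) - z s with hδ
  set τ := inputLeverage lam (invModulus G / 9) (features G Y h) Y r with hτ
  set χ := leverage lam (features G Y h) s with hχ
  have hlam := hrun.lam_pos
  have hg : 0 ≤ g := (norm_nonneg _).trans (hrun.norm_le 0)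
  have hτ0 : 0 ≤ τ := inputLeverage_nonneg hlam (by positivity) r
  have hχ0 : 0 ≤ χ := hrun.leverage_nonneg s
  have h1 : ‖act (Y r) δ‖ ^ 2 ≤ τ * (2 * (η ^ 2 * (g ^ 2 * χ))) := by
    refine (norm_act_sq_le_trace_mul_quad (posDef_jointSum hlam (by positivity) r) (Y r) δ).trans
      (mul_le_mul_of_nonneg_left ?_ hτ0)
    refine (quad_jointSum_le hlam.le hY hK hb hr δ).trans ?_
    have h2 := quad_regSum_mono (lam := lam)
      (W := fun s => (features G Y h s).transpose * features G Y h s)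
      (fun _ => posSemidef_transpose_mul_self _) hrs δ
    have h3 := hrun.quad_movement_le s
    linarith
  have hsq : 0 < √(invModulus G) := Real.sqrt_pos.2 hκ
  refine abs_le_of_sq_le_sq' ?_ (by positivity) |>.2
  refine h1.trans ?_
  rw [mul_pow, mul_pow]
  -- AM-GM with weight `√κ`, chosen because the `τ` sum to `O(D/κ)` and the `χ` only to `O(D)`: both
  -- terms then contribute `D/√κ`.
  have h4 : 2 * (τ * χ) ≤ (√(invModulus G) * τ + (√(invModulus G))⁻¹ * χ) ^ 2 := by
    have h5 : (√(invModulus G) * τ) * ((√(invModulus G))⁻¹ * χ) = τ * χ := by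
      field_simp
    have h6 : 0 ≤ τ * χ := mul_nonneg hτ0 hχ0
    nlinarith [sq_nonneg (√(invModulus G) * τ), sq_nonneg ((√(invModulus G))⁻¹ * χ)]
  calc τ * (2 * (η ^ 2 * (g ^ 2 * χ))) = η ^ 2 * g ^ 2 * (2 * (τ * χ)) := by ring
    _ ≤ _ := mul_le_mul_of_nonneg_left h4 (by positivity)

/-- Rewrites a sum over a window of at most `h` past rounds as a convolution with an indicator
kernel of mass at most `h`, independent of `r`, so that `sum_conv_le` can sum it over `t`. -/
lemma sum_Ico_le_conv {χ : ℕ → ℝ} (hχ : ∀ s, 0 ≤ χ s) {r t h : ℕ} (hth : t ≤ r + h) :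
    ∑ s ∈ Finset.Ico r t, χ s ≤
      ∑ i ∈ Finset.range (t + 1), (if 1 ≤ i ∧ i ≤ h then 1 else 0) * χ (t - i) := by
  have hflip := Finset.sum_flip (n := t)
    (fun k => (if 1 ≤ t - k ∧ t - k ≤ h then (1 : ℝ) else 0) * χ k)
  have heq : ∑ i ∈ Finset.range (t + 1), (if 1 ≤ i ∧ i ≤ h then (1 : ℝ) else 0) * χ (t - i) =
      ∑ k ∈ Finset.range (t + 1), (if 1 ≤ t - k ∧ t - k ≤ h then (1 : ℝ) else 0) * χ k := by
    rw [← hflip]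
    refine Finset.sum_congr rfl fun i hi => ?_
    rw [Nat.sub_sub_self (by simpa [Nat.lt_succ_iff] using hi)]
  rw [heq]
  calc ∑ s ∈ Finset.Ico r t, χ s =
        ∑ k ∈ Finset.Ico r t, (if 1 ≤ t - k ∧ t - k ≤ h then (1 : ℝ) else 0) * χ k := by
        refine Finset.sum_congr rfl fun k hk => ?_
        rw [Finset.mem_Ico] at hk
        rw [if_pos (by omega), one_mul]
    _ ≤ _ := by
        refine Finset.sum_le_sum_of_subset_of_nonneg ?_ fun k _ _ => ?_
        · intro k hk
          rw [Finset.mem_Ico] at hk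
          rw [Finset.mem_range]; omega
        · split_ifs <;> simp [hχ]

-- In an unsettled round the two inputs are bounded separately by `R`. In a settled one the
-- difference telescopes over at most `h` steps, each controlled by `norm_act_movement_le`.
open scoped Classical in
lemma norm_act_sub_le (hrun : IsNewtonRun Z η lam g (features G Y h) n z) (hη : 0 ≤ η)
    (hκ : 0 < invModulus G) (hY : Y 0 = 0) (hK : 0 < K)
    (hb : K ≤ T → ∀ n, ∑ i ∈ Finset.range n, ‖G i‖ * (if i ≤ h then (h : ℝ) / K else 1) ≤
      √(invModulus G) / 3) (hR : ∀ t, ∀ x ∈ Z, ‖act (Y t) x‖ ≤ R) {r t : ℕ}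
    (hrt : r ≤ t) (hth : t ≤ r + h) :
    ‖act (Y r) (z r - z t)‖ ≤
      η * g * (h * (√(invModulus G) *
          inputLeverage lam (invModulus G / 9) (features G Y h) Y r)) +
        2 * R * (if IsUnsettled (jointSum lam (invModulus G / 9) (features G Y h) Y) K T r
          then 1 else 0) +
        η * g * (√(invModulus G))⁻¹ * ∑ i ∈ Finset.range (t + 1),
          (if 1 ≤ i ∧ i ≤ h then 1 else 0) * leverage lam (features G Y h) (t - i) := by
  have hlam := hrun.lam_pos
  have hg : 0 ≤ g := (norm_nonneg _).trans (hrun.norm_le 0)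
  have hτ0 : 0 ≤ inputLeverage lam (invModulus G / 9) (features G Y h) Y r :=
    inputLeverage_nonneg hlam (by positivity) r
  have hsum := sum_Ico_le_conv (fun s => hrun.leverage_nonneg s) hth
  have hS0 : 0 ≤ ∑ s ∈ Finset.Ico r t, leverage lam (features G Y h) s :=
    Finset.sum_nonneg fun s _ => hrun.leverage_nonneg s
  by_cases hr : IsUnsettled (jointSum lam (invModulus G / 9) (features G Y h) Y) K T r
  · rw [if_pos hr, act_sub]
    have h1 := norm_sub_le (act (Y r) (z r)) (act (Y r) (z t))
    have h2 := hR r _ (hrun.mem r)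
    have h3 := hR r _ (hrun.mem t)
    have h4 : 0 ≤ η * g * (h * (√(invModulus G) *
          inputLeverage lam (invModulus G / 9) (features G Y h) Y r)) := by positivity
    have h5 : 0 ≤ η * g * (√(invModulus G))⁻¹ * ∑ i ∈ Finset.range (t + 1),
          (if 1 ≤ i ∧ i ≤ h then 1 else 0) * leverage lam (features G Y h) (t - i) :=
      mul_nonneg (by positivity) (hS0.trans hsum)
    linarith
  · rw [if_neg hr, mul_zero, add_zero]
    have htel : z t - z r = ∑ s ∈ Finset.Ico r t, (z (s + 1) - z s) :=
      (Finset.sum_Ico_sub z hrt).symm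
    rw [← neg_sub, act_neg, norm_neg, htel, act_sum]
    refine (norm_sum_le _ _).trans ?_
    calc _ ≤ ∑ s ∈ Finset.Ico r t, η * g * (√(invModulus G) *
            inputLeverage lam (invModulus G / 9) (features G Y h) Y r +
            (√(invModulus G))⁻¹ * leverage lam (features G Y h) s) :=
          Finset.sum_le_sum fun s hs =>
            norm_act_movement_le hrun hη hκ hY hK hb hr (Finset.mem_Ico.1 hs).1
      _ = η * g * (((t - r : ℕ) : ℝ) * (√(invModulus G) *
            inputLeverage lam (invModulus G / 9) (features G Y h) Y r)) +
          η * g * (√(invModulus G))⁻¹ * ∑ s ∈ Finset.Ico r t, leverage lam (features G Y h) s := by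
          simp only [mul_add, Finset.sum_add_distrib, ← Finset.mul_sum, Finset.sum_const,
            Nat.card_Ico, nsmul_eq_mul]
          ring
      _ ≤ _ := by
          have hle : ((t - r : ℕ) : ℝ) ≤ h := by exact_mod_cast (by omega)
          gcongr

open scoped Classical in
/-- The total cost of replacing, in the truncated convolution, past iterates by current ones. -/
lemma sum_norm_memory_le (hrun : IsNewtonRun Z η lam g (features G Y h) n z) (hη : 0 ≤ η)
    (hκ : 0 < invModulus G) (hY : Y 0 = 0) (hK : 0 < K)
    (hb : K ≤ T → ∀ n, ∑ i ∈ Finset.range n, ‖G i‖ * (if i ≤ h then (h : ℝ) / K else 1) ≤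
      √(invModulus G) / 3) (hR : ∀ t, ∀ x ∈ Z, ‖act (Y t) x‖ ≤ R) {ρ D : ℝ}
    (hρ : ∀ n, ∑ i ∈ Finset.range n, ‖G i‖ ≤ ρ)
    (hD : Real.log (regSum lam (fun s => (features G Y h s).transpose * features G Y h s) T).det -
      Real.log (lam • (1 : Matrix ι ι ℝ)).det ≤ D)
    (hD' : Real.log (jointSum lam (invModulus G / 9) (features G Y h) Y T).det -
      Real.log (lam • (1 : Matrix ι ι ℝ)).det ≤ D) :
    ∑ t ∈ Finset.range (T + 1), ∑ i ∈ Finset.range (h + 1),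
        ‖act (G i) (act (Y (t - i)) (z (t - i) - z t))‖ ≤
      ρ * (10 * η * g * h * (√(invModulus G))⁻¹ * D + 2 * R * (K + 2 * K * D)) := by
  set χ := leverage lam (features G Y h) with hχ
  set τ := inputLeverage lam (invModulus G / 9) (features G Y h) Y with hτ
  set bad : ℕ → ℝ := fun r =>
    if IsUnsettled (jointSum lam (invModulus G / 9) (features G Y h) Y) K T r then 1 else 0
    with hbad
  -- `X` collects the terms attached to the past round `t - i`, to be summed by convolution with `‖G
  -- i‖`; `C` depends on `t` alone and just picks up the mass `ρ`.
  set X : ℕ → ℝ := fun r => η * g * (h * (√(invModulus G) * τ r)) + 2 * R * bad r with hX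
  set C : ℕ → ℝ := fun t => η * g * (√(invModulus G))⁻¹ * ∑ i ∈ Finset.range (t + 1),
    (if 1 ≤ i ∧ i ≤ h then 1 else 0) * χ (t - i) with hC
  have hlam := hrun.lam_pos
  have hg : 0 ≤ g := (norm_nonneg _).trans (hrun.norm_le 0)
  have hsq : 0 < √(invModulus G) := Real.sqrt_pos.2 hκ
  have hτ0 : ∀ r, 0 ≤ τ r := inputLeverage_nonneg hlam (by positivity)
  have hχ0 : ∀ r, 0 ≤ χ r := hrun.leverage_nonneg
  have hR0 : 0 ≤ R := (norm_nonneg _).trans (hR 0 _ (hrun.mem 0))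
  have hρ0 : 0 ≤ ρ := by simpa using hρ 0
  have hbad0 : ∀ r, 0 ≤ bad r := fun r => by simp only [hbad]; split_ifs <;> simp
  have hX0 : ∀ r, 0 ≤ X r := fun r => by
    have := hτ0 r; have := hbad0 r; simp only [hX]; positivity
  have hC0 : ∀ t, 0 ≤ C t := fun t => by
    refine mul_nonneg (by positivity) (Finset.sum_nonneg fun i _ => ?_)
    split_ifs <;> simp [hχ0]
  have hround : ∀ t, ∑ i ∈ Finset.range (h + 1),
      ‖act (G i) (act (Y (t - i)) (z (t - i) - z t))‖ ≤
        ∑ i ∈ Finset.range (t + 1), ‖G i‖ * X (t - i) + ρ * C t := by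
    intro t
    calc _ ≤ ∑ i ∈ (Finset.range (h + 1)).filter (· < t + 1),
          ‖act (G i) (act (Y (t - i)) (z (t - i) - z t))‖ := by
          rw [← Finset.sum_filter_add_sum_filter_not (Finset.range (h + 1)) (· < t + 1)]
          refine add_le_of_le_of_nonpos le_rfl (Finset.sum_nonpos fun i hi => ?_)
          have hi' := (Finset.mem_filter.1 hi).2
          rw [show t - i = 0 by omega, hY]
          simp
      _ ≤ ∑ i ∈ (Finset.range (h + 1)).filter (· < t + 1),
          (‖G i‖ * X (t - i) + ‖G i‖ * C t) := by
          refine Finset.sum_le_sum fun i hi => ?_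
          simp only [Finset.mem_filter, Finset.mem_range] at hi
          rw [← mul_add]
          refine (norm_act_le _ _).trans (mul_le_mul_of_nonneg_left ?_ (norm_nonneg _))
          exact norm_act_sub_le hrun hη hκ hY hK hb hR (by omega) (by omega)
      _ ≤ ∑ i ∈ Finset.range (t + 1), (‖G i‖ * X (t - i) + ‖G i‖ * C t) := by
          refine Finset.sum_le_sum_of_subset_of_nonneg ?_ fun i _ _ => ?_
          · intro i hi
            simpa using (Finset.mem_filter.1 hi).2
          · have := hX0 (t - i); have := hC0 t; positivity
      _ ≤ _ := by
          rw [Finset.sum_add_distrib, ← Finset.sum_mul]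
          gcongr
          · exact hC0 t
          · exact hρ _
  -- The factor `9/κ` inverts the weight `κ/9` of `Y` in the joint second moments.
  have hsumτ : ∑ r ∈ Finset.range (T + 1), τ r ≤ 9 / invModulus G * D := by
    have h1 := (sum_inputLeverage_le (H := features G Y h) (Y := Y) hlam
      (show 0 ≤ invModulus G / 9 by positivity) T).trans hD'
    rw [← le_div_iff₀' (by positivity)] at h1
    refine h1.trans (le_of_eq ?_)
    field_simp
  have hsumχ : ∑ r ∈ Finset.range (T + 1), χ r ≤ D :=
    (sum_trace_inv_mul_le hlam (fun _ => posSemidef_transpose_mul_self _) T).trans hD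
  have hsumbad : ∑ r ∈ Finset.range (T + 1), bad r ≤ K + 2 * K * D := by
    have h1 := card_isUnsettled_le hlam
      (posSemidef_jointIncrement (H := features G Y h) (Y := Y)
        (show 0 ≤ invModulus G / 9 by positivity)) K T
    have h2 : Real.log (lam • (1 : Matrix ι ι ℝ)).det ≤
        Real.log (jointSum lam (invModulus G / 9) (features G Y h) Y 0).det := by
      have h3 := (sum_inputLeverage_le (H := features G Y h) (Y := Y) hlam
        (show 0 ≤ invModulus G / 9 by positivity) 0)
      have h4 := Finset.sum_nonneg fun t (_ : t ∈ Finset.range (0 + 1)) => hτ0 t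
      have h5 : 0 ≤ invModulus G / 9 * ∑ t ∈ Finset.range (0 + 1), τ t := by positivity
      linarith
    simp only [hbad, Finset.sum_boole]
    refine h1.trans ?_
    change (K : ℝ) + 2 * K * (Real.log (jointSum lam (invModulus G / 9) (features G Y h) Y T).det -
      Real.log (jointSum lam (invModulus G / 9) (features G Y h) Y 0).det) ≤ _
    have : Real.log (jointSum lam (invModulus G / 9) (features G Y h) Y T).det -
      Real.log (jointSum lam (invModulus G / 9) (features G Y h) Y 0).det ≤ D := by linarith
    gcongr
  have hsumX : ∑ r ∈ Finset.range (T + 1), X r ≤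
      η * g * h * (9 * (√(invModulus G))⁻¹ * D) + 2 * R * (K + 2 * K * D) := by
    have h1 : ∑ r ∈ Finset.range (T + 1), X r =
        η * g * h * (√(invModulus G) * ∑ r ∈ Finset.range (T + 1), τ r) +
          2 * R * ∑ r ∈ Finset.range (T + 1), bad r := by
      simp only [hX, Finset.sum_add_distrib, Finset.mul_sum, mul_assoc]
    have h2 : √(invModulus G) * (9 / invModulus G * D) = 9 * (√(invModulus G))⁻¹ * D := by
      have h3 : √(invModulus G) / invModulus G = (√(invModulus G))⁻¹ := by
        rw [Real.sqrt_div_self]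
      rw [← h3]; ring
    rw [h1, ← h2]
    gcongr
  have hsumC : ∑ t ∈ Finset.range (T + 1), C t ≤ η * g * (√(invModulus G))⁻¹ * (h * D) := by
    simp only [hC]
    rw [← Finset.mul_sum]
    refine mul_le_mul_of_nonneg_left ?_ (by positivity)
    refine (sum_conv_le (b := h) (fun i => by split_ifs <;> simp) hχ0 (fun n => ?_) _).trans
      (mul_le_mul_of_nonneg_left hsumχ (Nat.cast_nonneg h))
    rw [Finset.sum_boole]
    have : (Finset.range n).filter (fun i => 1 ≤ i ∧ i ≤ h) ⊆ Finset.Icc 1 h := fun i hi => by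
      rw [Finset.mem_Icc]; exact (Finset.mem_filter.1 hi).2
    have := Finset.card_le_card this
    rw [Nat.card_Icc] at this
    exact_mod_cast this
  calc _ ≤ ∑ t ∈ Finset.range (T + 1),
        (∑ i ∈ Finset.range (t + 1), ‖G i‖ * X (t - i) + ρ * C t) :=
        Finset.sum_le_sum fun t _ => hround t
    _ ≤ ρ * ∑ r ∈ Finset.range (T + 1), X r + ρ * ∑ t ∈ Finset.range (T + 1), C t := by
        rw [Finset.sum_add_distrib, ← Finset.mul_sum]
        gcongr
        exact sum_conv_le (fun i => norm_nonneg _) hX0 hρ _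
    _ ≤ ρ * (η * g * h * (9 * (√(invModulus G))⁻¹ * D) + 2 * R * (K + 2 * K * D)) +
          ρ * (η * g * (√(invModulus G))⁻¹ * (h * D)) := by gcongr
    _ = _ := by ring

end Memory

/-! ### Block vectors and one-step unfolding -/

section Joint

variable {a b c d : ℕ}

lemma act_fromBlocks (A : Matrix (Fin a) (Fin c) ℝ) (B : Matrix (Fin a) (Fin d) ℝ)
    (C : Matrix (Fin b) (Fin c) ℝ) (D : Matrix (Fin b) (Fin d) ℝ) (x : Vec (Fin c))
    (y : Vec (Fin d)) :
    act (Matrix.fromBlocks A B C D) (joint x y) =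
      joint (act A x + act B y) (act C x + act D y) := by
  ext i; rcases i with i | i <;> simp [joint, act, Matrix.fromBlocks_mulVec]

lemma act_fromRows (A : Matrix (Fin a) (Fin c) ℝ) (B : Matrix (Fin b) (Fin c) ℝ)
    (x : Vec (Fin c)) : act (Matrix.fromRows A B) x = joint (act A x) (act B x) := by
  ext i; rcases i with i | i <;> simp [joint, act, Matrix.fromRows_mulVec]

lemma act_fromCols (A : Matrix (Fin a) (Fin c) ℝ) (B : Matrix (Fin a) (Fin d) ℝ)
    (x : Vec (Fin c)) (y : Vec (Fin d)) :
    act (Matrix.fromCols A B) (joint x y) = act A x + act B y := by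
  ext i; simp [joint, act, Matrix.fromCols_mulVec]

lemma trajectory_succ {σ : Type} (step : ℕ → σ → σ) (init : σ) {t : ℕ} (ht : 1 ≤ t) :
    trajectory step init (t + 1) = step t (trajectory step init t) := by
  obtain ⟨t, rfl⟩ := Nat.exists_eq_add_of_le' ht
  rfl

end Joint

/-! ### Superposition of nature's iterates and exogenous inputs -/

section Superposition

variable {dx ds dy du dω : ℕ} (S : LinSys dx dy du) (π₀ : NominalController ds dy du dω)
  (w : ℕ → Vec (Fin dx)) (e : ℕ → Vec (Fin dy))

/-- Response of the state of the loop to exogenous inputs. -/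
noncomputable def response (u : ℕ → Vec (Fin du)) (t : ℕ) : Vec (Fin dx ⊕ Fin ds) :=
  ∑ i ∈ Finset.Ico 1 t, act (loopA S π₀ ^ (t - 1 - i) * loopB S π₀) (u i)

lemma response_succ (u : ℕ → Vec (Fin du)) {t : ℕ} (ht : 1 ≤ t) :
    response S π₀ u (t + 1) = act (loopA S π₀) (response S π₀ u t) + act (loopB S π₀) (u t) := by
  rw [response, Finset.sum_Ico_succ_top ht, response, act_sum]
  congr 1
  · refine Finset.sum_congr rfl fun i hi => ?_
    have := Finset.mem_Ico.1 hi
    rw [← mul_act, ← Matrix.mul_assoc, ← pow_succ', show t + 1 - 1 - i = t - 1 - i + 1 by omega]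
  · simp

lemma markovV_response (u : ℕ → Vec (Fin du)) {t : ℕ} (ht : 1 ≤ t) :
    act (Matrix.fromBlocks S.C 0 (π₀.D * S.C) π₀.C) (response S π₀ u t) + joint 0 (u t) =
      ∑ i ∈ Finset.Icc 1 t, act (markovV S π₀ (t - i)) (u i) := by
  rw [← Finset.Ico_add_one_right_eq_Icc, Finset.sum_Ico_succ_top ht, response, act_sum]
  congr 1
  · refine Finset.sum_congr rfl fun i hi => ?_
    have := Finset.mem_Ico.1 hi
    rw [← mul_act, show t - i = t - 1 - i + 1 by omega, markovV, Matrix.mul_assoc]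
  · rw [Nat.sub_self, markovV, act_fromRows]
    simp

lemma markovOmega_response (u : ℕ → Vec (Fin du)) (t : ℕ) :
    act (Matrix.fromCols (π₀.Dω * S.C) π₀.Cω) (response S π₀ u t) =
      ∑ i ∈ Finset.Ico 1 t, act (markovOmega S π₀ (t - i)) (u i) := by
  rw [response, act_sum]
  refine Finset.sum_congr rfl fun i hi => ?_
  have := Finset.mem_Ico.1 hi
  rw [← mul_act, show t - i = t - 1 - i + 1 by omega, markovOmega, Matrix.mul_assoc]

variable {S π₀ w e}

/-- One step of the loop, relative to the loop without exogenous input. -/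
lemma joint_step {x xn : Vec (Fin dx)} {s sn : Vec (Fin ds)} {r : Vec (Fin dx ⊕ Fin ds)}
    (hr : joint x s = joint xn sn + r) (u : Vec (Fin du)) (w' : Vec (Fin dx)) (e' : Vec (Fin dy)) :
    joint (act S.A x + act S.B (u + act π₀.C s + act π₀.D (act S.C x + e')) + w')
        (act π₀.A s + act π₀.B (act S.C x + e') + act π₀.Bex u) =
      joint (act S.A xn + act S.B (act π₀.C sn + act π₀.D (act S.C xn + e')) + w')
        (act π₀.A sn + act π₀.B (act S.C xn + e')) +
      (act (loopA S π₀) r + act (loopB S π₀) u) := by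
  have hr' : r = joint x s - joint xn sn := by rw [hr]; abel
  rw [hr', act_sub, loopA, loopB, act_fromBlocks, act_fromBlocks, act_fromRows]
  ext i
  rcases i with i | i <;> simp [joint, mul_act] <;> ring

lemma joint_output {x xn : Vec (Fin dx)} {s sn : Vec (Fin ds)} {r : Vec (Fin dx ⊕ Fin ds)}
    (hr : joint x s = joint xn sn + r) (u : Vec (Fin du)) (e' : Vec (Fin dy)) :
    joint (act S.C x + e') (u + act π₀.C s + act π₀.D (act S.C x + e')) =
      joint (act S.C xn + e') (act π₀.C sn + act π₀.D (act S.C xn + e')) +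
      (act (Matrix.fromBlocks S.C 0 (π₀.D * S.C) π₀.C) r + joint 0 u) := by
  have hr' : r = joint x s - joint xn sn := by rw [hr]; abel
  rw [hr', act_sub, act_fromBlocks, act_fromBlocks]
  ext i
  rcases i with i | i <;> simp [joint, mul_act] <;> ring

lemma omega_output {x xn : Vec (Fin dx)} {s sn : Vec (Fin ds)} {r : Vec (Fin dx ⊕ Fin ds)}
    (hr : joint x s = joint xn sn + r) (e' : Vec (Fin dy)) :
    act π₀.Cω s + act π₀.Dω (act S.C x + e') =
      act π₀.Cω sn + act π₀.Dω (act S.C xn + e') +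
      act (Matrix.fromCols (π₀.Dω * S.C) π₀.Cω) r := by
  have hr' : r = joint x s - joint xn sn := by rw [hr]; abel
  rw [hr', act_sub, act_fromCols, act_fromCols]
  simp only [act_add, mul_act]
  abel

end Superposition

/-! ### The matrices `Y t` -/

section Embedding

variable {m du dω : ℕ}

lemma embed_congr {ω ω' : ℕ → Vec (Fin dω)} {t : ℕ} (h : ∀ i, 1 ≤ i → i ≤ t → ω i = ω' i) :
    (embed m ω t : Matrix (Fin du) (PIdx m du dω) ℝ) = embed m ω' t := by
  ext a p
  simp only [embed, Matrix.of_apply]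
  by_cases hp : a = p.2.1 ∧ (p.1 : ℕ) < t
  · rw [if_pos hp, if_pos hp, h _ (by omega) (by omega)]
  · rw [if_neg hp, if_neg hp]

/-- Truncated subtraction sends all nonpositive rounds to `0`, so this implements the convention `Y
s = 0` for `s ≤ 0`. -/
lemma embed_zero (ω : ℕ → Vec (Fin dω)) :
    (embed m ω 0 : Matrix (Fin du) (PIdx m du dω) ℝ) = 0 := by
  ext a p; simp [embed]

lemma act_embed (ω : ℕ → Vec (Fin dω)) (t : ℕ) (z : Vec (PIdx m du dω)) :
    act (embed m ω t) z =
      ∑ i : Fin m, if (i : ℕ) < t then act (block z i) (ω (t - i)) else 0 := by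
  ext a
  simp only [act, Matrix.mulVec, dotProduct, embed, Matrix.of_apply, Fintype.sum_prod_type,
    WithLp.ofLp_sum, Finset.sum_apply]
  refine Finset.sum_congr rfl fun i _ => ?_
  by_cases hi : (i : ℕ) < t
  · simp only [hi, and_true, if_true, block]
    rw [Finset.sum_eq_single a]
    · exact Finset.sum_congr rfl fun b _ => by rw [if_pos rfl, mul_comm]; rfl
    · intro b _ hb; simp [Ne.symm hb]
    · simp
  · simp [hi]

end Embedding

/-! ### Gradient of a loss composed with the features -/

section Gradient

variable {ι κ : Type} [Fintype ι] [Fintype κ]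

/-- `act M` as a continuous linear map. -/
noncomputable def actCLM (M : Matrix ι κ ℝ) : Vec κ →L[ℝ] Vec ι :=
  LinearMap.toContinuousLinearMap
    { toFun := act M, map_add' := act_add M, map_smul' := act_smul M }

lemma gradient_comp_act {ℓ : Vec ι → ℝ} (hℓ : Differentiable ℝ ℓ) (v : Vec ι) (H : Matrix ι κ ℝ)
    (z : Vec κ) :
    gradient (fun z => ℓ (v + act H z)) z = act H.transpose (gradient ℓ (v + act H z)) := by
  have h1 := (hℓ (v + act H z)).hasGradientAt.hasFDerivAt
  have h2 : HasFDerivAt (fun z => v + act H z) (actCLM H) z :=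
    (actCLM H).hasFDerivAt.const_add v
  have h3 := h1.comp z h2
  have h4 : InnerProductSpace.toDual ℝ (Vec κ) (act H.transpose (gradient ℓ (v + act H z))) =
      (InnerProductSpace.toDual ℝ (Vec ι) (gradient ℓ (v + act H z))).comp (actCLM H) := by
    refine ContinuousLinearMap.ext fun y => ?_
    change inner ℝ (act H.transpose (gradient ℓ (v + act H z))) y =
      inner ℝ (gradient ℓ (v + act H z)) (act H y)
    rw [inner_act]
  refine HasGradientAt.gradient (hasGradientAt_iff_hasFDerivAt.2 ?_)
  rw [h4]
  exact h3

end Gradient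

/-! ### The closed loop in terms of nature's iterates -/

section Unroll

variable {dx ds dy du dω : ℕ} {S : LinSys dx dy du} {π₀ : NominalController ds dy du dω}
  {w : ℕ → Vec (Fin dx)} {e : ℕ → Vec (Fin dy)} {ℓ : ℕ → Vec (Fin dy ⊕ Fin du) → ℝ}
  {P : AlgInput dy du dω} {z₁ : Vec (PIdx P.m du dω)}

/-- The parameter played in round `t`. -/
noncomputable def algParam (S : LinSys dx dy du) (π₀ : NominalController ds dy du dω)
    (w : ℕ → Vec (Fin dx)) (e : ℕ → Vec (Fin dy)) (ℓ : ℕ → Vec (Fin dy ⊕ Fin du) → ℝ)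
    (P : AlgInput dy du dω) (z₁ : Vec (PIdx P.m du dω)) (t : ℕ) : Vec (PIdx P.m du dω) :=
  (loopState S π₀ w e ℓ P z₁ t).alg.z

/-- The exogenous input of round `t`, in terms of nature's iterates. -/
noncomputable def algInputOf (S : LinSys dx dy du) (π₀ : NominalController ds dy du dω)
    (w : ℕ → Vec (Fin dx)) (e : ℕ → Vec (Fin dy)) (ℓ : ℕ → Vec (Fin dy ⊕ Fin du) → ℝ)
    (P : AlgInput dy du dω) (z₁ : Vec (PIdx P.m du dω)) (t : ℕ) : Vec (Fin du) :=
  act (embed P.m (omegaNat S π₀ w e) t) (algParam S π₀ w e ℓ P z₁ t)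

/-- The features of round `t`, in terms of nature's iterates. -/
noncomputable def algFeatures (S : LinSys dx dy du) (π₀ : NominalController ds dy du dω)
    (w : ℕ → Vec (Fin dx)) (e : ℕ → Vec (Fin dy)) (P : AlgInput dy du dω) :
    ℕ → Matrix (Fin dy ⊕ Fin du) (PIdx P.m du dω) ℝ :=
  features P.Gv (embed P.m (omegaNat S π₀ w e)) P.h

/-- The memory of the algorithm agrees with nature's iterates. -/
structure LoopInvariant (S : LinSys dx dy du) (π₀ : NominalController ds dy du dω)
    (w : ℕ → Vec (Fin dx)) (e : ℕ → Vec (Fin dy)) (ℓ : ℕ → Vec (Fin dy ⊕ Fin du) → ℝ)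
    (P : AlgInput dy du dω) (z₁ : Vec (PIdx P.m du dω)) (t : ℕ) : Prop where
  uex : ∀ i, 1 ≤ i → i < t →
    (loopState S π₀ w e ℓ P z₁ t).alg.uex i = algInputOf S π₀ w e ℓ P z₁ i
  omegaHat : ∀ i, 1 ≤ i → i < t →
    (loopState S π₀ w e ℓ P z₁ t).alg.omegaHat i = omegaNat S π₀ w e i
  lam : (loopState S π₀ w e ℓ P z₁ t).alg.Lam = P.lam • 1 +
    ∑ s ∈ Finset.range t, (algFeatures S π₀ w e P s).transpose * algFeatures S π₀ w e P s
  state : joint (loopState S π₀ w e ℓ P z₁ t).x (loopState S π₀ w e ℓ P z₁ t).s =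
    joint (natState S π₀ w e t).1 (natState S π₀ w e t).2 +
      response S π₀ (algInputOf S π₀ w e ℓ P z₁) t

lemma algFeatures_zero : algFeatures S π₀ w e P 0 = 0 := by
  rw [algFeatures, features]
  refine Finset.sum_eq_zero fun i _ => ?_
  rw [Nat.zero_sub, embed_zero, Matrix.mul_zero]

lemma loopInvariant_one : LoopInvariant S π₀ w e ℓ P z₁ 1 where
  uex i h1 h2 := by omega
  omegaHat i h1 h2 := by omega
  lam := by
    rw [Finset.sum_range_one, algFeatures_zero]
    simp [loopState, trajectory, algInit]
  state := by simp [loopState, natState, trajectory, response]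

namespace LoopInvariant

variable {t : ℕ}

lemma loopRound_omegaHat (h : LoopInvariant S π₀ w e ℓ P z₁ t) (hω : P.Gω = markovOmega S π₀)
    {i : ℕ} (hi : 1 ≤ i) (hit : i ≤ t) :
    (loopRound S π₀ e P t (loopState S π₀ w e ℓ P z₁ t)).2.1.omegaHat i = omegaNat S π₀ w e i := by
  simp only [loopRound, algPlay]
  rcases hit.eq_or_lt with rfl | hlt
  -- The response of `ω` in round `i` involves only inputs before `i`, which the memory holds;
  -- subtracting it leaves nature's iterate exactly.
  · rw [Function.update_self, omega_output h.state, markovOmega_response, hω]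
    have : ∑ j ∈ Finset.Ico 1 i, act (markovOmega S π₀ (i - j))
        ((loopState S π₀ w e ℓ P z₁ i).alg.uex j) =
        ∑ j ∈ Finset.Ico 1 i, act (markovOmega S π₀ (i - j)) (algInputOf S π₀ w e ℓ P z₁ j) :=
      Finset.sum_congr rfl fun j hj => by
        rw [h.uex j (Finset.mem_Ico.1 hj).1 (Finset.mem_Ico.1 hj).2]
    rw [this, add_sub_cancel_right, omegaNat]
  · rw [Function.update_of_ne hlt.ne, h.omegaHat i hi hlt]

lemma loopRound_embed (h : LoopInvariant S π₀ w e ℓ P z₁ t) (hω : P.Gω = markovOmega S π₀)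
    {i : ℕ} (hit : i ≤ t) :
    (embed P.m (loopRound S π₀ e P t (loopState S π₀ w e ℓ P z₁ t)).2.1.omegaHat i :
      Matrix (Fin du) (PIdx P.m du dω) ℝ) = embed P.m (omegaNat S π₀ w e) i :=
  embed_congr fun _ h1 h2 => h.loopRound_omegaHat hω h1 (h2.trans hit)

lemma loopRound_uex (h : LoopInvariant S π₀ w e ℓ P z₁ t) (hω : P.Gω = markovOmega S π₀)
    {i : ℕ} (hi : 1 ≤ i) (hit : i ≤ t) :
    (loopRound S π₀ e P t (loopState S π₀ w e ℓ P z₁ t)).2.1.uex i =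
      algInputOf S π₀ w e ℓ P z₁ i := by
  rcases hit.eq_or_lt with rfl | hlt
  · have := h.loopRound_embed hω le_rfl
    simp only [loopRound, algPlay] at this ⊢
    rw [Function.update_self, this, algInputOf, algParam]
  · simp only [loopRound, algPlay]
    rw [Function.update_of_ne hlt.ne, h.uex i hi hlt]

lemma algIterate_eq (h : LoopInvariant S π₀ w e ℓ P z₁ t) (hω : P.Gω = markovOmega S π₀)
    (ht : 1 ≤ t) :
    algIterate S π₀ w e ℓ P z₁ t = vNat S π₀ w e t +
      ∑ i ∈ Finset.Icc 1 t, act (markovV S π₀ (t - i)) (algInputOf S π₀ w e ℓ P z₁ i) := by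
  have hu := h.loopRound_uex hω ht le_rfl
  rw [← markovV_response _ _ _ ht, vNat, ← joint_output h.state, ← hu]
  rfl

/-- Since every recovered signal is exact, the update is a Newton step with features and losses
determined by nature's iterates, which do not depend on the parameters played. -/
lemma algUpdate_spec (h : LoopInvariant S π₀ w e ℓ P z₁ t) (hv : P.Gv = markovV S π₀)
    (hω : P.Gω = markovOmega S π₀) (ht : 1 ≤ t) :
    (loopState S π₀ w e ℓ P z₁ (t + 1)).alg.Lam = P.lam • 1 + ∑ s ∈ Finset.range (t + 1),
        (algFeatures S π₀ w e P s).transpose * algFeatures S π₀ w e P s ∧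
      algParam S π₀ w e ℓ P z₁ (t + 1) = projOn (paramSet P.m du dω P.RM)
        (loopState S π₀ w e ℓ P z₁ (t + 1)).alg.Lam
        (algParam S π₀ w e ℓ P z₁ t -
          P.η • act (loopState S π₀ w e ℓ P z₁ (t + 1)).alg.Lam⁻¹
            (gradient (fun z => ℓ t (vNat S π₀ w e t + act (algFeatures S π₀ w e P t) z))
              (algParam S π₀ w e ℓ P z₁ t))) := by
  set p := loopState S π₀ w e ℓ P z₁ t with hp
  set r := loopRound S π₀ e P t p with hr
  have hstep : (loopState S π₀ w e ℓ P z₁ (t + 1)).alg =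
      algUpdate P t r.2.1 (joint r.1 r.2.2) (ℓ t) := by
    rw [loopState, trajectory_succ _ _ ht]
    rfl
  have hH : ∑ i ∈ Finset.range (P.h + 1), P.Gv i * embed P.m r.2.1.omegaHat (t - i) =
      algFeatures S π₀ w e P t :=
    Finset.sum_congr rfl fun i _ => by
      rw [h.loopRound_embed hω (Nat.sub_le t i)]
      rfl
  have hvhat : joint r.1 r.2.2 - ∑ i ∈ Finset.Icc 1 t, act (P.Gv (t - i)) (r.2.1.uex i) =
      vNat S π₀ w e t := by
    have h1 := h.algIterate_eq hω ht
    rw [algIterate] at h1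
    rw [hv, Finset.sum_congr rfl fun i hi => by
      rw [h.loopRound_uex hω (Finset.mem_Icc.1 hi).1 (Finset.mem_Icc.1 hi).2]]
    exact sub_eq_of_eq_add h1
  have hz : r.2.1.z = algParam S π₀ w e ℓ P z₁ t := rfl
  have hL : r.2.1.Lam = p.alg.Lam := rfl
  constructor
  · rw [hstep]
    simp only [algUpdate, hH]
    rw [hL, h.lam, Finset.sum_range_succ, add_assoc]
  · rw [algParam, hstep]
    simp only [algUpdate, hH, hvhat, hz]

lemma succ (h : LoopInvariant S π₀ w e ℓ P z₁ t) (hv : P.Gv = markovV S π₀)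
    (hω : P.Gω = markovOmega S π₀) (ht : 1 ≤ t) : LoopInvariant S π₀ w e ℓ P z₁ (t + 1) where
  uex i h1 h2 := by
    have := h.loopRound_uex hω h1 (Nat.lt_succ_iff.1 h2)
    rw [loopState, trajectory_succ _ _ ht]
    exact this
  omegaHat i h1 h2 := by
    have := h.loopRound_omegaHat hω h1 (Nat.lt_succ_iff.1 h2)
    rw [loopState, trajectory_succ _ _ ht]
    exact this
  lam := (h.algUpdate_spec hv hω ht).1
  state := by
    have hu := h.loopRound_uex hω ht le_rfl
    rw [response_succ _ _ _ ht, natState, trajectory_succ _ _ ht, ← natState,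
      loopState, trajectory_succ _ _ ht, ← loopState, ← hu]
    exact joint_step h.state _ _ _

end LoopInvariant

lemma loopInvariant (hv : P.Gv = markovV S π₀) (hω : P.Gω = markovOmega S π₀) {t : ℕ}
    (ht : 1 ≤ t) : LoopInvariant S π₀ w e ℓ P z₁ t := by
  induction t, ht using Nat.le_induction with
  | base => exact loopInvariant_one
  | succ t ht ih => exact ih.succ hv hω ht

end Unroll

/-! ### Operator norms and truncated convolutions -/

section Norms

variable {ι κ : Type} [Fintype ι] [Fintype κ] [DecidableEq ι] [DecidableEq κ]

lemma abs_entry_le_norm (M : Matrix ι κ ℝ) (i : ι) (j : κ) : |M i j| ≤ ‖M‖ := by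
  have h := norm_act_le M (EuclideanSpace.single j 1)
  have h2 := PiLp.norm_apply_le (act M (EuclideanSpace.single j 1)) i
  have h3 : (act M (EuclideanSpace.single j 1)) i = M i j := by
    simp [act, Matrix.mulVec_single]
  rw [h3, Real.norm_eq_abs] at h2
  simpa using h2.trans h

omit [DecidableEq ι] in
lemma trace_transpose_mul_self_eq (P : Matrix ι κ ℝ) :
    (P.transpose * P).trace = ∑ p, ‖act P (EuclideanSpace.single p 1)‖ ^ 2 := by
  rw [Matrix.trace]
  refine Finset.sum_congr rfl fun p _ => ?_
  rw [EuclideanSpace.real_norm_sq_eq]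
  simp [act, Matrix.mul_apply, sq, Matrix.mulVec_single]

omit [DecidableEq ι] in
lemma trace_transpose_mul_self_le (P : Matrix ι κ ℝ) {b : ℝ}
    (hb : ∀ p, ‖act P (EuclideanSpace.single p 1)‖ ≤ b) :
    (P.transpose * P).trace ≤ Fintype.card κ * b ^ 2 := by
  rw [trace_transpose_mul_self_eq]
  calc _ ≤ ∑ _p : κ, b ^ 2 :=
        Finset.sum_le_sum fun p _ => pow_le_pow_left₀ (norm_nonneg _) (hb p) 2
    _ = _ := by simp

omit [DecidableEq ι] in
lemma sum_norm_le_of_l1op {G : ℕ → Matrix ι κ ℝ} {b : ℝ} (hb : 0 ≤ b)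
    (h : l1op G ≤ ENNReal.ofReal b) (n : ℕ) : ∑ i ∈ Finset.range n, ‖G i‖ ≤ b := by
  have h1 := (ENNReal.sum_le_tsum (Finset.range n)).trans h
  simp_rw [← ofReal_norm] at h1
  rw [← ENNReal.ofReal_sum_of_nonneg fun i _ => norm_nonneg _] at h1
  exact (ENNReal.ofReal_le_ofReal_iff hb).1 h1

omit [DecidableEq ι] in
lemma sum_norm_le_of_decay {G : ℕ → Matrix ι κ ℝ} {b : ℝ} (hb : 0 ≤ b) {k : ℕ}
    (h : decay G k ≤ ENNReal.ofReal b) (n : ℕ) : ∑ i ∈ Finset.range n, ‖G (k + i)‖ ≤ b :=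
  sum_norm_le_of_l1op (G := fun i => G (k + i)) hb h n

omit [Fintype ι] [Fintype κ] [DecidableEq ι] [DecidableEq κ] in
lemma sum_range_mul_ite_le {f : ℕ → ℝ} (hf : ∀ i, 0 ≤ f i) {a b c : ℝ} (hc : 0 ≤ c) {h : ℕ}
    (ha : ∀ n, ∑ i ∈ Finset.range n, f i ≤ a)
    (hb : ∀ n, ∑ i ∈ Finset.range n, f (h + 1 + i) ≤ b) (n : ℕ) :
    ∑ i ∈ Finset.range n, f i * (if i ≤ h then c else 1) ≤ a * c + b := by
  calc _ ≤ ∑ i ∈ Finset.range (h + 1 + n), f i * (if i ≤ h then c else 1) := by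
        refine Finset.sum_le_sum_of_subset_of_nonneg
          (Finset.range_subset_range.2 (by omega)) fun i _ _ => ?_
        have := hf i
        split_ifs <;> positivity
    _ = (∑ i ∈ Finset.range (h + 1), f i) * c + ∑ i ∈ Finset.range n, f (h + 1 + i) := by
        rw [Finset.sum_range_add, Finset.sum_mul]
        congr 1
        · refine Finset.sum_congr rfl fun i hi => ?_
          rw [if_pos (by simpa [Nat.lt_succ_iff] using hi)]
        · refine Finset.sum_congr rfl fun i _ => ?_
          rw [if_neg (by omega), mul_one]
    _ ≤ _ := add_le_add (mul_le_mul_of_nonneg_right (ha _) hc) (hb n)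

omit [DecidableEq ι] [DecidableEq κ] in
lemma sum_Icc_act_eq (G : ℕ → Matrix ι κ ℝ) {u : ℕ → Vec κ} (hu : u 0 = 0) (t : ℕ) :
    ∑ i ∈ Finset.Icc 1 t, act (G (t - i)) (u i) =
      ∑ j ∈ Finset.range (t + 1), act (G j) (u (t - j)) := by
  have hflip := Finset.sum_flip (n := t) (fun k => act (G (t - k)) (u k))
  have h1 : ∑ j ∈ Finset.range (t + 1), act (G j) (u (t - j)) =
      ∑ k ∈ Finset.range (t + 1), act (G (t - k)) (u k) := by
    rw [← hflip]
    refine Finset.sum_congr rfl fun i hi => ?_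
    rw [Nat.sub_sub_self (by simpa [Nat.lt_succ_iff] using hi)]
  rw [h1, Finset.range_eq_Ico, Finset.sum_eq_sum_Ico_succ_bot (Nat.succ_pos t), hu, act_zero,
    zero_add]
  rfl

lemma norm_conv_le (G : ℕ → Matrix ι κ ℝ) {u : ℕ → Vec κ} {a b : ℝ}
    (ha : ∀ n, ∑ i ∈ Finset.range n, ‖G i‖ ≤ a) (hu : ∀ s, ‖u s‖ ≤ b) (n t : ℕ) :
    ‖∑ i ∈ Finset.range n, act (G i) (u (t - i))‖ ≤ a * b := by
  have hb0 : 0 ≤ b := (norm_nonneg _).trans (hu 0)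
  calc _ ≤ ∑ i ∈ Finset.range n, ‖G i‖ * b :=
        (norm_sum_le _ _).trans (Finset.sum_le_sum fun i _ => (norm_act_le _ _).trans
          (mul_le_mul_of_nonneg_left (hu _) (norm_nonneg _)))
    _ ≤ a * b := by
        rw [← Finset.sum_mul]
        exact mul_le_mul_of_nonneg_right (ha n) hb0

/-- The error of truncating a convolution at lag `h`. -/
lemma norm_conv_sub_truncated_le (G : ℕ → Matrix ι κ ℝ) {u : ℕ → Vec κ} (hu0 : u 0 = 0) {b c : ℝ}
    {h : ℕ} (hb : ∀ n, ∑ i ∈ Finset.range n, ‖G (h + 1 + i)‖ ≤ b) (hu : ∀ s, ‖u s‖ ≤ c) (t : ℕ) :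
    ‖∑ i ∈ Finset.range (t + 1), act (G i) (u (t - i)) -
      ∑ i ∈ Finset.range (h + 1), act (G i) (u (t - i))‖ ≤ b * c := by
  have h1 : ∑ i ∈ Finset.range (t + 1), act (G i) (u (t - i)) =
      ∑ i ∈ Finset.range (h + 1 + t), act (G i) (u (t - i)) := by
    refine Finset.sum_subset (Finset.range_subset_range.2 (by omega)) fun i _ hi => ?_
    rw [Finset.mem_range] at hi
    rw [show t - i = 0 by omega, hu0, act_zero]
  rw [h1, Finset.sum_range_add, add_sub_cancel_left]
  have hc0 : 0 ≤ c := (norm_nonneg _).trans (hu 0)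
  calc _ ≤ ∑ i ∈ Finset.range t, ‖G (h + 1 + i)‖ * c :=
        (norm_sum_le _ _).trans (Finset.sum_le_sum fun i _ => (norm_act_le _ _).trans
          (mul_le_mul_of_nonneg_left (hu _) (norm_nonneg _)))
    _ ≤ b * c := by
        rw [← Finset.sum_mul]
        exact mul_le_mul_of_nonneg_right (hb t) hc0

end Norms

/-! ### The constraint set -/

section Parameters

variable {m du dω : ℕ} {R : ℝ}

/-- `block` as a linear map. -/
def blockLM (i : Fin m) : Vec (PIdx m du dω) →ₗ[ℝ] Matrix (Fin du) (Fin dω) ℝ where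
  toFun z := block z i
  map_add' x y := by ext; simp [block]
  map_smul' c x := by ext; simp [block]

lemma convex_paramSet : Convex ℝ (paramSet m du dω R) := by
  have h : ConvexOn ℝ Set.univ fun z : Vec (PIdx m du dω) => ∑ i, ‖block z i‖ := by
    have h1 : ∀ s : Finset (Fin m),
        ConvexOn ℝ Set.univ fun z : Vec (PIdx m du dω) => ∑ i ∈ s, ‖block z i‖ := by
      intro s
      induction s using Finset.induction_on with
      | empty => simpa using convexOn_const (𝕜 := ℝ) (0 : ℝ) convex_univ
      | insert a s ha ih =>
        simp only [Finset.sum_insert ha]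
        exact ((convexOn_univ_norm (E := Matrix (Fin du) (Fin dω) ℝ)).comp_linearMap
          (blockLM a)).add ih
    exact h1 Finset.univ
  simpa [paramSet] using h.convex_le R

lemma norm_block_le {z : Vec (PIdx m du dω)} (hz : z ∈ paramSet m du dω R) (i : Fin m) :
    ‖block z i‖ ≤ R :=
  (Finset.single_le_sum (f := fun i => ‖block z i‖) (fun _ _ => norm_nonneg _)
    (Finset.mem_univ i)).trans hz

/-- A squared entry of block `i` is at most `R‖block z i‖`, and the block norms sum to at most `R`;
this avoids a factor `m`. -/
lemma norm_sq_le_of_mem_paramSet {z : Vec (PIdx m du dω)} (hz : z ∈ paramSet m du dω R) :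
    ‖z‖ ^ 2 ≤ du * dω * R ^ 2 := by
  have hR : 0 ≤ R := (Finset.sum_nonneg fun i _ => norm_nonneg (block z i)).trans hz
  have h1 : ∀ i : Fin m, ∑ a : Fin du, ∑ b : Fin dω, z (i, a, b) ^ 2 ≤
      du * dω * (R * ‖block z i‖) := by
    intro i
    calc _ ≤ ∑ _a : Fin du, ∑ _b : Fin dω, R * ‖block z i‖ := by
          refine Finset.sum_le_sum fun a _ => Finset.sum_le_sum fun b _ => ?_
          have h2 : |z (i, a, b)| ≤ ‖block z i‖ := abs_entry_le_norm (block z i) a b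
          rw [← sq_abs, sq]
          exact mul_le_mul (h2.trans (norm_block_le hz i)) h2 (abs_nonneg _) hR
      _ = _ := by simp; ring
  rw [EuclideanSpace.real_norm_sq_eq, Fintype.sum_prod_type]
  simp only [Fintype.sum_prod_type]
  calc _ ≤ ∑ i : Fin m, du * dω * (R * ‖block z i‖) := Finset.sum_le_sum fun i _ => h1 i
    _ = du * dω * (R * ∑ i : Fin m, ‖block z i‖) := by simp only [Finset.mul_sum]
    _ ≤ _ := by
        rw [sq]
        have : ∑ i : Fin m, ‖block z i‖ ≤ R := hz
        gcongr

lemma isCompact_paramSet : IsCompact (paramSet m du dω R) := by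
  refine Metric.isCompact_of_isClosed_isBounded ?_ ?_
  · have hc : Continuous fun z : Vec (PIdx m du dω) => ∑ i, ‖block z i‖ :=
      continuous_finsetSum _ fun i _ =>
        ((blockLM i).continuous_of_finiteDimensional).norm
    exact isClosed_le hc continuous_const
  · refine (Metric.isBounded_closedBall (x := (0 : Vec (PIdx m du dω)))
      (r := √(du * dω * R ^ 2))).subset fun z hz => ?_
    rw [mem_closedBall_zero_iff]
    exact Real.le_sqrt_of_sq_le (norm_sq_le_of_mem_paramSet hz)

lemma norm_act_embed_le {ω : ℕ → Vec (Fin dω)} {b : ℝ} (hω : ∀ t, 1 ≤ t → ‖ω t‖ ≤ b)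
    {z : Vec (PIdx m du dω)} (hz : z ∈ paramSet m du dω R) (t : ℕ) :
    ‖act (embed m ω t) z‖ ≤ R * b := by
  have hb : 0 ≤ b := (norm_nonneg _).trans (hω 1 le_rfl)
  rw [act_embed]
  calc _ ≤ ∑ i : Fin m, ‖block z i‖ * b := by
        refine (norm_sum_le _ _).trans (Finset.sum_le_sum fun i _ => ?_)
        split_ifs with hi
        · exact (norm_act_le _ _).trans
            (mul_le_mul_of_nonneg_left (hω _ (by omega)) (norm_nonneg _))
        · rw [norm_zero]; positivity
    _ ≤ _ := by
        rw [← Finset.sum_mul]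
        exact mul_le_mul_of_nonneg_right hz hb

/-- A column of `Y t` has at most one nonzero entry, a coordinate of some `ω s`. -/
lemma norm_act_embed_single_le {ω : ℕ → Vec (Fin dω)} {b : ℝ} (hω : ∀ t, 1 ≤ t → ‖ω t‖ ≤ b)
    (t : ℕ) (p : PIdx m du dω) :
    ‖act (embed m ω t) (EuclideanSpace.single p 1)‖ ≤ b := by
  have hb : 0 ≤ b := (norm_nonneg _).trans (hω 1 le_rfl)
  have h : act (embed m ω t) (EuclideanSpace.single p 1) =
      EuclideanSpace.single p.2.1 (if (p.1 : ℕ) < t then ω (t - p.1) p.2.2 else 0) := by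
    ext a
    by_cases ha : a = p.2.1 <;> by_cases ht : (p.1 : ℕ) < t <;>
      simp [act, embed, Matrix.mulVec_single, ha, ht]
  rw [h, PiLp.norm_single]
  split_ifs with ht
  · exact (PiLp.norm_apply_le _ _).trans (hω _ (by omega))
  · simpa using hb

end Parameters

/-! ### Consequences of strong convexity -/

section Losses

variable {ι : Type} [Fintype ι] {α L : ℝ} {ℓ : Vec ι → ℝ}

/-- Divide the strong convexity inequality on the segment from `v` to `v'` by `t` and let `t → 0+`.
-/
lemma LossRegular.sub_le (hℓ : LossRegular α L ℓ) (v v' : Vec ι) :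
    ℓ v - ℓ v' ≤ inner ℝ (gradient ℓ v) (v - v') - α / 2 * ‖v - v'‖ ^ 2 := by
  obtain ⟨hd, hc, -⟩ := hℓ
  have h1 : HasDerivAt (fun t : ℝ => ℓ (v + t • (v' - v))) (inner ℝ (gradient ℓ v) (v' - v)) 0 := by
    have h2 : HasFDerivAt ℓ (InnerProductSpace.toDual ℝ (Vec ι) (gradient ℓ v))
        (v + (0 : ℝ) • (v' - v)) := by
      simpa using (hd v).hasGradientAt.hasFDerivAt
    have h3 : HasDerivAt (fun t : ℝ => v + t • (v' - v)) (v' - v) 0 := by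
      simpa using ((hasDerivAt_id (0 : ℝ)).smul_const (v' - v)).const_add v
    exact h2.comp_hasDerivAt (0 : ℝ) h3
  have h4 := h1.tendsto_slope_zero_right
  have h5 : Filter.Tendsto (fun t : ℝ => ℓ v' - ℓ v - (1 - t) * (α / 2 * ‖v - v'‖ ^ 2))
      (nhdsWithin 0 (Set.Ioi 0)) (nhds (ℓ v' - ℓ v - (1 - 0) * (α / 2 * ‖v - v'‖ ^ 2))) := by
    refine Filter.Tendsto.mono_left ?_ nhdsWithin_le_nhds
    exact Continuous.tendsto (by fun_prop) 0
  have h6 := le_of_tendsto_of_tendsto h4 h5 (by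
    filter_upwards [Ioo_mem_nhdsGT (zero_lt_one' ℝ)] with t ht
    have h7 := hc.2 (Set.mem_univ v) (Set.mem_univ v') (sub_nonneg.2 ht.2.le) ht.1.le
      (sub_add_cancel 1 t)
    rw [show (1 - t) • v + t • v' = v + t • (v' - v) by rw [sub_smul, one_smul, smul_sub]; abel]
      at h7
    simp only [zero_add, zero_smul, add_zero, smul_eq_mul] at h7 ⊢
    rw [inv_mul_le_iff₀ ht.1]
    linarith)
  rw [← neg_sub v v', inner_neg_right] at h6
  linarith

lemma LossRegular.sub_le_norm (hα : 0 ≤ α) (hℓ : LossRegular α L ℓ) {v v' : Vec ι} {g : ℝ}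
    (hg : ‖gradient ℓ v‖ ≤ g) : ℓ v - ℓ v' ≤ g * ‖v - v'‖ := by
  have h1 := hℓ.sub_le v v'
  have h2 := real_inner_le_norm (gradient ℓ v) (v - v')
  have h3 : ‖gradient ℓ v‖ * ‖v - v'‖ ≤ g * ‖v - v'‖ := by gcongr
  have h4 : 0 ≤ α / 2 * ‖v - v'‖ ^ 2 := by positivity
  linarith

/-- Add the strong convexity inequalities between `v` and `-v` for a unit vector `v`, where both
gradients are at most `L`. This lets `α` and `L` be absorbed into `L²/α`. -/
lemma LossRegular.le [Nonempty ι] (hℓ : LossRegular α L ℓ) : α ≤ L := by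
  classical
  obtain ⟨i⟩ := ‹Nonempty ι›
  set v : Vec ι := EuclideanSpace.single i 1 with hv
  have hn : ‖v‖ = 1 := by simp [hv]
  have h2 : ‖v - -v‖ = 2 := by
    rw [sub_neg_eq_add, ← two_smul ℝ v, norm_smul, hn]; norm_num
  have h2' : ‖-v - v‖ = 2 := by rw [← norm_neg, neg_sub, sub_neg_eq_add, ← sub_neg_eq_add, h2]
  have h3 := hℓ.sub_le v (-v)
  have h4 := hℓ.sub_le (-v) v
  have h5 := real_inner_le_norm (gradient ℓ v) (v - -v)
  have h6 := real_inner_le_norm (gradient ℓ (-v)) (-v - v)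
  have h7 := hℓ.2.2 v
  have h8 := hℓ.2.2 (-v)
  rw [norm_neg] at h8
  rw [hn, max_self, mul_one] at h7 h8
  rw [h2] at h3 h5
  rw [h2'] at h4 h6
  linarith

end Losses

/-! ### The three parts of the regret -/

section Assembly

variable {dx ds dy du dω : ℕ} {S : LinSys dx dy du} {π₀ : NominalController ds dy du dω}
  {w : ℕ → Vec (Fin dx)} {e : ℕ → Vec (Fin dy)} {ℓ : ℕ → Vec (Fin dy ⊕ Fin du) → ℝ}
  {P : AlgInput dy du dω} {z₁ : Vec (PIdx P.m du dω)} {α L Rnat ρ b : ℝ}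

/-- The exogenous input enters `u` directly, so `G_v 0` contains an identity block. Hence `R_{π₀} ≥
1`. -/
lemma one_le_norm_markovV_zero (hdu : 0 < du) : 1 ≤ ‖markovV S π₀ 0‖ := by
  have h := abs_entry_le_norm (markovV S π₀ 0) (Sum.inr ⟨0, hdu⟩) ⟨0, hdu⟩
  simpa [markovV] using h

lemma algParam_mem (hv : P.Gv = markovV S π₀) (hω : P.Gω = markovOmega S π₀)
    (hz₁ : z₁ ∈ paramSet P.m du dω P.RM) (t : ℕ) :
    algParam S π₀ w e ℓ P z₁ t ∈ paramSet P.m du dω P.RM := by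
  rcases t with _ | _ | t
  · exact hz₁
  · exact hz₁
  · rw [((loopInvariant hv hω (Nat.succ_pos t)).algUpdate_spec hv hω (Nat.succ_pos t)).2]
    exact (projOn_spec isCompact_paramSet ⟨z₁, hz₁⟩ _ _).1

lemma act_features {ι ν υ : Type} [Fintype ι] [Fintype ν] [Fintype υ] (G : ℕ → Matrix ν υ ℝ)
    (Y : ℕ → Matrix υ ι ℝ) (h t : ℕ) (x : Vec ι) :
    act (features G Y h t) x = ∑ i ∈ Finset.range (h + 1), act (G i) (act (Y (t - i)) x) := by
  simp only [features, sum_act, mul_act]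

/-- Nature's part and the convolution are each at most `E = ρ·RM·Rnat`. Played and memoryless
iterates both have this form, hence the common gradient bound `2LE`. -/
lemma norm_nat_add_conv_le {u : ℕ → Vec (Fin du)} (hRM : 1 ≤ P.RM) (hρ1 : 1 ≤ ρ)
    (hRnat : 0 ≤ Rnat) (hnat : ∀ t, 1 ≤ t → ‖vNat S π₀ w e t‖ ≤ Rnat)
    (hρ : ∀ n, ∑ i ∈ Finset.range n, ‖markovV S π₀ i‖ ≤ ρ) (hu : ∀ s, ‖u s‖ ≤ P.RM * Rnat)
    (k : ℕ) {t : ℕ} (ht : 1 ≤ t) :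
    ‖vNat S π₀ w e t + ∑ i ∈ Finset.range k, act (markovV S π₀ i) (u (t - i))‖ ≤
      2 * (ρ * P.RM * Rnat) := by
  have h1 := norm_conv_le (markovV S π₀) hρ hu k t
  have h2 := hnat t ht
  have h3 : 1 * Rnat ≤ ρ * P.RM * Rnat := mul_le_mul_of_nonneg_right (by nlinarith) hRnat
  refine (norm_add_le _ _).trans ?_
  linarith

lemma norm_gradient_le {ι : Type} [Fintype ι] {f : Vec ι → ℝ} (hf : LossRegular α L f)
    (hL : 0 ≤ L) {v : Vec ι} {r : ℝ} (hr : 1 ≤ r) (hv : ‖v‖ ≤ r) : ‖gradient f v‖ ≤ L * r :=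
  (hf.2.2 v).trans (mul_le_mul_of_nonneg_left (max_le hr hv) hL)

/-- The gradients of the losses at the memoryless iterates. -/
noncomputable def algGradient (S : LinSys dx dy du) (π₀ : NominalController ds dy du dω)
    (w : ℕ → Vec (Fin dx)) (e : ℕ → Vec (Fin dy)) (ℓ : ℕ → Vec (Fin dy ⊕ Fin du) → ℝ)
    (P : AlgInput dy du dω) (z₁ : Vec (PIdx P.m du dω)) (t : ℕ) : Vec (Fin dy ⊕ Fin du) :=
  if t = 0 then 0 else gradient (ℓ t) (vNat S π₀ w e t +
    act (algFeatures S π₀ w e P t) (algParam S π₀ w e ℓ P z₁ t))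

variable (hv : P.Gv = markovV S π₀) (hω : P.Gω = markovOmega S π₀)
  (hz₁ : z₁ ∈ paramSet P.m du dω P.RM) (hℓ : ∀ t, 1 ≤ t → LossRegular α L (ℓ t))
  (hL : 0 ≤ L) (hRM : 1 ≤ P.RM) (hρ1 : 1 ≤ ρ) (hRnat : 1 ≤ Rnat)
  (hnat : ∀ t, 1 ≤ t → ‖vNat S π₀ w e t‖ ≤ Rnat)
  (hnatω : ∀ t, 1 ≤ t → ‖omegaNat S π₀ w e t‖ ≤ Rnat)
  (hρ : ∀ n, ∑ i ∈ Finset.range n, ‖markovV S π₀ i‖ ≤ ρ)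

include hv hL hRM hρ1 hRnat hnat hnatω hρ in
lemma norm_gradient_features_le {f : Vec (Fin dy ⊕ Fin du) → ℝ} (hf : LossRegular α L f)
    {z : Vec (PIdx P.m du dω)} (hz : z ∈ paramSet P.m du dω P.RM) {t : ℕ} (ht : 1 ≤ t) :
    ‖gradient f (vNat S π₀ w e t + act (algFeatures S π₀ w e P t) z)‖ ≤
      L * (2 * (ρ * P.RM * Rnat)) := by
  have hE : 1 ≤ ρ * P.RM * Rnat :=
    one_le_mul_of_one_le_of_one_le (one_le_mul_of_one_le_of_one_le hρ1 hRM) hRnat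
  refine norm_gradient_le hf hL (by linarith) ?_
  rw [algFeatures, act_features, hv]
  exact norm_nat_add_conv_le (u := fun s => act (embed P.m (omegaNat S π₀ w e) s) z) hRM hρ1
    (by linarith) hnat hρ (fun s => norm_act_embed_le hnatω hz s) _ ht

include hv hω hz₁ hℓ hL hRM hρ1 hRnat hnat hnatω hρ in
lemma isNewtonRun (hlam : 0 < P.lam) :
    IsNewtonRun (paramSet P.m du dω P.RM) P.η P.lam (L * (2 * (ρ * P.RM * Rnat)))
      (algFeatures S π₀ w e P) (algGradient S π₀ w e ℓ P z₁) (algParam S π₀ w e ℓ P z₁) where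
  lam_pos := hlam
  mem := algParam_mem hv hω hz₁
  norm_le t := by
    rw [algGradient]
    split_ifs with ht
    · rw [norm_zero]; positivity
    · exact norm_gradient_features_le hv hL hRM hρ1 hRnat hnat hnatω hρ
        (hℓ t (Nat.one_le_iff_ne_zero.2 ht)) (algParam_mem hv hω hz₁ t)
        (Nat.one_le_iff_ne_zero.2 ht)
  step t x hx := by
    rcases t.eq_zero_or_pos with rfl | ht
    -- Round `0` is fictitious: its gradient vanishes by definition and the parameter does not
    -- change from `0` to `1`, so it is a trivial Newton step.
    · have h0 : algParam S π₀ w e ℓ P z₁ (0 + 1) = algParam S π₀ w e ℓ P z₁ 0 := rfl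
      simp only [algGradient, if_true, act_zero, smul_zero, sub_zero]
      rw [h0]
    · obtain ⟨h1, h2⟩ := (loopInvariant (w := w) (e := e) (ℓ := ℓ) (z₁ := z₁) hv hω
        ht).algUpdate_spec hv hω ht
      rw [h2, h1, algGradient, if_neg (by omega), gradient_comp_act (hℓ t ht).1]
      exact quad_projOn_sub_le isCompact_paramSet convex_paramSet
        (posDef_regSum hlam (fun _ => posSemidef_transpose_mul_self _) t).posSemidef _ hx

include hv hω hz₁ hRM hℓ hL hρ1 hRnat hnat hnatω hρ in
/-- Cost of the memory: the incurred losses against those of the memoryless iterates. -/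
lemma sum_loss_sub_memoryless_le (hα : 0 ≤ α)
    (hb : ∀ n, ∑ i ∈ Finset.range n, ‖markovV S π₀ (P.h + 1 + i)‖ ≤ b) (T : ℕ) :
    ∑ t ∈ Finset.Icc 1 T, (ℓ t (algIterate S π₀ w e ℓ P z₁ t) -
        ℓ t (vNat S π₀ w e t + act (algFeatures S π₀ w e P t) (algParam S π₀ w e ℓ P z₁ t))) ≤
      L * (2 * (ρ * P.RM * Rnat)) * (T * (b * (P.RM * Rnat)) +
        ∑ t ∈ Finset.range (T + 1), ∑ i ∈ Finset.range (P.h + 1),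
          ‖act (P.Gv i) (act (embed P.m (omegaNat S π₀ w e) (t - i))
            (algParam S π₀ w e ℓ P z₁ (t - i) - algParam S π₀ w e ℓ P z₁ t))‖) := by
  set z := algParam S π₀ w e ℓ P z₁ with hz
  set Y : ℕ → Matrix (Fin du) (PIdx P.m du dω) ℝ := embed P.m (omegaNat S π₀ w e) with hY
  set u : ℕ → Vec (Fin du) := fun s => act (Y s) (z s) with hu
  have hE : 1 ≤ ρ * P.RM * Rnat :=
    one_le_mul_of_one_le_of_one_le (one_le_mul_of_one_le_of_one_le hρ1 hRM) hRnat
  have hu0 : u 0 = 0 := by simp only [hu, hY, embed_zero, zero_act]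
  have hun : ∀ s, ‖u s‖ ≤ P.RM * Rnat := fun s =>
    norm_act_embed_le hnatω (algParam_mem hv hω hz₁ s) s
  have hround : ∀ t ∈ Finset.Icc 1 T, ℓ t (algIterate S π₀ w e ℓ P z₁ t) -
        ℓ t (vNat S π₀ w e t + act (algFeatures S π₀ w e P t) (z t)) ≤
      L * (2 * (ρ * P.RM * Rnat)) * (b * (P.RM * Rnat) +
        ∑ i ∈ Finset.range (P.h + 1), ‖act (P.Gv i) (act (Y (t - i)) (z (t - i) - z t))‖) := by
    intro t ht
    have ht1 := (Finset.mem_Icc.1 ht).1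
    have hiter : algIterate S π₀ w e ℓ P z₁ t = vNat S π₀ w e t +
        ∑ j ∈ Finset.range (t + 1), act (markovV S π₀ j) (u (t - j)) := by
      rw [(loopInvariant hv hω ht1).algIterate_eq hω ht1, ← sum_Icc_act_eq _ hu0]
      rfl
    have hgrad : ‖gradient (ℓ t) (algIterate S π₀ w e ℓ P z₁ t)‖ ≤
        L * (2 * (ρ * P.RM * Rnat)) := by
      refine norm_gradient_le (hℓ t ht1) hL (by linarith) ?_
      rw [hiter]
      exact norm_nat_add_conv_le hRM hρ1 (by linarith) hnat hρ hun _ ht1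
    refine ((hℓ t ht1).sub_le_norm hα hgrad).trans
      (mul_le_mul_of_nonneg_left ?_ (by positivity))
    -- The deviation is the tail of the convolution beyond lag `h` plus the effect of evaluating
    -- past features at past rather than current parameters.
    have hdec : algIterate S π₀ w e ℓ P z₁ t -
        (vNat S π₀ w e t + act (algFeatures S π₀ w e P t) (z t)) =
        (∑ j ∈ Finset.range (t + 1), act (markovV S π₀ j) (u (t - j)) -
          ∑ j ∈ Finset.range (P.h + 1), act (markovV S π₀ j) (u (t - j))) +
        ∑ i ∈ Finset.range (P.h + 1), act (P.Gv i) (act (Y (t - i)) (z (t - i) - z t)) := by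
      rw [hiter, algFeatures, act_features, hv]
      simp only [act_sub, Finset.sum_sub_distrib, hu, hY]
      abel
    rw [hdec]
    exact (norm_add_le _ _).trans (add_le_add
      (norm_conv_sub_truncated_le _ hu0 hb hun t) (norm_sum_le _ _))
  refine (Finset.sum_le_sum hround).trans ?_
  rw [← Finset.mul_sum, Finset.sum_add_distrib, Finset.sum_const, Nat.card_Icc, nsmul_eq_mul,
    Nat.add_sub_cancel]
  refine mul_le_mul_of_nonneg_left (add_le_add le_rfl ?_) (by positivity)
  refine Finset.sum_le_sum_of_subset_of_nonneg (fun t ht => ?_) fun t _ _ =>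
    Finset.sum_nonneg fun i _ => norm_nonneg _
  have := Finset.mem_Icc.1 ht
  rw [Finset.mem_range]; omega

include hv hω hz₁ hRM hℓ hL hρ1 hRnat hnat hnatω hρ in
/-- Regret of the memoryless iterates. -/
lemma sum_memoryless_sub_le (hα : 0 < α) (hη : P.η = 1 / α) (hlam : 0 < P.lam)
    {x : Vec (PIdx P.m du dω)} (hx : x ∈ paramSet P.m du dω P.RM) {D : ℝ} (T : ℕ)
    (hD : Real.log (regSum P.lam (fun s => (algFeatures S π₀ w e P s).transpose *
        algFeatures S π₀ w e P s) T).det -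
      Real.log (P.lam • (1 : Matrix (PIdx P.m du dω) (PIdx P.m du dω) ℝ)).det ≤ D) :
    ∑ t ∈ Finset.Icc 1 T,
        (ℓ t (vNat S π₀ w e t + act (algFeatures S π₀ w e P t) (algParam S π₀ w e ℓ P z₁ t)) -
        ℓ t (vNat S π₀ w e t + act (algFeatures S π₀ w e P t) x)) ≤
      α / 2 * (P.lam * (4 * (du * dω * P.RM ^ 2))) +
        (L * (2 * (ρ * P.RM * Rnat))) ^ 2 * D / (2 * α) := by
  set g := L * (2 * (ρ * P.RM * Rnat)) with hg
  have hrun := isNewtonRun hv hω hz₁ hℓ hL hRM hρ1 hRnat hnat hnatω hρ hlam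
  rw [← hg] at hrun
  have h1 := hrun.regret_le hx (T + 1)
  have hlev : ∑ t ∈ Finset.range (T + 1), leverage P.lam (algFeatures S π₀ w e P) t ≤ D :=
    (sum_trace_inv_mul_le hlam (fun _ => posSemidef_transpose_mul_self _) T).trans hD
  have hx0 : ‖algParam S π₀ w e ℓ P z₁ 0 - x‖ ^ 2 ≤ 4 * (du * dω * P.RM ^ 2) := by
    have h2 := norm_sq_le_of_mem_paramSet (hrun.mem 0)
    have h3 := norm_sq_le_of_mem_paramSet hx
    have h4 := norm_sub_le (algParam S π₀ w e ℓ P z₁ 0) x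
    have h5 := pow_le_pow_left₀ (norm_nonneg _) h4 2
    nlinarith [sq_nonneg (‖algParam S π₀ w e ℓ P z₁ 0‖ - ‖x‖)]
  -- With `η = 1/α`, scaling by `α/2` turns the Newton regret terms into exactly the strong
  -- convexity bound at `H_t z_t`.
  have hterm : ∀ t ∈ Finset.Icc 1 T,
      ℓ t (vNat S π₀ w e t + act (algFeatures S π₀ w e P t) (algParam S π₀ w e ℓ P z₁ t)) -
        ℓ t (vNat S π₀ w e t + act (algFeatures S π₀ w e P t) x) ≤
      α / 2 * (2 * P.η * inner ℝ (algGradient S π₀ w e ℓ P z₁ t)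
          (act (algFeatures S π₀ w e P t) (algParam S π₀ w e ℓ P z₁ t - x)) -
        ‖act (algFeatures S π₀ w e P t) (algParam S π₀ w e ℓ P z₁ t - x)‖ ^ 2) := by
    intro t ht
    have ht1 := (Finset.mem_Icc.1 ht).1
    have h2 := (hℓ t ht1).sub_le
      (vNat S π₀ w e t + act (algFeatures S π₀ w e P t) (algParam S π₀ w e ℓ P z₁ t))
      (vNat S π₀ w e t + act (algFeatures S π₀ w e P t) x)
    rw [add_sub_add_left_eq_sub, ← act_sub] at h2
    refine h2.trans (le_of_eq ?_)
    rw [algGradient, if_neg (by omega), hη]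
    field_simp
  have hsplit : ∑ t ∈ Finset.range (T + 1),
      (2 * P.η * inner ℝ (algGradient S π₀ w e ℓ P z₁ t)
          (act (algFeatures S π₀ w e P t) (algParam S π₀ w e ℓ P z₁ t - x)) -
        ‖act (algFeatures S π₀ w e P t) (algParam S π₀ w e ℓ P z₁ t - x)‖ ^ 2) =
      ∑ t ∈ Finset.Icc 1 T, (2 * P.η * inner ℝ (algGradient S π₀ w e ℓ P z₁ t)
          (act (algFeatures S π₀ w e P t) (algParam S π₀ w e ℓ P z₁ t - x)) -
        ‖act (algFeatures S π₀ w e P t) (algParam S π₀ w e ℓ P z₁ t - x)‖ ^ 2) := by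
    rw [Finset.range_eq_Ico, Finset.sum_eq_sum_Ico_succ_bot (Nat.succ_pos T), algFeatures_zero]
    simp only [zero_act, inner_zero_right, mul_zero, norm_zero, ne_eq, OfNat.ofNat_ne_zero,
      not_false_eq_true, zero_pow, sub_zero, zero_add]
    rfl
  rw [hsplit] at h1
  calc _ ≤ α / 2 * ∑ t ∈ Finset.Icc 1 T, (2 * P.η * inner ℝ (algGradient S π₀ w e ℓ P z₁ t)
          (act (algFeatures S π₀ w e P t) (algParam S π₀ w e ℓ P z₁ t - x)) -
        ‖act (algFeatures S π₀ w e P t) (algParam S π₀ w e ℓ P z₁ t - x)‖ ^ 2) := by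
        rw [Finset.mul_sum]; exact Finset.sum_le_sum hterm
    _ ≤ α / 2 * (P.lam * ‖algParam S π₀ w e ℓ P z₁ 0 - x‖ ^ 2 + P.η ^ 2 * g ^ 2 *
          ∑ t ∈ Finset.range (T + 1), leverage P.lam (algFeatures S π₀ w e P) t) := by gcongr
    _ ≤ α / 2 * (P.lam * (4 * (du * dω * P.RM ^ 2)) + P.η ^ 2 * g ^ 2 * D) := by gcongr
    _ = _ := by rw [hη]; field_simp

include hv hRnat hnatω hρ in
/-- Comparators are approximated by static parameters. -/
lemma exists_param_approx {Rstar : ℝ} {ψ : ℕ → ℝ} (hψ : ∀ n, 0 ≤ ψ n) (hR0 : 0 ≤ Rstar)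
    (hR : Rstar ≤ P.RM) (hb : ∀ n, ∑ i ∈ Finset.range n, ‖markovV S π₀ (P.h + 1 + i)‖ ≤ b)
    {π : LDC dy du} (hπ : π ∈ comparators S π₀ w e Rstar ψ) :
    ∃ x ∈ paramSet P.m du dω P.RM, ∀ t, 1 ≤ t →
      ‖vNat S π₀ w e t + act (algFeatures S π₀ w e P t) x - policyIterate S π w e t‖ ≤
        ρ * (ψ P.m * Rnat) + b * (P.RM * Rnat) := by
  obtain ⟨G, hconv, hl1, hdec⟩ := hπ
  -- The comparator's parameter is its conversion operator truncated to the first `m` lags.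
  set x : Vec (PIdx P.m du dω) := WithLp.toLp 2 fun p => G p.1 p.2.1 p.2.2 with hx
  have hblock : ∀ i : Fin P.m, block x i = G i := fun i => by ext a c; simp [block, hx]
  have hxmem : x ∈ paramSet P.m du dω P.RM := by
    change ∑ i, ‖block x i‖ ≤ P.RM
    simp only [hblock]
    rw [Fin.sum_univ_eq_sum_range fun i => ‖G i‖]
    exact (sum_norm_le_of_l1op hR0 hl1 _).trans hR
  have hRnat0 : 0 ≤ Rnat := by linarith
  refine ⟨x, hxmem, fun t ht => ?_⟩
  set uπ : ℕ → Vec (Fin du) := fun t =>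
    ∑ i ∈ Finset.Icc 1 t, act (G (t - i)) (omegaNat S π₀ w e i) with huπ
  set q : ℕ → Vec (Fin du) := fun s => act (embed P.m (omegaNat S π₀ w e) s) x with hq
  have hq0 : q 0 = 0 := by simp only [hq, embed_zero, zero_act]
  have hπ0 : uπ 0 = 0 := by simp [huπ]
  have hqn : ∀ s, ‖q s‖ ≤ P.RM * Rnat := fun s => norm_act_embed_le hnatω hxmem s
  have hdiff : ∀ s, ‖q s - uπ s‖ ≤ ψ P.m * Rnat := by
    intro s
    -- `omegaNat` at `0` need not vanish; it is replaced by `0` so that lags beyond the start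
    -- contribute nothing.
    set ω' : ℕ → Vec (Fin dω) := fun i => if i = 0 then 0 else omegaNat S π₀ w e i with hω'
    have hω'n : ∀ i, ‖ω' i‖ ≤ Rnat := fun i => by
      simp only [hω']
      split_ifs with hi
      · simpa using hRnat0
      · exact hnatω i (Nat.one_le_iff_ne_zero.2 hi)
    have h1 : uπ s = ∑ j ∈ Finset.range (s + 1), act (G j) (ω' (s - j)) := by
      rw [← sum_Icc_act_eq G (by simp [hω'])]
      refine Finset.sum_congr rfl fun i hi => ?_
      have : i ≠ 0 := by have := (Finset.mem_Icc.1 hi).1; omega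
      simp only [hω', if_neg this]
    have h2 : q s = ∑ j ∈ Finset.range P.m, act (G j) (ω' (s - j)) := by
      simp only [hq, act_embed, hblock]
      rw [← Fin.sum_univ_eq_sum_range fun j => act (G j) (ω' (s - j))]
      refine Finset.sum_congr rfl fun i _ => ?_
      split_ifs with hi
      · simp only [hω', if_neg (show s - (i : ℕ) ≠ 0 by omega)]
      · simp [hω', show s - (i : ℕ) = 0 by omega]
    have h3 : uπ s = ∑ j ∈ Finset.range (P.m + (s + 1)), act (G j) (ω' (s - j)) := by
      rw [h1]
      refine Finset.sum_subset (Finset.range_subset_range.2 (by omega)) fun i _ hi => ?_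
      rw [Finset.mem_range] at hi
      simp [hω', show s - i = 0 by omega]
    rw [norm_sub_rev, h2, h3, Finset.sum_range_add, add_sub_cancel_left]
    calc _ ≤ ∑ j ∈ Finset.range (s + 1), ‖G (P.m + j)‖ * Rnat :=
          (norm_sum_le _ _).trans (Finset.sum_le_sum fun j _ => (norm_act_le _ _).trans
            (mul_le_mul_of_nonneg_left (hω'n _) (norm_nonneg _)))
      _ ≤ _ := by
          rw [← Finset.sum_mul]
          exact mul_le_mul_of_nonneg_right (sum_norm_le_of_decay (hψ _) (hdec _) _) hRnat0
  have hpol : policyIterate S π w e t = vNat S π₀ w e t +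
      ∑ j ∈ Finset.range (t + 1), act (markovV S π₀ j) (uπ (t - j)) := by
    rw [hconv t ht, ← sum_Icc_act_eq _ hπ0]
  have hdec' : vNat S π₀ w e t + act (algFeatures S π₀ w e P t) x - policyIterate S π w e t =
      ∑ j ∈ Finset.range (t + 1), act (markovV S π₀ j) ((fun s => q s - uπ s) (t - j)) -
      (∑ j ∈ Finset.range (t + 1), act (markovV S π₀ j) (q (t - j)) -
        ∑ j ∈ Finset.range (P.h + 1), act (markovV S π₀ j) (q (t - j))) := by
    rw [hpol, algFeatures, act_features, hv]
    simp only [act_sub, Finset.sum_sub_distrib, hq]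
    abel
  rw [hdec']
  exact (norm_sub_le _ _).trans (add_le_add (norm_conv_le _ hρ hdiff _ t)
    (norm_conv_sub_truncated_le _ hq0 hb hqn t))

end Assembly

/-! ### Constants and the final estimate -/

section Bound

variable {dx ds dy du dω : ℕ} {S : LinSys dx dy du} {π₀ : NominalController ds dy du dω}
  {w : ℕ → Vec (Fin dx)} {e : ℕ → Vec (Fin dy)} {ℓ : ℕ → Vec (Fin dy ⊕ Fin du) → ℝ}
  {P : AlgInput dy du dω} {z₁ : Vec (PIdx P.m du dω)} {α L Rnat ρ : ℝ}

lemma trace_features_le (hv : P.Gv = markovV S π₀)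
    (hnatω : ∀ t, 1 ≤ t → ‖omegaNat S π₀ w e t‖ ≤ Rnat)
    (hρ : ∀ n, ∑ i ∈ Finset.range n, ‖markovV S π₀ i‖ ≤ ρ) (t : ℕ) :
    ((algFeatures S π₀ w e P t).transpose * algFeatures S π₀ w e P t).trace ≤
      Fintype.card (PIdx P.m du dω) * (ρ * Rnat) ^ 2 := by
  refine trace_transpose_mul_self_le _ fun p => ?_
  rw [algFeatures, act_features, hv]
  exact norm_conv_le (u := fun s => act (embed P.m (omegaNat S π₀ w e) s)
    (EuclideanSpace.single p 1)) _ hρ (fun s => norm_act_embed_single_le hnatω s p) _ t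

/-- Both potentials grow logarithmically. -/
lemma log_det_potentials_le (hv : P.Gv = markovV S π₀)
    (hnatω : ∀ t, 1 ≤ t → ‖omegaNat S π₀ w e t‖ ≤ Rnat)
    (hρ : ∀ n, ∑ i ∈ Finset.range n, ‖markovV S π₀ i‖ ≤ ρ) (hρ1 : 1 ≤ ρ) (hRnat : 1 ≤ Rnat)
    (hh : 0 < P.h) (hlam : P.lam = 6 * P.h * Rnat ^ 2 * ρ ^ 2) {θ : ℝ} (hθ : 0 ≤ θ) (hθ1 : θ ≤ 1)
    (T : ℕ) :
    Real.log (regSum P.lam (fun s => (algFeatures S π₀ w e P s).transpose *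
        algFeatures S π₀ w e P s) T).det -
      Real.log (P.lam • (1 : Matrix (PIdx P.m du dω) (PIdx P.m du dω) ℝ)).det ≤
        Fintype.card (PIdx P.m du dω) * Real.log (1 + T) ∧
    Real.log (jointSum P.lam θ (algFeatures S π₀ w e P)
        (embed P.m (omegaNat S π₀ w e) : ℕ → Matrix (Fin du) (PIdx P.m du dω) ℝ) T).det -
      Real.log (P.lam • (1 : Matrix (PIdx P.m du dω) (PIdx P.m du dω) ℝ)).det ≤
        Fintype.card (PIdx P.m du dω) * Real.log (1 + T) := by
  have hh1 : (1 : ℝ) ≤ P.h := by exact_mod_cast hh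
  have hlam0 : 0 < P.lam := by rw [hlam]; positivity
  -- One copy of `(ρ Rnat)²` covers `HᵀH` and one covers `θ YᵀY`; the prescribed `λ` exceeds what
  -- the potentials require.
  have h2 : 2 * (ρ * Rnat) ^ 2 ≤ P.lam := by
    have : 0 ≤ (ρ * Rnat) ^ 2 := sq_nonneg _
    rw [hlam]
    nlinarith
  set Y : ℕ → Matrix (Fin du) (PIdx P.m du dω) ℝ := embed P.m (omegaNat S π₀ w e) with hY
  have hYtr : ∀ t, ((Y t).transpose * Y t).trace ≤
      Fintype.card (PIdx P.m du dω) * (ρ * Rnat) ^ 2 := fun t =>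
    trace_transpose_mul_self_le _ fun p => (norm_act_embed_single_le hnatω t p).trans
      (le_mul_of_one_le_left (by linarith) hρ1)
  have hHtr := trace_features_le (w := w) (e := e) hv hnatω hρ
  have hcard : (0 : ℝ) ≤ Fintype.card (PIdx P.m du dω) := Nat.cast_nonneg _
  have hsq : 0 ≤ (ρ * Rnat) ^ 2 := sq_nonneg _
  constructor
  · refine log_det_regSum_sub_le hlam0 (fun _ => posSemidef_transpose_mul_self _) ?_
      (fun t => ?_) T
    · simp only [algFeatures_zero, Matrix.mul_zero]
    · exact (hHtr t).trans (mul_le_mul_of_nonneg_left (by linarith) hcard)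
  · refine log_det_regSum_sub_le hlam0 (posSemidef_jointIncrement hθ) ?_ (fun t => ?_) T
    · simp only [algFeatures_zero, hY, embed_zero, Matrix.mul_zero, smul_zero, add_zero]
    · rw [Matrix.trace_add, Matrix.trace_smul, smul_eq_mul]
      have h3 : θ * ((Y t).transpose * Y t).trace ≤
          1 * (Fintype.card (PIdx P.m du dω) * (ρ * Rnat) ^ 2) :=
        mul_le_mul hθ1 (hYtr t) (posSemidef_transpose_mul_self (Y t)).trace_nonneg zero_le_one
      have h4 := hHtr t
      have h5 := mul_le_mul_of_nonneg_left h2 hcard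
      linarith

/-- The window over which rounds have to settle. -/
lemma window_sum_le {κ : ℝ} (hκ : 0 < κ) (hρ1 : 1 ≤ ρ) {G : ℕ → ℝ} (hG : ∀ i, 0 ≤ G i)
    (hρ : ∀ n, ∑ i ∈ Finset.range n, G i ≤ ρ) {h K T : ℕ} (hh : 0 < h)
    (hK : 6 * h * ρ * (√κ)⁻¹ ≤ K)
    (hb : ∀ n, ∑ i ∈ Finset.range n, G (h + 1 + i) ≤ ρ / T) (hKT : K ≤ T) (n : ℕ) :
    ∑ i ∈ Finset.range n, G i * (if i ≤ h then (h : ℝ) / K else 1) ≤ √κ / 3 := by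
  have hsq : 0 < √κ := Real.sqrt_pos.2 hκ
  have hh1 : (1 : ℝ) ≤ h := by exact_mod_cast hh
  have hK0 : (0 : ℝ) < K := lt_of_lt_of_le (by positivity) hK
  have hK' : 6 * h * ρ ≤ K * √κ := by
    rw [← div_eq_mul_inv, div_le_iff₀ hsq] at hK; exact hK
  -- The budget `√κ/3` is split equally between the slope of the ramp at lags up to `h` and the tail
  -- of `G`; the tail is at most `ρ/T`, hence at most `ρ/K` because `K ≤ T`.
  have h1 : ρ * (h / K) ≤ √κ / 6 := by
    rw [← mul_div_assoc, div_le_iff₀ hK0]; linarith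
  have h2 : ρ / T ≤ √κ / 6 := by
    calc ρ / T ≤ ρ / K := by
          have : (K : ℝ) ≤ T := by exact_mod_cast hKT
          gcongr
      _ ≤ √κ / 6 := by
          rw [div_le_iff₀ hK0]
          nlinarith
  have h3 := sum_range_mul_ite_le hG (c := (h : ℝ) / K) (by positivity) hρ hb n
  linarith

/-- Every term is compared with `XW`, where `X = L²E²/α` and `W = ρhD/√κ`, using `α ≤ L`, `κ ≤ 1`
and `D ≥ 1/2`. The coefficients add up to less than `200(1 + c)`. A single power of `h` already
suffices; the second is slack spent in `hfin`. -/
lemma numeric_bound {α L κ E ρ h D d c : ℝ} {K : ℕ} (hα : 0 < α) (hαL : α ≤ L) (hκ : 0 < κ)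
    (hκ1 : κ ≤ 1) (hE : 1 ≤ E) (hρ : 1 ≤ ρ) (hh : 1 ≤ h) (hD : 1 / 2 ≤ D) (hd : d ≤ 2 * D)
    (hc : 0 < c) (hK : (K : ℝ) ≤ 6 * h * ρ * (√κ)⁻¹ + 1) :
    L * (2 * E) * (E + ρ * (10 * (1 / α) * (L * (2 * E)) * h * (√κ)⁻¹ * D +
        2 * (E / ρ) * (K + 2 * K * D))) +
      (12 * α * h * E ^ 2 * d + (L * (2 * E)) ^ 2 * D / (2 * α)) +
      L * (2 * E) * ((1 + c) * E) ≤
    200 * (1 + c) * ((α * √κ)⁻¹ * L ^ 2 * E ^ 2 * ρ * h ^ 2 * D) := by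
  have hL : 0 < L := hα.trans_le hαL
  have hsq : 0 < √κ := Real.sqrt_pos.2 hκ
  set q := (√κ)⁻¹ with hq
  have hq1 : 1 ≤ q := (one_le_inv₀ hsq).2 (Real.sqrt_le_one.2 hκ1)
  set X := α⁻¹ * L ^ 2 * E ^ 2 with hX
  set W := ρ * h * q * D with hW
  have hρhq : 1 ≤ ρ * h * q :=
    one_le_mul_of_one_le_of_one_le (one_le_mul_of_one_le_of_one_le hρ hh) hq1
  have hE2 : 0 ≤ E ^ 2 := sq_nonneg E
  have hαL2 : α ≤ α⁻¹ * L ^ 2 := by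
    rw [le_inv_mul_iff₀ hα]; nlinarith
  have hLL : L ≤ α⁻¹ * L ^ 2 := by
    rw [le_inv_mul_iff₀ hα]; nlinarith
  have hLE : L * E ^ 2 ≤ X := mul_le_mul_of_nonneg_right hLL hE2
  have hαE : α * E ^ 2 ≤ X := mul_le_mul_of_nonneg_right hαL2 hE2
  have hX0 : 0 ≤ X := by positivity
  have hDW : D ≤ W := le_mul_of_one_le_left (by linarith) hρhq
  have hhW : h * D ≤ W := by
    have h1 : h * 1 ≤ h * (ρ * q) :=
      mul_le_mul_of_nonneg_left (one_le_mul_of_one_le_of_one_le hρ hq1) (by linarith)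
    calc h * D ≤ h * (ρ * q) * D := mul_le_mul_of_nonneg_right (by linarith) (by linarith)
      _ = W := by rw [hW]; ring
  have hXW : X ≤ 2 * (X * W) := by nlinarith
  have hKW : K + 2 * K * D ≤ 28 * W := by
    have h1 : (K : ℝ) ≤ 7 * (ρ * h * q) := by linarith
    have h2 : (K : ℝ) * D ≤ 7 * (ρ * h * q) * D := mul_le_mul_of_nonneg_right h1 (by linarith)
    have h3 : (K : ℝ) * (1 / 2) ≤ K * D := mul_le_mul_of_nonneg_left hD (Nat.cast_nonneg K)
    have h4 : 7 * (ρ * h * q) * D = 7 * W := by rw [hW]; ring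
    linarith
  have t3 : 4 * (L * E ^ 2) * (K + 2 * K * D) ≤ 112 * (X * W) := by
    calc _ ≤ 4 * X * (28 * W) := by gcongr
      _ = _ := by ring
  have t4 : 12 * α * h * E ^ 2 * d ≤ 24 * (X * W) := by
    calc 12 * α * h * E ^ 2 * d ≤ 12 * α * h * E ^ 2 * (2 * D) := by gcongr
      _ = 24 * ((α * E ^ 2) * (h * D)) := by ring
      _ ≤ 24 * (X * W) := by gcongr
  have t5 : (L * (2 * E)) ^ 2 * D / (2 * α) ≤ 2 * (X * W) := by
    calc (L * (2 * E)) ^ 2 * D / (2 * α) = 2 * (X * D) := by rw [hX]; field_simp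
      _ ≤ _ := by gcongr
  have t6 : (1 + c) * (L * E ^ 2) ≤ (1 + c) * (2 * (X * W)) := by
    have := hLE.trans hXW
    gcongr
  have hfin : (1 + c) * (X * W) ≤ (1 + c) * (h * (X * W)) := by
    have : 1 * (X * W) ≤ h * (X * W) := mul_le_mul_of_nonneg_right hh (by positivity)
    have h0 : 0 ≤ 1 + c := by linarith
    nlinarith
  have hXWc : X * W ≤ (1 + c) * (X * W) := le_mul_of_one_le_left (by positivity) (by linarith)
  have hlhs : L * (2 * E) * (E + ρ * (10 * (1 / α) * (L * (2 * E)) * h * q * D +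
        2 * (E / ρ) * (K + 2 * K * D))) =
      2 * (L * E ^ 2) + 40 * (X * W) + 4 * (L * E ^ 2) * (K + 2 * K * D) := by
    rw [hX, hW]; field_simp; ring
  have hlhs' : L * (2 * E) * ((1 + c) * E) = 2 * ((1 + c) * (L * E ^ 2)) := by ring
  have hrhs : 200 * (1 + c) * ((α * √κ)⁻¹ * L ^ 2 * E ^ 2 * ρ * h ^ 2 * D) =
      200 * ((1 + c) * (h * (X * W))) := by
    rw [hX, hW, hq, mul_inv]; ring
  rw [hlhs, hlhs', hrhs]
  linarith

/-- Regret against a comparator. -/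
theorem sum_loss_le (hv : P.Gv = markovV S π₀) (hω : P.Gω = markovOmega S π₀)
    (hz₁ : z₁ ∈ paramSet P.m du dω P.RM) (hα : 0 < α) (hη : P.η = 1 / α)
    (hlam : P.lam = 6 * P.h * Rnat ^ 2 * ρ ^ 2) (hℓ : ∀ t, 1 ≤ t → LossRegular α L (ℓ t))
    (hdu : 0 < du) (hdω : 0 < dω) (hm : 0 < P.m) (hh : 0 < P.h) {T : ℕ} (hT : 0 < T)
    (hRM : 1 ≤ P.RM) (hRnat : 1 ≤ Rnat) (hnat : ∀ t, 1 ≤ t → ‖vNat S π₀ w e t‖ ≤ Rnat)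
    (hnatω : ∀ t, 1 ≤ t → ‖omegaNat S π₀ w e t‖ ≤ Rnat)
    (hρ : ∀ n, ∑ i ∈ Finset.range n, ‖markovV S π₀ i‖ ≤ ρ)
    (hb : ∀ n, ∑ i ∈ Finset.range n, ‖markovV S π₀ (P.h + 1 + i)‖ ≤ ρ / T)
    (hκ : 0 < invModulus (markovV S π₀)) {Rstar c : ℝ} {ψ : ℕ → ℝ} (hψ : ∀ n, 0 ≤ ψ n)
    (hc : 0 < c) (hψm : ψ P.m ≤ c * Rstar / T) (hR : Rstar ≤ P.RM) {π : LDC dy du}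
    (hπ : π ∈ comparators S π₀ w e Rstar ψ) :
    ∑ t ∈ Finset.Icc 1 T, ℓ t (algIterate S π₀ w e ℓ P z₁ t) ≤
      ∑ t ∈ Finset.Icc 1 T, ℓ t (policyIterate S π w e t) +
      200 * (1 + c) * ((α * √(invModulus (markovV S π₀)))⁻¹ * P.m * P.h ^ 2 * du * dω * ρ ^ 3 *
        Rnat ^ 2 * P.RM ^ 2 * L ^ 2 * Real.log (1 + T)) := by
  have hT0 : (0 : ℝ) < T := by exact_mod_cast hT
  have hh1 : (1 : ℝ) ≤ P.h := by exact_mod_cast hh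
  have hρ1 : 1 ≤ ρ := (one_le_norm_markovV_zero hdu).trans (by simpa using hρ 1)
  have : Nonempty (Fin dy ⊕ Fin du) := ⟨Sum.inr ⟨0, hdu⟩⟩
  have hαL : α ≤ L := (hℓ 1 le_rfl).le
  have hL : 0 ≤ L := hα.le.trans hαL
  have hlam0 : 0 < P.lam := by rw [hlam]; positivity
  -- Nonnegativity of `Rstar` follows from `0 ≤ ψ m ≤ c·Rstar/T` and `c > 0`.
  have hR0 : 0 ≤ Rstar := by
    have h1 := (hψ P.m).trans hψm
    rw [le_div_iff₀ hT0, zero_mul] at h1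
    exact nonneg_of_mul_nonneg_right h1 hc
  have hκ1 := invModulus_le_one (markovV S π₀)
  set κ := invModulus (markovV S π₀) with hκdef
  set E := ρ * P.RM * Rnat with hE
  have hE1 : 1 ≤ E :=
    one_le_mul_of_one_le_of_one_le (one_le_mul_of_one_le_of_one_le hρ1 hRM) hRnat
  have hEρ : P.RM * Rnat = E / ρ := by rw [hE]; field_simp
  set D := Fintype.card (PIdx P.m du dω) * Real.log (1 + T) with hD
  set K := ⌈6 * P.h * ρ * (√κ)⁻¹⌉₊ with hK
  have hsq : 0 < √κ := Real.sqrt_pos.2 hκ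
  have hKpos : 0 < K := Nat.ceil_pos.2 (by positivity)
  have hlog := log_det_potentials_le (w := w) (e := e) hv hnatω hρ hρ1 hRnat hh hlam
    (θ := κ / 9) (by positivity) (by linarith) T
  have hgrad := isNewtonRun hv hω hz₁ hℓ hL hRM hρ1 hRnat hnat hnatω hρ hlam0
  have hmem := sum_loss_sub_memoryless_le hv hω hz₁ hℓ hL hRM hρ1 hRnat hnat hnatω hρ hα.le hb T
  have hmove := sum_norm_memory_le (G := P.Gv) (Y := embed P.m (omegaNat S π₀ w e)) (K := K)
    (T := T) (ρ := ρ) (D := D) (R := P.RM * Rnat) hgrad (by rw [hη]; positivity)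
    (by rw [hv]; exact hκ) (embed_zero _) hKpos
    (by
      rw [hv]
      exact fun hKT n => window_sum_le hκ hρ1 (fun _ => norm_nonneg _) hρ hh (Nat.le_ceil _) hb
        hKT n)
    (fun t x hx => norm_act_embed_le hnatω hx t) (by rw [hv]; exact hρ) hlog.1
    (by
      have h := hlog.2
      rw [hκdef, ← hv] at h
      exact h)
  obtain ⟨x, hx, happrox⟩ := exists_param_approx hv hRnat hnatω hρ hψ hR0 hR hb hπ
  have hreg := sum_memoryless_sub_le hv hω hz₁ hℓ hL hRM hρ1 hRnat hnat hnatω hρ hα hη hlam0 hx T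
    hlog.1
  rw [hv, ← hκdef, hη, ← hE] at hmove
  rw [hv, ← hE, hEρ] at hmem
  rw [← hE, hlam] at hreg
  have hcomp : ∑ t ∈ Finset.Icc 1 T,
      (ℓ t (vNat S π₀ w e t + act (algFeatures S π₀ w e P t) x) - ℓ t (policyIterate S π w e t)) ≤
      L * (2 * E) * ((1 + c) * E) := by
    have hround : ∀ t ∈ Finset.Icc 1 T,
        ℓ t (vNat S π₀ w e t + act (algFeatures S π₀ w e P t) x) -
          ℓ t (policyIterate S π w e t) ≤ L * (2 * E) * ((1 + c) * E / T) := by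
      intro t ht
      have ht1 := (Finset.mem_Icc.1 ht).1
      refine ((hℓ t ht1).sub_le_norm hα.le (norm_gradient_features_le hv hL hRM hρ1 hRnat hnat
        hnatω hρ (hℓ t ht1) hx ht1)).trans (mul_le_mul_of_nonneg_left ?_ (by positivity))
      refine (happrox t ht1).trans ?_
      have h1 : ρ * (ψ P.m * Rnat) ≤ c * E / T := by
        calc ρ * (ψ P.m * Rnat) ≤ ρ * (c * P.RM / T * Rnat) := by
              have : c * Rstar / T ≤ c * P.RM / T := by gcongr
              gcongr
              exact hψm.trans this
          _ = c * E / T := by rw [hE]; ring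
      have h2 : ρ / T * (P.RM * Rnat) = E / T := by rw [hE]; ring
      rw [h2]
      calc _ ≤ c * E / T + E / T := by linarith
        _ = _ := by ring
    refine (Finset.sum_le_sum hround).trans (le_of_eq ?_)
    rw [Finset.sum_const, Nat.card_Icc, Nat.add_sub_cancel, nsmul_eq_mul]
    field_simp
  have hcard : (Fintype.card (PIdx P.m du dω) : ℝ) = P.m * (du * dω) := by
    simp [Fintype.card_prod]
  have hlog2 : 1 / 2 ≤ Real.log (1 + T) := by
    have h1 : Real.log 2 ≤ Real.log (1 + T) := by
      have : (1 : ℝ) ≤ T := by exact_mod_cast hT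
      exact Real.log_le_log two_pos (by linarith)
    linarith [Real.log_two_gt_d9]
  have hm1 : (1 : ℝ) ≤ P.m := by exact_mod_cast hm
  have hdu1 : (1 : ℝ) ≤ du := by exact_mod_cast hdu
  have hdω1 : (1 : ℝ) ≤ dω := by exact_mod_cast hdω
  have hdd : (1 : ℝ) ≤ du * dω := one_le_mul_of_one_le_of_one_le hdu1 hdω1
  have hdD : (du * dω : ℝ) ≤ 2 * D := by
    have h1 : (du * dω : ℝ) * 1 ≤ P.m * (du * dω) * (2 * Real.log (1 + T)) :=
      mul_le_mul (le_mul_of_one_le_left (by linarith) hm1) (by linarith) zero_le_one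
        (by positivity)
    rw [hD, hcard]
    linarith
  have hD1 : 1 / 2 ≤ D := by linarith
  have hnum := numeric_bound (K := K) hα hαL hκ hκ1 hE1 hρ1 hh1 hD1 hdD hc
    (Nat.ceil_lt_add_one (by positivity)).le
  have hmem' : L * (2 * E) * (T * (ρ / T * (E / ρ)) +
      ∑ t ∈ Finset.range (T + 1), ∑ i ∈ Finset.range (P.h + 1),
          ‖act (markovV S π₀ i) (act (embed P.m (omegaNat S π₀ w e) (t - i))
            (algParam S π₀ w e ℓ P z₁ (t - i) - algParam S π₀ w e ℓ P z₁ t))‖) ≤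
      L * (2 * E) * (E + ρ * (10 * (1 / α) * (L * (2 * E)) * P.h * (√κ)⁻¹ * D +
        2 * (E / ρ) * (K + 2 * K * D))) := by
    refine mul_le_mul_of_nonneg_left (add_le_add (le_of_eq (by field_simp)) ?_) (by positivity)
    rw [← hEρ]
    exact hmove
  have hreg' : α / 2 * (6 * P.h * Rnat ^ 2 * ρ ^ 2 * (4 * (du * dω * P.RM ^ 2))) =
      12 * α * P.h * E ^ 2 * (du * dω) := by rw [hE]; ring
  have hrhs : (α * √κ)⁻¹ * P.m * P.h ^ 2 * du * dω * ρ ^ 3 * Rnat ^ 2 * P.RM ^ 2 * L ^ 2 *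
      Real.log (1 + T) = (α * √κ)⁻¹ * L ^ 2 * E ^ 2 * ρ * P.h ^ 2 * D := by
    rw [hD, hcard, hE]; ring
  rw [hreg'] at hreg
  rw [hrhs]
  simp only [Finset.sum_sub_distrib] at hmem hreg hcomp
  linarith

end Bound

end Drc

/-! ### The regret bound -/

theorem mainTheorem1 :
    ∃ Cst : ℝ, 0 < Cst ∧
      ∀ (dx ds dy du dω m h T : ℕ), 0 < du → 0 < dω → 0 < m → 0 < h → 0 < T →
      ∀ (S : Drc.LinSys dx dy du) (π₀ : Drc.NominalController ds dy du dω)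
        (w : ℕ → Drc.Vec (Fin dx)) (e : ℕ → Drc.Vec (Fin dy))
        (ℓ : ℕ → Drc.Vec (Fin dy ⊕ Fin du) → ℝ)
        (α L Rnat Rπ₀ Rstar RM c : ℝ) (ψ₀ ψstar : ℕ → ℝ)
        (z₁ : Drc.Vec (Drc.PIdx m du dω)),
        -- cost regularity
        0 < α → (∀ t, 1 ≤ t → Drc.LossRegular α L (ℓ t)) →
        -- stability under the nominal controller
        Drc.nominalRadius S π₀ ≠ ⊤ → Rπ₀ = (Drc.nominalRadius S π₀).toReal →
        Drc.IsDecayFunction ψ₀ →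
        (∀ n, Drc.decay (Drc.markovV S π₀) n ≤ ENNReal.ofReal (ψ₀ n)) →
        (∀ n, Drc.decay (Drc.markovOmega S π₀) n ≤ ENNReal.ofReal (ψ₀ n)) →
        -- bounded nature's iterates
        1 ≤ Rnat →
        (∀ t, 1 ≤ t → ‖Drc.vNat S π₀ w e t‖ ≤ Rnat ∧ ‖Drc.omegaNat S π₀ w e t‖ ≤ Rnat) →
        -- invertibility modulus
        0 < Drc.invModulus (Drc.markovV S π₀) →
        -- choice of the parameters
        Drc.IsDecayFunction ψstar → 0 < c →
        ψ₀ (h + 1) ≤ Rπ₀ / T → ψstar m ≤ c * Rstar / T → Rstar ≤ RM → 1 ≤ RM →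
        z₁ ∈ Drc.paramSet m du dω RM →
        Drc.controlReg S w e ℓ T
            (Drc.algIterate S π₀ w e ℓ
              { m := m, h := h, η := 1 / α, lam := 6 * h * Rnat ^ 2 * Rπ₀ ^ 2, RM := RM,
                Gv := Drc.markovV S π₀, Gω := Drc.markovOmega S π₀ } z₁)
            (Drc.comparators S π₀ w e Rstar ψstar)
          ≤ ((Cst * (1 + c) *
              ((α * √(Drc.invModulus (Drc.markovV S π₀)))⁻¹ * m * h ^ 2 * du * dω * Rπ₀ ^ 3 *
                Rnat ^ 2 * RM ^ 2 * L ^ 2 * Real.log (1 + T)) : ℝ) : EReal) := by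
  refine ⟨200, by norm_num, ?_⟩
  intro dx ds dy du dω m h T hdu hdω hm hh hT S π₀ w e ℓ α L Rnat Rπ₀ Rstar RM c ψ₀ ψstar z₁ hα hℓ
    hfin hRπ hψ₀ hψv _ hRnat hnat hκ hψs hc hψh hψm hRs hRM hz₁
  have hρ : ∀ n, ∑ i ∈ Finset.range n, ‖Drc.markovV S π₀ i‖ ≤ Rπ₀ := by
    refine Drc.sum_norm_le_of_l1op (by rw [hRπ]; exact ENNReal.toReal_nonneg) ?_
    rw [hRπ, ENNReal.ofReal_toReal hfin]
    exact le_max_left _ _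
  have hb : ∀ n, ∑ i ∈ Finset.range n, ‖Drc.markovV S π₀ (h + 1 + i)‖ ≤ Rπ₀ / T := fun n =>
    (Drc.sum_norm_le_of_decay (hψ₀.1 _) (hψv (h + 1)) n).trans hψh
  rw [Drc.controlReg]
  refine EReal.sub_le_of_le_add' ?_
  -- Only finite quantities are moved across, leaving a lower bound on the infimum that is checked
  -- comparator by comparator; an empty class needs no separate case.
  rw [← EReal.sub_le_iff_le_add (Or.inl (EReal.coe_ne_bot _)) (Or.inl (EReal.coe_ne_top _)),
    ← EReal.coe_sub]
  refine le_iInf₂ fun π hπ => EReal.coe_le_coe_iff.2 ?_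
  have hmain := Drc.sum_loss_le (P :=
    { m := m, h := h, η := 1 / α, lam := 6 * h * Rnat ^ 2 * Rπ₀ ^ 2, RM := RM,
      Gv := Drc.markovV S π₀, Gω := Drc.markovOmega S π₀ }) rfl rfl hz₁ hα rfl rfl hℓ hdu hdω hm hh
    hT hRM hRnat (fun t ht => (hnat t ht).1) (fun t ht => (hnat t ht).2) hρ hb hκ hψs.1 hc hψm hRs
    hπ
  rw [sub_le_iff_le_add]
  exact hmain
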